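/- Let $m\ge 0$, let $R_m$ be the $\mathbb Q(q,t)$-algebra of formal power series of bounded degree in $x_1,x_2,\dots$ that are symmetric in $x_{m+1},x_{m+2},\dots$, and for $1\le i\le m-1$ let $$T_i=t+\frac{tx_i-x_{i+1}}{x_i-x_{i+1}}(K_{i,i+1}-1)$$ on $R_m$, where $K_{i,i+1}$ exchanges $x_i$ and $x_{i+1}$. An $m$-partition is a pair $\Lambda=(\boldsymbol a;\lambda)$ with $\boldsymbol a\in\mathbb Z_{\ge0}^m$ and $\lambda$ a partition; it is dominant if $a_1\ge\cdots\ge a_m$. Let $s_i$ exchange $a_i$ and $a_{i+1}$, $s_i\Lambda=(s_i\boldsymbol a;\lambda)$, and let $\boldsymbol a\cup\lambda$ be the partition formed by the entries of $\boldsymbol a$ and $\lambda$. Throughout, $\Omega=(\boldsymbol b;\mu)$ is another $m$-partition. *The basis $k_\Lambda$.* Let $H_{\boldsymbol a}(x_1,\dots,x_m;t)$ be the non-symmetric Hall–Littlewood polynomials, given by $H_{\boldsymbol a}=x^{\boldsymbol a}$ for dominant $\boldsymbol a$ and $H_{\boldsymbol a}=T_iH_{s_i\boldsymbol a}$ if $a_i<a_{i+1}$.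 Put $k_\Lambda=H_{\boldsymbol a}\,s_\lambda(x_1,x_2,\dots)$ with $s_\lambda$ the Schur function, let $\langle\cdot,\cdot\rangle_m$ be the bilinear form on $R_m$ with $\langle k_\Lambda,k_\Omega\rangle_m=\delta_{\Lambda\Omega}$, and let $T_i^*$ be the adjoint of $T_i$: $\langle T_if,g\rangle_m=\langle f,T_i^*g\rangle_m$ for all $f,g\in R_m$. *Charge.* On words, $\sigma_i$ pairs repeatedly the factors $(i+1)\,i$ of the subword in the letters $i,i+1$ and replaces the remaining unpaired subword $i^r(i+1)^s$ by $i^s(i+1)^r$. If the evaluation of a word is dominant (letter $1$ occurs at least as often as letter $2$, and so on), its charge is the sum of the labels given by the following procedure: read the word cyclically from right to left, label the first $1$, then the next $2$, then the next $3$, etc., by $\ell$, where $\ell=0$ at the start and $\ell$ increases by $1$ each time the end of the word is passed; repeat on the unlabelled letters, starting again at the right end with $\ell=0$, until all letters are labelled. The charge of a word in the letters $1,\dots,m$ is the charge of the word of dominant evaluation in its orbit under $\sigma_1,\dots,\sigma_{m-1}$. The charge of a word in letters $\bar1>\bar2>\cdots>\bar m$ is computed after the substitution $\bar\imath\mapsto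 m+1-i$. *Dual $m$-symmetric Schur functions.* For dominant $\Lambda$, let $\mathcal S_{\Lambda\Omega}$ be the set of skew tableaux $T$ of shape $(\boldsymbol a\cup\lambda)/\mu$ in the letters $1,\dots,m$ (rows weakly, columns strictly increasing) in which the letter $i$ occurs $b_i$ times and only within the first $a_i$ columns. To $T$ corresponds the skew tableau $\bar T$ of shape $\mu/\lambda$ in which $\bar\imath$ occurs in column $c$ if and only if $c\le a_i$ and $i$ is not in column $c$ of $T$. Let $w(\bar T)$ be the word of $\bar T$, reading rows from left to right, from the bottom row to the top row, let $u_{\boldsymbol a}=\bar1^{a_1-a_1}\bar2^{a_1-a_2}\cdots\bar m^{a_1-a_m}$, and put $$D_{\Lambda\Omega}(t)=\sum_{T\in\mathcal S_{\Lambda\Omega}}t^{\#\{i<j\,:\,b_i<b_j\}+\mathrm{charge}(w(\bar T)u_{\boldsymbol a})}.$$ The dual $m$-symmetric Schur functions are given by $s^*_\Lambda=\sum_\Omega D_{\Lambda\Omega}(t)\,k_\Omega$ for dominant $\Lambda$, and $s^*_\Lambda=t^{-1}T_i^*s^*_{s_i\Lambda}$ if $a_i<a_{i+1}$. The $m$-symmetric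 Schur functions $s_\Lambda\in R_m$ are given by $\langle s_\Lambda,s^*_\Omega\rangle_m=\delta_{\Lambda\Omega}$. **Statement.** The form $\langle\cdot,\cdot\rangle_m$, the adjoints $T_i^*$ and the family $(s_\Lambda)_\Lambda$ exist and are unique, and for all $1\le i\le m-1$ and all $m$-partitions $\Lambda=(\boldsymbol a;\lambda)$: $$T_ik_\Lambda=\begin{cases}k_{s_i\Lambda}&a_i>a_{i+1},\\(t-1)k_\Lambda+t\,k_{s_i\Lambda}&a_i<a_{i+1},\\t\,k_\Lambda&a_i=a_{i+1},\end{cases}\qquad T_i^*s^*_\Lambda=\begin{cases}t\,s^*_{s_i\Lambda}&a_i>a_{i+1},\\(t-1)s^*_\Lambda+s^*_{s_i\Lambda}&a_i<a_{i+1},\\t\,s^*_\Lambda&a_i=a_{i+1},\end{cases}$$ $$T_is_\Lambda=\begin{cases}s_{s_i\Lambda}&a_i>a_{i+1},\\(t-1)s_\Lambda+t\,s_{s_i\Lambda}&a_i<a_{i+1},\\t\,s_\Lambda&a_i=a_{i+1}.\end{cases}$$ In particular, $s_\Lambda$ is symmetric in $x_i,x_{i+1}$ if $a_i=a_{i+1}$.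 -/

import Mathlib

namespace MSymmetric

/-- The field of rational functions in `q` and `t`, as `ℚ(q)(t)`. -/
abbrev QT : Type := RatFunc (RatFunc ℚ)

/-- The parameter `t`. -/
noncomputable def t : QT := RatFunc.X

/-! ### The ring of `m`-symmetric functions

The variable `x_{j+1}` is `MvPowerSeries.X j`: indices of variables, of entries of compositions and
of Hecke generators start at `0`. -/

/-- The ring `R_m`: formal power series of bounded degree in `x_1, x_2, …` over `ℚ(q,t)` which are
symmetric in `x_{m+1}, x_{m+2}, …`. -/
noncomputable def SymRing (m : ℕ) : Subalgebra QT (MvPowerSeries ℕ QT) where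
  carrier := {f | (∃ D : ℕ, ∀ d : ℕ →₀ ℕ, MvPowerSeries.coeff d f ≠ 0 → d.degree ≤ D) ∧
    ∀ σ : Equiv.Perm ℕ, (∀ j < m, σ j = j) → MvPowerSeries.renameEquiv QT σ f = f}
  mul_mem' := by
    rintro f g ⟨⟨D, hD⟩, hf⟩ ⟨⟨E, hE⟩, hg⟩
    refine ⟨⟨D + E, fun d hd => ?_⟩, fun σ hσ => by rw [map_mul, hf σ hσ, hg σ hσ]⟩
    rw [MvPowerSeries.coeff_mul] at hd
    obtain ⟨p, hp, hne⟩ := Finset.exists_ne_zero_of_sum_ne_zero hd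
    rw [Finset.HasAntidiagonal.mem_antidiagonal] at hp
    rw [← hp, map_add]
    exact add_le_add (hD _ (left_ne_zero_of_mul hne)) (hE _ (right_ne_zero_of_mul hne))
  add_mem' := by
    rintro f g ⟨⟨D, hD⟩, hf⟩ ⟨⟨E, hE⟩, hg⟩
    refine ⟨⟨max D E, fun d hd => ?_⟩, fun σ hσ => by rw [map_add, hf σ hσ, hg σ hσ]⟩
    by_cases h : MvPowerSeries.coeff d f = 0
    · refine le_max_of_le_right (hE d fun h' => hd ?_)
      rw [map_add, h, h', add_zero]
    · exact le_max_of_le_left (hD d h)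
  algebraMap_mem' := by
    intro c
    refine ⟨⟨0, fun d hd => ?_⟩, fun σ _ => AlgEquiv.commutes _ c⟩
    rw [MvPowerSeries.algebraMap_apply, MvPowerSeries.coeff_C] at hd
    by_cases h : d = 0
    · simp [h]
    · simp [h] at hd

/-- The variable `x_{j+1}`, for `j < m`, as an element of `R_m`. -/
noncomputable def x {m : ℕ} (j : Fin m) : SymRing m :=
  ⟨MvPowerSeries.X (j : ℕ), ⟨1, fun d hd => by
      rw [MvPowerSeries.coeff_X] at hd
      have h : d = Finsupp.single (j : ℕ) 1 := by
        by_contra h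
        simp [h] at hd
      simp [h]⟩,
    fun σ hσ => by simp [hσ j j.isLt]⟩

/-- The complete homogeneous symmetric function `h_r(x_1, x_2, …)`. -/
noncomputable def hSym (m r : ℕ) : SymRing m :=
  ⟨fun d => if d.degree = r then 1 else 0, ⟨r, fun d hd => by
      have h : MvPowerSeries.coeff d (fun d : ℕ →₀ ℕ => if d.degree = r then (1 : QT) else 0) =
        if d.degree = r then 1 else 0 := rfl
      rw [h] at hd
      by_contra h'
      rw [if_neg (by omega)] at hd
      exact hd rfl⟩,
    fun σ _ => by
      ext d
      obtain ⟨e, rfl⟩ : ∃ e, d = Finsupp.embDomain σ.toEmbedding e :=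
        ⟨Finsupp.mapDomain σ.symm d, by
          rw [Finsupp.embDomain_eq_mapDomain, ← Finsupp.mapDomain_comp]
          simp⟩
      have := MvPowerSeries.coeff_embDomain_rename σ.toEmbedding
        (fun d : ℕ →₀ ℕ => if d.degree = r then (1 : QT) else 0) e
      refine this.trans ?_
      change (if e.degree = r then (1 : QT) else 0) = if _ = r then 1 else 0
      rw [Finsupp.embDomain_eq_mapDomain, Finsupp.degree_mapDomain]⟩

/-! ### The Hecke generators

Throughout, the generator `T_{i+1}` is indexed by `i : ℕ` with `i + 1 < m`; it involves the
variables `x_{i+1} = x ⟨i, _⟩` and `x_{i+2} = x ⟨i + 1, _⟩`. -/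

/-- The operator `K_{i,i+1}` exchanging two consecutive variables among `x_1, …, x_m`. -/
noncomputable def swapVar {m : ℕ} (i : ℕ) (hi : i + 1 < m) (f : SymRing m) : SymRing m :=
  ⟨MvPowerSeries.renameEquiv QT (Equiv.swap i (i + 1)) f, by
    obtain ⟨f, ⟨D, hD⟩, hf⟩ := f
    refine ⟨⟨D, fun d hd => ?_⟩, fun σ hσ => ?_⟩
    · obtain ⟨e, rfl⟩ : ∃ e, d = Finsupp.embDomain (Equiv.swap i (i + 1)).toEmbedding e :=
        ⟨Finsupp.mapDomain (Equiv.swap i (i + 1)).symm d, by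
          rw [Finsupp.embDomain_eq_mapDomain, ← Finsupp.mapDomain_comp,
            Equiv.coe_toEmbedding, Equiv.self_comp_symm, Finsupp.mapDomain_id]⟩
      have h := MvPowerSeries.coeff_embDomain_rename (Equiv.swap i (i + 1)).toEmbedding f e
      rw [Finsupp.embDomain_eq_mapDomain, Finsupp.degree_mapDomain]
      exact hD e (h ▸ hd)
    · have hc : (Equiv.swap i (i + 1)).trans σ = σ.trans (Equiv.swap i (i + 1)) := by
        ext j
        have h0 := hσ i (by omega)
        have h1 := hσ (i + 1) hi
        rcases eq_or_ne j i with rfl | hj0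
        · simp [h0, h1]
        rcases eq_or_ne j (i + 1) with rfl | hj1
        · simp [h0, h1]
        have g0 : σ j ≠ i := fun h => hj0 (σ.injective (h.trans h0.symm))
        have g1 : σ j ≠ i + 1 := fun h => hj1 (σ.injective (h.trans h1.symm))
        simp [Equiv.swap_apply_of_ne_of_ne, hj0, hj1, g0, g1]
      have h2 := congrArg (fun e => MvPowerSeries.renameEquiv QT e f) hc
      rw [← MvPowerSeries.renameEquiv_trans, ← MvPowerSeries.renameEquiv_trans] at h2
      simp only [AlgEquiv.trans_apply] at h2
      rw [h2, hf σ hσ]⟩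

/-- The quotient `(K f - f) / (X i - X (i + 1))` of power series, coefficient by coefficient. -/
noncomputable def quotSeries (i : ℕ) (f : MvPowerSeries ℕ QT) : MvPowerSeries ℕ QT := fun e =>
  ∑ k ∈ Finset.range (min (e i) (e (i + 1)) + 1),
    (MvPowerSeries.coeff ((e.update i k).update (i + 1) (e i + e (i + 1) + 1 - k)) f -
      MvPowerSeries.coeff ((e.update i (e i + e (i + 1) + 1 - k)).update (i + 1) k) f)

theorem quotSeries_mul (i : ℕ) (f : MvPowerSeries ℕ QT) :
    (MvPowerSeries.X i - MvPowerSeries.X (i + 1)) * quotSeries i f =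
      MvPowerSeries.renameEquiv QT (Equiv.swap i (i + 1)) f - f := by
  have hupd : ∀ (e e' : ℕ →₀ ℕ) (u v : ℕ), (∀ n, n ≠ i → n ≠ i + 1 → e n = e' n) →
      (e.update i u).update (i + 1) v = (e'.update i u).update (i + 1) v := by
    intro e e' u v h
    ext n
    simp only [Finsupp.coe_update, Function.update_apply]
    split_ifs with h1 h2
    · rfl
    · rfl
    · exact h n h2 h1
  ext e
  set D : ℕ → QT := fun k =>
    MvPowerSeries.coeff ((e.update i k).update (i + 1) (e i + e (i + 1) - k)) f -
      MvPowerSeries.coeff ((e.update i (e i + e (i + 1) - k)).update (i + 1) k) f with hD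
  have h1 : MvPowerSeries.coeff e (MvPowerSeries.X i * quotSeries i f) =
      ∑ k ∈ Finset.range (min (e i) (e (i + 1) + 1)), D k := by
    rw [MvPowerSeries.X, MvPowerSeries.coeff_monomial_mul, one_mul]
    split_ifs with h
    · have hpos : 1 ≤ e i := by simpa using h i
      have hi0 : (e - Finsupp.single i 1 : ℕ →₀ ℕ) i = e i - 1 := by simp
      have hi1 : (e - Finsupp.single i 1 : ℕ →₀ ℕ) (i + 1) = e (i + 1) := by simp
      rw [MvPowerSeries.coeff_apply, quotSeries, hi0, hi1,
        show min (e i - 1) (e (i + 1)) + 1 = min (e i) (e (i + 1) + 1) by omega,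
        show e i - 1 + e (i + 1) + 1 = e i + e (i + 1) by omega]
      refine Finset.sum_congr rfl fun k _ => ?_
      have hn : ∀ n, n ≠ i → n ≠ i + 1 → (e - Finsupp.single i 1 : ℕ →₀ ℕ) n = e n := by
        intro n h0 h1
        simp [h0.symm]
      rw [hupd _ e _ _ hn, hupd _ e _ _ hn]
    · have hz : e i = 0 := by
        by_contra h0
        exact h (Finsupp.single_le_iff.2 (Nat.one_le_iff_ne_zero.2 h0))
      simp [hz]
  have h2 : MvPowerSeries.coeff e (MvPowerSeries.X (i + 1) * quotSeries i f) =
      ∑ k ∈ Finset.range (min (e i + 1) (e (i + 1))), D k := by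
    rw [MvPowerSeries.X, MvPowerSeries.coeff_monomial_mul, one_mul]
    split_ifs with h
    · have hpos : 1 ≤ e (i + 1) := by simpa using h (i + 1)
      have hi0 : (e - Finsupp.single (i + 1) 1 : ℕ →₀ ℕ) i = e i := by simp
      have hi1 : (e - Finsupp.single (i + 1) 1 : ℕ →₀ ℕ) (i + 1) = e (i + 1) - 1 := by simp
      rw [MvPowerSeries.coeff_apply, quotSeries, hi0, hi1,
        show min (e i) (e (i + 1) - 1) + 1 = min (e i + 1) (e (i + 1)) by omega,
        show e i + (e (i + 1) - 1) + 1 = e i + e (i + 1) by omega]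
      refine Finset.sum_congr rfl fun k _ => ?_
      have hn : ∀ n, n ≠ i → n ≠ i + 1 → (e - Finsupp.single (i + 1) 1 : ℕ →₀ ℕ) n = e n := by
        intro n h0 h1
        simp [h1.symm]
      rw [hupd _ e _ _ hn, hupd _ e _ _ hn]
    · have hz : e (i + 1) = 0 := by
        by_contra h0
        exact h (Finsupp.single_le_iff.2 (Nat.one_le_iff_ne_zero.2 h0))
      simp [hz]
  have h3 : MvPowerSeries.coeff e (MvPowerSeries.renameEquiv QT (Equiv.swap i (i + 1)) f) =
      MvPowerSeries.coeff ((e.update i (e (i + 1))).update (i + 1) (e i)) f := by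
    have h := MvPowerSeries.coeff_embDomain_rename (Equiv.swap i (i + 1)).toEmbedding f
      ((e.update i (e (i + 1))).update (i + 1) (e i))
    have he : Finsupp.embDomain (Equiv.swap i (i + 1)).toEmbedding
        ((e.update i (e (i + 1))).update (i + 1) (e i)) = e := by
      ext n
      obtain ⟨n, rfl⟩ := (Equiv.swap i (i + 1)).surjective n
      refine (Finsupp.embDomain_apply_self _ _ n).trans ?_
      simp only [Finsupp.coe_update, Function.update_apply]
      split_ifs with g1 g2
      · simp [g1]
      · simp [g2]
      · rw [Equiv.swap_apply_of_ne_of_ne g2 g1]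
    rw [he] at h
    exact h
  have h4 : (e.update i (e i)).update (i + 1) (e (i + 1)) = e := by
    rw [Finsupp.update_self, Finsupp.update_self]
  rw [sub_mul, map_sub, map_sub, h1, h2, h3]
  rcases lt_trichotomy (e i) (e (i + 1)) with h | h | h
  · rw [show min (e i) (e (i + 1) + 1) = e i by omega,
      show min (e i + 1) (e (i + 1)) = e i + 1 by omega, Finset.sum_range_succ, hD]
    simp only [Nat.add_sub_cancel_left, h4]
    ring
  · rw [show min (e i) (e (i + 1) + 1) = e i by omega,
      show min (e i + 1) (e (i + 1)) = e i by omega]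
    conv_rhs => rw [← h, Finsupp.update_self, h, Finsupp.update_self]
    ring
  · rw [show min (e i) (e (i + 1) + 1) = e (i + 1) + 1 by omega,
      show min (e i + 1) (e (i + 1)) = e (i + 1) by omega, Finset.sum_range_succ, hD]
    simp only [Nat.add_sub_cancel, h4]
    ring

theorem degree_update_update (i : ℕ) (e : ℕ →₀ ℕ) (u v : ℕ) :
    ((e.update i u).update (i + 1) v).degree + (e i + e (i + 1)) = e.degree + (u + v) := by
  have key : ∀ (e : ℕ →₀ ℕ) (n u : ℕ), (e.update n u).degree + e n = e.degree + u := by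
    intro e n u
    have h1 : e.update n u = e.erase n + Finsupp.single n u := by
      rw [Finsupp.update_eq_erase_add_single]
    have h2 : e = e.erase n + Finsupp.single n (e n) := (Finsupp.erase_add_single n e).symm
    have h3 : e.degree = (e.erase n).degree + e n := by
      conv_lhs => rw [h2]
      simp
    rw [h1, h3]
    simp
    omega
  have h1 := key e i u
  have h2 := key (e.update i u) (i + 1) v
  have h3 : (e.update i u) (i + 1) = e (i + 1) := by simp
  omega

/-- `x_{i+1} - x_{i+2}` divides `K f - f`, where `K` exchanges the two variables. -/
theorem exists_divDiff {m : ℕ} (i : ℕ) (hi : i + 1 < m) (f : SymRing m) :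
    ∃ g : SymRing m, (x ⟨i, by omega⟩ - x ⟨i + 1, hi⟩) * g = swapVar i hi f - f := by
  have hspec := quotSeries_mul i f.1
  refine ⟨⟨quotSeries i f.1, ?_, fun σ hσ => ?_⟩, Subtype.ext hspec⟩
  · obtain ⟨D, hD⟩ := f.2.1
    refine ⟨D, fun e he => ?_⟩
    obtain ⟨k, hk, hne⟩ := Finset.exists_ne_zero_of_sum_ne_zero (s := Finset.range _) he
    rw [Finset.mem_range] at hk
    have hk' : k ≤ e i + e (i + 1) := by omega
    by_cases h : MvPowerSeries.coeff
        ((e.update i k).update (i + 1) (e i + e (i + 1) + 1 - k)) f.1 = 0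
    · rw [h, zero_sub, neg_ne_zero] at hne
      have := hD _ hne
      have := degree_update_update i e (e i + e (i + 1) + 1 - k) k
      omega
    · have := hD _ h
      have := degree_update_update i e k (e i + e (i + 1) + 1 - k)
      omega
  · have hX : ∀ j < m, MvPowerSeries.renameEquiv QT σ (MvPowerSeries.X j) =
        (MvPowerSeries.X j : MvPowerSeries ℕ QT) := fun j hj => by simp [hσ j hj]
    have h := congrArg (MvPowerSeries.renameEquiv QT σ) hspec
    have hsw : MvPowerSeries.renameEquiv QT σ
        (MvPowerSeries.renameEquiv QT (Equiv.swap i (i + 1)) f.1) =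
          MvPowerSeries.renameEquiv QT (Equiv.swap i (i + 1)) f.1 := (swapVar i hi f).2.2 σ hσ
    rw [map_mul, map_sub, map_sub, hX i (by omega), hX (i + 1) hi,
      hsw, f.2.2 σ hσ] at h
    refine mul_left_cancel₀ (fun h0 => ?_) (h.trans hspec.symm)
    have h' := congrArg (MvPowerSeries.coeff (Finsupp.single i 1)) h0
    simp [MvPowerSeries.coeff_X, Finsupp.single_left_inj] at h'

theorem x_sub_x_ne_zero {m : ℕ} (i : ℕ) (hi : i + 1 < m) :
    (x ⟨i, by omega⟩ - x ⟨i + 1, hi⟩ : SymRing m) ≠ 0 := by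
  intro h
  have h' := congrArg (fun f : SymRing m => MvPowerSeries.coeff (Finsupp.single i 1) f.1) h
  simp [x, MvPowerSeries.coeff_X, Finsupp.single_left_inj] at h'

/-- The quotient `(K f - f) / (x_{i+1} - x_{i+2})`. -/
noncomputable def divDiff {m : ℕ} (i : ℕ) (hi : i + 1 < m) (f : SymRing m) : SymRing m :=
  (exists_divDiff i hi f).choose

theorem divDiff_spec {m : ℕ} (i : ℕ) (hi : i + 1 < m) (f : SymRing m) :
    (x ⟨i, by omega⟩ - x ⟨i + 1, hi⟩) * divDiff i hi f = swapVar i hi f - f :=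
  (exists_divDiff i hi f).choose_spec

/-- The Hecke generator `T = t + (t x_{i+1} - x_{i+2}) / (x_{i+1} - x_{i+2}) (K - 1)` on `R_m`. -/
noncomputable def heckeT {m : ℕ} (i : ℕ) (hi : i + 1 < m) : SymRing m →ₗ[QT] SymRing m where
  toFun f := t • f + (t • x ⟨i, by omega⟩ - x ⟨i + 1, hi⟩) * divDiff i hi f
  map_add' f g := by
    have h : divDiff i hi (f + g) = divDiff i hi f + divDiff i hi g := by
      refine mul_left_cancel₀ (x_sub_x_ne_zero i hi) ?_
      have hs : swapVar i hi (f + g) = swapVar i hi f + swapVar i hi g :=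
        Subtype.ext (map_add (MvPowerSeries.renameEquiv QT (Equiv.swap i (i + 1))) f.1 g.1)
      rw [mul_add, divDiff_spec, divDiff_spec, divDiff_spec, hs]
      ring
    rw [h, smul_add]
    ring
  map_smul' c f := by
    have h : divDiff i hi (c • f) = c • divDiff i hi f := by
      refine mul_left_cancel₀ (x_sub_x_ne_zero i hi) ?_
      have hs : swapVar i hi (c • f) = c • swapVar i hi f :=
        Subtype.ext (map_smul (MvPowerSeries.renameEquiv QT (Equiv.swap i (i + 1))) c f.1)
      rw [mul_smul_comm, divDiff_spec, divDiff_spec, hs, smul_sub]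
    rw [h, RingHom.id_apply, smul_add, mul_smul_comm, smul_comm]

/-! ### `m`-partitions and the basis `k_Λ(x;t)` -/

/-- An `m`-partition `Λ = (a; λ)`: a composition `a` with `m` parts and a partition `λ`. -/
@[ext]
structure MPartition (m : ℕ) where
  comp : Fin m → ℕ
  part : YoungDiagram

/-- `s_i a`: the composition `a` with two consecutive entries exchanged. -/
def swapComp {m : ℕ} (i : ℕ) (hi : i + 1 < m) (a : Fin m → ℕ) : Fin m → ℕ :=
  a ∘ Equiv.swap ⟨i, by omega⟩ ⟨i + 1, hi⟩

/-- `s_i Λ = (s_i a; λ)`. -/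
def MPartition.swap {m : ℕ} (i : ℕ) (hi : i + 1 < m) (Λ : MPartition m) : MPartition m :=
  ⟨swapComp i hi Λ.comp, Λ.part⟩

/-- Exchanging an ascent `a_i < a_{i+1}` decreases `∑ j a_j`; the two recursions below, which
remove ascents one by one until the composition is dominant, terminate. -/
theorem weight_swapComp_lt {m : ℕ} (i : ℕ) (hi : i + 1 < m) (a : Fin m → ℕ)
    (h : a ⟨i, by omega⟩ < a ⟨i + 1, hi⟩) :
    ∑ j : Fin m, (j : ℕ) * swapComp i hi a j < ∑ j : Fin m, (j : ℕ) * a j := by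
  have hne : (⟨i + 1, hi⟩ : Fin m) ≠ ⟨i, by omega⟩ := by simp
  have hq : (⟨i + 1, hi⟩ : Fin m) ∈ Finset.univ.erase (⟨i, by omega⟩ : Fin m) := by simp
  rw [← Finset.add_sum_erase _ _ (Finset.mem_univ (⟨i, by omega⟩ : Fin m)),
    ← Finset.add_sum_erase _ _ hq,
    ← Finset.add_sum_erase _ (fun j : Fin m => (j : ℕ) * a j)
      (Finset.mem_univ (⟨i, by omega⟩ : Fin m)), ← Finset.add_sum_erase _ _ hq]
  have hrest : ∀ j ∈ (Finset.univ.erase (⟨i, by omega⟩ : Fin m)).erase ⟨i + 1, hi⟩,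
      (j : ℕ) * swapComp i hi a j = (j : ℕ) * a j := by
    intro j hj
    simp only [Finset.mem_erase, Finset.mem_univ, and_true] at hj
    simp [swapComp, Equiv.swap_apply_of_ne_of_ne hj.2 hj.1]
  rw [Finset.sum_congr rfl hrest]
  simp only [swapComp, Function.comp_apply, Equiv.swap_apply_left, Equiv.swap_apply_right]
  nlinarith

open Classical in
/-- The non-symmetric Hall-Littlewood polynomial `H_a(x_1, …, x_m; t)`: it is `x^a` if `a` is
dominant (that is, has no ascent), and `H_a = T_i H_{s_i a}` if `a_i < a_{i+1}`. -/
noncomputable def hallLittlewood {m : ℕ} (a : Fin m → ℕ) : SymRing m :=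
  if h : ∃ i, ∃ hi : i + 1 < m, a ⟨i, by omega⟩ < a ⟨i + 1, hi⟩ then
    heckeT h.choose h.choose_spec.choose
      (hallLittlewood (swapComp h.choose h.choose_spec.choose a))
  else ∏ j, x j ^ a j
termination_by ∑ j : Fin m, (j : ℕ) * a j
decreasing_by exact weight_swapComp_lt _ _ _ h.choose_spec.choose_spec

/-- The Schur function `s_λ(x_1, x_2, …) = det (h_{λ_i - i + j})`, with `h_r = 0` for `r < 0`. -/
noncomputable def schur (m : ℕ) (lam : YoungDiagram) : SymRing m :=
  Matrix.det (Matrix.of fun i j : Fin (lam.colLen 0) =>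
    if (i : ℕ) ≤ lam.rowLen i + j then hSym m (lam.rowLen i + j - i) else 0)

/-- `k_Λ(x;t) = H_a(x_1, …, x_m; t) s_λ(x)`. -/
noncomputable def kFun {m : ℕ} (Λ : MPartition m) : SymRing m :=
  hallLittlewood Λ.comp * schur m Λ.part

/-! ### The scalar product and the adjoint operators -/

open Classical in
/-- The property `⟨k_Λ, k_Ω⟩_m = δ_{ΛΩ}` that defines the scalar product on `R_m`. -/
def IsScalarProduct (m : ℕ) (B : LinearMap.BilinForm QT (SymRing m)) : Prop :=
  ∀ Λ Ω : MPartition m, B (kFun Λ) (kFun Ω) = if Λ = Ω then 1 else 0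

/-- The scalar product `⟨·,·⟩_m`: the bilinear form for which the `k_Λ(x;t)` are orthonormal. -/
noncomputable def scalarProduct (m : ℕ) : LinearMap.BilinForm QT (SymRing m) :=
  Classical.epsilon (IsScalarProduct m)

/-- The property `⟨T_i f, g⟩_m = ⟨f, S g⟩_m` that defines the adjoint `S = T_i^*`. -/
def IsHeckeAdjoint {m : ℕ} (i : ℕ) (hi : i + 1 < m) (S : SymRing m →ₗ[QT] SymRing m) : Prop :=
  ∀ f g : SymRing m, scalarProduct m (heckeT i hi f) g = scalarProduct m f (S g)

/-- The adjoint `T_i^*` of `T_i`. -/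
noncomputable def heckeTStar {m : ℕ} (i : ℕ) (hi : i + 1 < m) : SymRing m →ₗ[QT] SymRing m :=
  Classical.epsilon (IsHeckeAdjoint i hi)

/-! ### Words, the action of the symmetric group on words, charge -/

/-- Scan of a word from left to right that pairs each letter `i` with the nearest unpaired letter
`i + 1` on its left. Here `p` is the current position, `opened` are the positions of the letters
`i + 1` that are still unpaired, `free` those of the letters `i` that stay unpaired, both with the
most recent one first. -/
def pairScan (i : ℕ) : List ℕ → ℕ → List ℕ → List ℕ → List ℕ × List ℕ
  | [], _, opened, free => (free, opened)
  | c :: w, p, opened, free =>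
    if c = i + 1 then pairScan i w (p + 1) (p :: opened) free
    else if c = i then
      match opened with
      | [] => pairScan i w (p + 1) [] (p :: free)
      | _ :: opened' => pairScan i w (p + 1) opened' free
    else pairScan i w (p + 1) opened free

/-- The operator `σ_i` on words: once the factors `(i+1) i` have been paired repeatedly, the
unpaired letters `i` and `i + 1` form a subword `i^r (i+1)^s`, which is replaced by `i^s (i+1)^r`. -/
def wordSwap (i : ℕ) (w : List ℕ) : List ℕ :=
  let free := (pairScan i w 0 [] []).1.reverse
  let opened := (pairScan i w 0 [] []).2.reverse
  let unpaired := free ++ opened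
  w.mapIdx fun p c =>
    if p ∈ unpaired.take opened.length then i
    else if p ∈ unpaired.drop opened.length then i + 1
    else c

/-- The labelling that computes the charge, started in the middle: `S` is the set of positions not
yet labelled, `c` the next letter to label, `p` the position reached (the word being read from right
to left, cyclically) and `l` the current label. The value is the sum of the labels still to come. -/
def chargeAux (w : List ℕ) (S : Finset ℕ) (c p l : ℕ) : ℕ :=
  if hS : ∃ j ∈ S, w.getD j 0 = c then
    if hp : ∃ j ∈ S, w.getD j 0 = c ∧ j < p then
      let j := (S.filter fun j => w.getD j 0 = c ∧ j < p).sup id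
      l + chargeAux w (S.erase j) (c + 1) j l
    else
      let j := (S.filter fun j => w.getD j 0 = c).sup id
      (l + 1) + chargeAux w (S.erase j) (c + 1) j (l + 1)
  else if 1 < c then chargeAux w S 1 w.length 0
  else 0
termination_by (S.card, c)
decreasing_by
  · obtain ⟨j, hj⟩ := hp
    have hm := Finset.exists_mem_eq_sup (S.filter fun j => w.getD j 0 = c ∧ j < p)
      ⟨j, by simpa using hj⟩ id
    obtain ⟨j', hj', he⟩ := hm
    exact Prod.Lex.left _ _ (Finset.card_erase_lt_of_mem
      (by rw [he]; exact (Finset.mem_filter.1 hj').1))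
  · obtain ⟨j, hj⟩ := hS
    have hm := Finset.exists_mem_eq_sup (S.filter fun j => w.getD j 0 = c)
      ⟨j, by simpa using hj⟩ id
    obtain ⟨j', hj', he⟩ := hm
    exact Prod.Lex.left _ _ (Finset.card_erase_lt_of_mem
      (by rw [he]; exact (Finset.mem_filter.1 hj').1))
  · exact Prod.Lex.right _ (by omega)

/-- The charge of a word of dominant evaluation. -/
def dominantCharge (w : List ℕ) : ℕ := chargeAux w (Finset.range w.length) 1 w.length 0

/-- The evaluation of a word in the letters `1, …, m` is dominant. -/
def DominantWord (m : ℕ) (w : List ℕ) : Prop :=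
  ∀ c, 1 ≤ c → c < m → w.count (c + 1) ≤ w.count c

/-- `w'` is obtained from `w` by applying `σ_1, …, σ_{m-1}` finitely many times. -/
def SameOrbit (m : ℕ) (w w' : List ℕ) : Prop :=
  Relation.ReflTransGen (fun u v => ∃ i, 1 ≤ i ∧ i < m ∧ v = wordSwap i u) w w'

/-- The charge of a word `w` in the letters `1, …, m`: the charge of the word of dominant evaluation
in the orbit of `w` under the symmetric group. -/
noncomputable def charge (m : ℕ) (w : List ℕ) : ℕ :=
  dominantCharge (Classical.epsilon fun w' => SameOrbit m w w' ∧ DominantWord m w')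

/-! ### Skew tableaux -/

/-- A skew tableau of shape `ν/μ` with positive integer entries (and `0` outside of the shape),
weakly increasing along rows and strictly increasing down columns. -/
structure SkewTableau (ν μ : YoungDiagram) where
  entry : ℕ → ℕ → ℕ
  le : μ ≤ ν
  entry_pos : ∀ r c, (r, c) ∈ ν → (r, c) ∉ μ → 1 ≤ entry r c
  entry_zero : ∀ r c, ¬((r, c) ∈ ν ∧ (r, c) ∉ μ) → entry r c = 0
  row_weak : ∀ r c c', c < c' → (r, c) ∉ μ → (r, c') ∈ ν → entry r c ≤ entry r c'
  col_strict : ∀ r r' c, r < r' → (r, c) ∉ μ → (r', c) ∈ ν → entry r c < entry r' c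

/-- `a ∪ λ`: the partition whose parts are the entries of `a` and the parts of `λ`. -/
noncomputable def unionPart {m : ℕ} (a : Fin m → ℕ) (lam : YoungDiagram) : YoungDiagram :=
  YoungDiagram.ofRowLens
    ((↑(List.ofFn a ++ lam.rowLens) : Multiset ℕ).sort (· ≥ ·))
    (List.sortedGE_iff_pairwise.2 (Multiset.pairwise_sort _ _))

/-- The set `𝒮_{ΛΩ}`: skew tableaux of shape `(a ∪ λ)/μ` such that the letter `i` occurs `b_i` times
and always within the first `a_i` columns (letters are `1, …, m`). -/
def tableaux {m : ℕ} (Λ Ω : MPartition m) :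
    Set (SkewTableau (unionPart Λ.comp Λ.part) Ω.part) :=
  {T | (∀ r c, T.entry r c ≤ m) ∧ ∀ i : Fin m,
    {p : ℕ × ℕ | T.entry p.1 p.2 = i + 1}.ncard = Ω.comp i ∧
    ∀ r c, T.entry r c = i + 1 → c < Λ.comp i}

/-- The entry in row `r` and column `c` of the complementary skew tableau `T̄` of shape `μ/λ`. Column
`c` of `T̄` consists of the `ī` with `c ≤ a_i` (columns counted from `1`) such that `i` is not in
column `c` of `T`. As `1̄ > 2̄ > ⋯ > m̄`, the letter `ī` is written `m + 1 - i`, and column `c`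
is increasing from its top cell, which lies just below `λ`. -/
noncomputable def barEntry {m : ℕ} (a : Fin m → ℕ) (lam : YoungDiagram) (T : ℕ → ℕ → ℕ) (r c : ℕ) : ℕ :=
  open Classical in
  (((Finset.univ.filter fun i : Fin m => c < a i ∧ ∀ r', T r' c ≠ i + 1).image
    fun i => m - (i : ℕ)).sort (· ≤ ·)).getD (r - lam.colLen c) 0

/-- The word of `T̄`: its rows, of shape `μ/λ`, read from left to right, from bottom to top. -/
noncomputable def barWord {m : ℕ} (Λ Ω : MPartition m) (T : ℕ → ℕ → ℕ) : List ℕ :=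
  (List.range (Ω.part.colLen 0)).reverse.flatMap fun r =>
    ((List.range (Ω.part.rowLen r)).filter fun c => decide (Λ.part.rowLen r ≤ c)).map fun c =>
      barEntry Λ.comp Λ.part T r c

/-- For a dominant composition `a`, the word `u_a`: the product over `j` of the
`j̄^{a_1 - a_j}`. -/
def uWord {m : ℕ} (a : Fin m → ℕ) : List ℕ :=
  (List.finRange m).flatMap fun j => List.replicate (a ⟨0, j.pos⟩ - a j) (m - (j : ℕ))

/-- `Inv(b)`, the number of `i < j` with `b_i < b_j`. -/
def inv {m : ℕ} (b : Fin m → ℕ) : ℕ :=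
  (Finset.univ.filter fun p : Fin m × Fin m => p.1 < p.2 ∧ b p.1 < b p.2).card

/-- `charge_{a,b}(T) = Inv(b) + charge(T̄ u_a)`. -/
noncomputable def tableauCharge {m : ℕ} (Λ Ω : MPartition m) (T : ℕ → ℕ → ℕ) : ℕ :=
  inv Ω.comp + charge m (barWord Λ Ω T ++ uWord Λ.comp)

/-- For dominant `Λ`, the coefficient `D_{ΛΩ}(t)`, the sum of `t^{charge_{a,b}(T)}` over the
(finite) set `𝒮_{ΛΩ}`. -/
noncomputable def dCoeff {m : ℕ} (Λ Ω : MPartition m) : QT :=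
  ∑ᶠ T ∈ tableaux Λ Ω, t ^ tableauCharge Λ Ω T.entry

/-! ### The dual `m`-symmetric Schur functions and the `m`-symmetric Schur functions -/

open Classical in
/-- The dual `m`-symmetric Schur function `s^*_Λ(x;t)`: it is `∑_Ω D_{ΛΩ}(t) k_Ω(x;t)` (a finite
sum) if `Λ` is dominant, and `s^*_Λ = t⁻¹ T_i^* s^*_{s_i Λ}` if `a_i < a_{i+1}`. -/
noncomputable def dualSchur {m : ℕ} (Λ : MPartition m) : SymRing m :=
  if h : ∃ i, ∃ hi : i + 1 < m, Λ.comp ⟨i, by omega⟩ < Λ.comp ⟨i + 1, hi⟩ then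
    t⁻¹ • heckeTStar h.choose h.choose_spec.choose
      (dualSchur (Λ.swap h.choose h.choose_spec.choose))
  else ∑ᶠ Ω, dCoeff Λ Ω • kFun Ω
termination_by ∑ j : Fin m, (j : ℕ) * Λ.comp j
decreasing_by exact weight_swapComp_lt _ _ _ h.choose_spec.choose_spec

open Classical in
/-- The property `⟨s_Λ, s^*_Ω⟩_m = δ_{ΛΩ}` that defines the `m`-symmetric Schur functions. -/
def IsMSchurFamily (m : ℕ) (s : MPartition m → SymRing m) : Prop :=
  ∀ Λ Ω : MPartition m, scalarProduct m (s Λ) (dualSchur Ω) = if Λ = Ω then 1 else 0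

/-- The `m`-symmetric Schur functions `s_Λ(x;t)`: the family dual to the `s^*_Λ(x;t)`. -/
noncomputable def mSchur {m : ℕ} : MPartition m → SymRing m :=
  Classical.epsilon (IsMSchurFamily m)

end MSymmetric

/-!
The Hecke generators satisfy the quadratic, commutation and braid relations; these are checked after
clearing denominators. Whenever operators satisfying the braid relations build a family indexed by
compositions by removing one ascent at a time, the family does not depend on the ascents chosen,
provided that the members with dominant index behave well at equal consecutive entries
(`ascent_recursion`). For the polynomials `H_a` this condition is the symmetry of `x^a`, and the
action of `T_i` on `k_Λ` follows.

The `k_Λ` form a basis of `R_m` (`kBasis`): the coefficients at the monomials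
`x^b x_{m+1}^{ν_1} x_{m+2}^{ν_2} ⋯` are triangular, since `H_a` is `x^a` plus monomials with a smaller
sum of squares of the exponents (`coeff_hallLittlewood`), and since in the Jacobi–Trudi determinant
one variable after the other can be split off (`coeff_mul_jacobiTrudi`); in each degree there are as
many `k_Λ` as coefficients that determine an element of `R_m`. So the scalar product and the adjoints
exist and are unique.

For the dual Schur functions the recursion is applied to `t⁻¹ T_i^*`, and the condition to be checked
is `T_i^* s^*_Λ = t s^*_Λ` for dominant `Λ` with `a_i = a_{i+1}`. By the action of `T_i` on the `k_Ω`
this means that exchanging `b_i > b_{i+1}` multiplies `D_{ΛΩ}` by `t` (`dCoeff_swap`). As `Inv(b)`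
increases by one, a bijection between the two sets of tableaux which preserves the charge is needed.
It applies the operator `σ_i` to the word formed by those letters `i`, `i + 1` which are alone in
their columns, the columns being read from left to right (`SkewTableau.swapLetters`). In the
complementary tableau the letters that stand for `i` and `i + 1` are alone in the same columns, hence
they are exchanged in the same way (`barTableau_swapLetters`). In the row reading of the
complementary tableau a letter `j` above a `j + 1` is paired with some `j + 1` below a `j`, and the
other letters are met from left to right (`SkewTableau.labelScan_readCells`); moreover the two letters
are paired within `u_a`. Therefore the word of the complementary tableau followed by `u_a` undergoes
an operator `σ_j`, under which the charge is invariant by definition.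

Finally `D_{ΛΩ} ≠ 0` forces `Ω` to have the size of `Λ` and, unless `Ω = Λ`, a smaller sum of `b`,
whereas `D_{ΛΛ}` is a power of `t`. Hence the `s^*_Λ` form a basis (`dualBasis`) whose dual family
consists of elements of `R_m`, the functions `s_Λ`, and the action of `T_i` on these is the transpose
of the action of `T_i^*`. An eigenvector of `T_i` with eigenvalue `t` is symmetric in `x_i, x_{i+1}`.
-/

namespace MSymmetric

/-! ### Relations between the Hecke generators -/

/-- The exchange of two consecutive variables as an algebra homomorphism. -/
noncomputable def swapHom {m : ℕ} (i : ℕ) (hi : i + 1 < m) : SymRing m →ₐ[QT] SymRing m where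
  toFun := swapVar i hi
  map_one' := Subtype.ext (map_one (MvPowerSeries.renameEquiv QT (Equiv.swap i (i + 1))))
  map_mul' f g := Subtype.ext
    (map_mul (MvPowerSeries.renameEquiv QT (Equiv.swap i (i + 1))) f.1 g.1)
  map_zero' := Subtype.ext (map_zero (MvPowerSeries.renameEquiv QT (Equiv.swap i (i + 1))))
  map_add' f g := Subtype.ext
    (map_add (MvPowerSeries.renameEquiv QT (Equiv.swap i (i + 1))) f.1 g.1)
  commutes' c := Subtype.ext
    (AlgEquiv.commutes (MvPowerSeries.renameEquiv QT (Equiv.swap i (i + 1))) c)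

theorem swapHom_apply {m : ℕ} (i : ℕ) (hi : i + 1 < m) (f : SymRing m) :
    swapHom i hi f = swapVar i hi f := rfl

theorem swapHom_x {m : ℕ} (i : ℕ) (hi : i + 1 < m) (j : Fin m) :
    swapHom i hi (x j) = x (Equiv.swap ⟨i, by omega⟩ ⟨i + 1, hi⟩ j) := by
  apply Subtype.ext
  refine (MvPowerSeries.rename_X (R := QT) (Equiv.swap i (i + 1)) (j : ℕ)).trans ?_
  change MvPowerSeries.X _ = MvPowerSeries.X _
  congr 1
  simp only [Equiv.swap_apply_def, Fin.ext_iff]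
  split_ifs <;> simp_all

theorem swapHom_x_left {m : ℕ} (i : ℕ) (hi : i + 1 < m) :
    swapHom i hi (x ⟨i, by omega⟩) = x ⟨i + 1, hi⟩ := by
  rw [swapHom_x, Equiv.swap_apply_left]

theorem swapHom_x_right {m : ℕ} (i : ℕ) (hi : i + 1 < m) :
    swapHom i hi (x ⟨i + 1, hi⟩) = x ⟨i, by omega⟩ := by
  rw [swapHom_x, Equiv.swap_apply_right]

theorem swapHom_x_of_ne {m : ℕ} (i : ℕ) (hi : i + 1 < m) (j : Fin m) (h0 : (j : ℕ) ≠ i)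
    (h1 : (j : ℕ) ≠ i + 1) : swapHom i hi (x j) = x j := by
  rw [swapHom_x, Equiv.swap_apply_of_ne_of_ne] <;> simp [Fin.ext_iff, h0, h1]

theorem swapHom_swapHom {m : ℕ} (i : ℕ) (hi : i + 1 < m) (f : SymRing m) :
    swapHom i hi (swapHom i hi f) = f := by
  apply Subtype.ext
  change MvPowerSeries.renameEquiv QT _ (MvPowerSeries.renameEquiv QT _ f.1) = f.1
  rw [← AlgEquiv.trans_apply, MvPowerSeries.renameEquiv_trans]
  have : (Equiv.swap i (i + 1)).trans (Equiv.swap i (i + 1)) = Equiv.refl ℕ := by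
    ext; simp
  rw [this, MvPowerSeries.renameEquiv_refl, AlgEquiv.coe_refl, id]

theorem swapHom_braid {m : ℕ} (i : ℕ) (hi : i + 1 + 1 < m) (f : SymRing m) :
    swapHom i (by omega) (swapHom (i + 1) hi (swapHom i (by omega) f)) =
      swapHom (i + 1) hi (swapHom i (by omega) (swapHom (i + 1) hi f)) := by
  apply Subtype.ext
  change MvPowerSeries.renameEquiv QT _ (MvPowerSeries.renameEquiv QT _
    (MvPowerSeries.renameEquiv QT _ f.1)) = MvPowerSeries.renameEquiv QT _
      (MvPowerSeries.renameEquiv QT _ (MvPowerSeries.renameEquiv QT _ f.1))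
  simp only [← AlgEquiv.trans_apply, MvPowerSeries.renameEquiv_trans]
  congr 2
  ext n
  simp only [Equiv.trans_apply, Equiv.swap_apply_def]
  split_ifs <;> omega

theorem swapHom_comm {m : ℕ} (i j : ℕ) (hi : i + 1 < m) (hj : j + 1 < m) (hij : i + 1 < j)
    (f : SymRing m) :
    swapHom i hi (swapHom j hj f) = swapHom j hj (swapHom i hi f) := by
  apply Subtype.ext
  change MvPowerSeries.renameEquiv QT _ (MvPowerSeries.renameEquiv QT _ f.1) =
    MvPowerSeries.renameEquiv QT _ (MvPowerSeries.renameEquiv QT _ f.1)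
  simp only [← AlgEquiv.trans_apply, MvPowerSeries.renameEquiv_trans]
  congr 2
  ext n
  simp only [Equiv.trans_apply, Equiv.swap_apply_def]
  split_ifs <;> omega

/-- The defining formula of `T_i` with its denominator cleared. -/
theorem heckeT_spec {m : ℕ} (i : ℕ) (hi : i + 1 < m) (f : SymRing m) :
    (x ⟨i, by omega⟩ - x ⟨i + 1, hi⟩) * heckeT i hi f =
      (algebraMap QT (SymRing m) t * x ⟨i, by omega⟩ - x ⟨i + 1, hi⟩) * swapHom i hi f +
        (1 - algebraMap QT (SymRing m) t) * x ⟨i + 1, hi⟩ * f := by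
  have h := divDiff_spec i hi f
  change (x ⟨i, by omega⟩ - x ⟨i + 1, hi⟩) *
    (t • f + (t • x ⟨i, by omega⟩ - x ⟨i + 1, hi⟩) * divDiff i hi f) = _
  rw [← swapHom_apply] at h
  rw [Algebra.smul_def, Algebra.smul_def]
  linear_combination (algebraMap QT (SymRing m) t * x ⟨i, by omega⟩ - x ⟨i + 1, hi⟩) * h

theorem x_sub_x_ne_zero' {m : ℕ} (i j : Fin m) (hij : i ≠ j) : (x i - x j : SymRing m) ≠ 0 := by
  intro h
  have h' := congrArg (fun f : SymRing m => MvPowerSeries.coeff (Finsupp.single (i : ℕ) 1) f.1) h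
  have hn : ¬ (i : ℕ) = (j : ℕ) := fun h => hij (Fin.ext h)
  simp [x, MvPowerSeries.coeff_X, Finsupp.single_left_inj, hn] at h'

theorem heckeT_quadratic {m : ℕ} (i : ℕ) (hi : i + 1 < m) (f : SymRing m) :
    heckeT i hi (heckeT i hi f) = (t - 1) • heckeT i hi f + t • f := by
  have hd := x_sub_x_ne_zero i hi
  refine mul_left_cancel₀ (mul_ne_zero hd hd) ?_
  have h1 := heckeT_spec i hi f
  have h2 := heckeT_spec i hi (heckeT i hi f)
  have h3 := congrArg (swapHom i hi) h1
  simp only [map_mul, map_sub, map_add, map_one, AlgHom.commutes, swapHom_x_left,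
    swapHom_x_right, swapHom_swapHom] at h3
  rw [Algebra.smul_def, Algebra.smul_def, map_sub, map_one]
  set τ := algebraMap QT (SymRing m) t
  set a : SymRing m := x ⟨i, by omega⟩
  set b : SymRing m := x ⟨i + 1, hi⟩
  linear_combination (a - b) * h2 - (τ * a - b) * h3 + ((1 - τ) * b - (τ - 1) * (a - b)) * h1

theorem heckeT_comm {m : ℕ} (i j : ℕ) (hi : i + 1 < m) (hj : j + 1 < m) (hij : i + 1 < j)
    (f : SymRing m) : heckeT i hi (heckeT j hj f) = heckeT j hj (heckeT i hi f) := by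
  refine mul_left_cancel₀ (mul_ne_zero (x_sub_x_ne_zero i hi) (x_sub_x_ne_zero j hj)) ?_
  have h1 := heckeT_spec i hi f
  have h2 := heckeT_spec j hj f
  have h3 := heckeT_spec i hi (heckeT j hj f)
  have h4 := heckeT_spec j hj (heckeT i hi f)
  have h5 := congrArg (swapHom j hj) h1
  have h6 := congrArg (swapHom i hi) h2
  simp only [map_mul, map_sub, map_add, map_one, AlgHom.commutes] at h5 h6
  rw [swapHom_x_of_ne j hj ⟨i, _⟩ (by simp; omega) (by simp; omega),
    swapHom_x_of_ne j hj ⟨i + 1, _⟩ (by simp; omega) (by simp; omega)] at h5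
  rw [swapHom_x_of_ne i hi ⟨j, _⟩ (by simp; omega) (by simp; omega),
    swapHom_x_of_ne i hi ⟨j + 1, _⟩ (by simp; omega) (by simp; omega),
    swapHom_comm i j hi hj hij] at h6
  set τ := algebraMap QT (SymRing m) t
  set a : SymRing m := x ⟨i, by omega⟩
  set b : SymRing m := x ⟨i + 1, hi⟩
  set c : SymRing m := x ⟨j, by omega⟩
  set d : SymRing m := x ⟨j + 1, hj⟩
  linear_combination (c - d) * h3 - (a - b) * h4 + (τ * a - b) * h6 + (1 - τ) * b * h2 -
    (τ * c - d) * h5 - (1 - τ) * d * h1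

/-- The braid relation: once all denominators are cleared, both sides are expanded in terms of the
six images of `f` under the permutations of three consecutive variables. -/
theorem heckeT_braid {m : ℕ} (i : ℕ) (hi : i + 1 + 1 < m) (f : SymRing m) :
    heckeT i (by omega) (heckeT (i + 1) hi (heckeT i (by omega) f)) =
      heckeT (i + 1) hi (heckeT i (by omega) (heckeT (i + 1) hi f)) := by
  have hi' : i + 1 < m := by omega
  have hab := x_sub_x_ne_zero i hi'
  have hbc := x_sub_x_ne_zero (i + 1) hi
  have hac := x_sub_x_ne_zero' (⟨i, by omega⟩ : Fin m) ⟨i + 1 + 1, hi⟩ (by simp [Fin.ext_iff]; omega)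
  have e1 : ∀ g, swapHom i hi' (heckeT (i + 1) hi g) * (x ⟨i, by omega⟩ - x ⟨i + 1 + 1, hi⟩) =
      (algebraMap QT (SymRing m) t * x ⟨i, by omega⟩ - x ⟨i + 1 + 1, hi⟩) *
        swapHom i hi' (swapHom (i + 1) hi g) +
        (1 - algebraMap QT (SymRing m) t) * x ⟨i + 1 + 1, hi⟩ * swapHom i hi' g := by
    intro g
    have h := congrArg (swapHom i hi') (heckeT_spec (i + 1) hi g)
    simp only [map_mul, map_sub, map_add, map_one, AlgHom.commutes, swapHom_x_right] at h
    rw [swapHom_x_of_ne i hi' ⟨i + 1 + 1, _⟩ (by simp; omega) (by simp)] at h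
    linear_combination h
  have e2 : ∀ g, swapHom (i + 1) hi (heckeT i hi' g) * (x ⟨i, by omega⟩ - x ⟨i + 1 + 1, hi⟩) =
      (algebraMap QT (SymRing m) t * x ⟨i, by omega⟩ - x ⟨i + 1 + 1, hi⟩) *
        swapHom (i + 1) hi (swapHom i hi' g) +
        (1 - algebraMap QT (SymRing m) t) * x ⟨i + 1 + 1, hi⟩ * swapHom (i + 1) hi g := by
    intro g
    have h := congrArg (swapHom (i + 1) hi) (heckeT_spec i hi' g)
    simp only [map_mul, map_sub, map_add, map_one, AlgHom.commutes, swapHom_x_left] at h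
    rw [swapHom_x_of_ne (i + 1) hi ⟨i, _⟩ (by simp) (by simp; omega)] at h
    linear_combination h
  have e3 : ∀ g, swapHom i hi' (heckeT i hi' g) * (x ⟨i + 1, hi'⟩ - x ⟨i, by omega⟩) =
      (algebraMap QT (SymRing m) t * x ⟨i + 1, hi'⟩ - x ⟨i, by omega⟩) * g +
        (1 - algebraMap QT (SymRing m) t) * x ⟨i, by omega⟩ * swapHom i hi' g := by
    intro g
    have h := congrArg (swapHom i hi') (heckeT_spec i hi' g)
    simp only [map_mul, map_sub, map_add, map_one, AlgHom.commutes, swapHom_x_right,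
      swapHom_x_left, swapHom_swapHom] at h
    linear_combination h
  have e4 : ∀ g, swapHom (i + 1) hi (heckeT (i + 1) hi g) *
      (x ⟨i + 1 + 1, hi⟩ - x ⟨i + 1, hi'⟩) =
      (algebraMap QT (SymRing m) t * x ⟨i + 1 + 1, hi⟩ - x ⟨i + 1, hi'⟩) * g +
        (1 - algebraMap QT (SymRing m) t) * x ⟨i + 1, hi'⟩ * swapHom (i + 1) hi g := by
    intro g
    have h := congrArg (swapHom (i + 1) hi) (heckeT_spec (i + 1) hi g)
    simp only [map_mul, map_sub, map_add, map_one, AlgHom.commutes, swapHom_x_right,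
      swapHom_x_left, swapHom_swapHom] at h
    linear_combination h
  have e5 : ∀ g, swapHom i hi' (swapHom (i + 1) hi (heckeT i hi' g)) *
      (x ⟨i + 1, hi'⟩ - x ⟨i + 1 + 1, hi⟩) =
      (algebraMap QT (SymRing m) t * x ⟨i + 1, hi'⟩ - x ⟨i + 1 + 1, hi⟩) *
        swapHom i hi' (swapHom (i + 1) hi (swapHom i hi' g)) +
        (1 - algebraMap QT (SymRing m) t) * x ⟨i + 1 + 1, hi⟩ *
          swapHom i hi' (swapHom (i + 1) hi g) := by
    intro g
    have h := congrArg (swapHom i hi') (e2 g)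
    simp only [map_mul, map_sub, map_add, map_one, AlgHom.commutes, swapHom_x_left] at h
    rw [swapHom_x_of_ne i hi' ⟨i + 1 + 1, _⟩ (by simp; omega) (by simp)] at h
    linear_combination h
  have e6 : ∀ g, swapHom (i + 1) hi (swapHom i hi' (heckeT (i + 1) hi g)) *
      (x ⟨i, by omega⟩ - x ⟨i + 1, hi'⟩) =
      (algebraMap QT (SymRing m) t * x ⟨i, by omega⟩ - x ⟨i + 1, hi'⟩) *
        swapHom (i + 1) hi (swapHom i hi' (swapHom (i + 1) hi g)) +
        (1 - algebraMap QT (SymRing m) t) * x ⟨i + 1, hi'⟩ *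
          swapHom (i + 1) hi (swapHom i hi' g) := by
    intro g
    have h := congrArg (swapHom (i + 1) hi) (e1 g)
    simp only [map_mul, map_sub, map_add, map_one, AlgHom.commutes, swapHom_x_right] at h
    rw [swapHom_x_of_ne (i + 1) hi ⟨i, _⟩ (by simp) (by simp; omega)] at h
    linear_combination h
  have hbr := swapHom_braid i hi f
  have a1 := heckeT_spec i hi' f
  have a2 := heckeT_spec (i + 1) hi (heckeT i hi' f)
  have a3 := heckeT_spec i hi' (heckeT (i + 1) hi (heckeT i hi' f))
  have a4 := e1 (heckeT i hi' f)
  have a5 := e2 f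
  have a6 := e3 f
  have a7 := e5 f
  have b1 := heckeT_spec (i + 1) hi f
  have b2 := heckeT_spec i hi' (heckeT (i + 1) hi f)
  have b3 := heckeT_spec (i + 1) hi (heckeT i hi' (heckeT (i + 1) hi f))
  have b4 := e2 (heckeT (i + 1) hi f)
  have b5 := e1 f
  have b6 := e4 f
  have b7 := e6 f
  rw [hbr] at a7
  clear e1 e2 e3 e4 e5 e6 hbr
  refine mul_left_cancel₀ (mul_ne_zero (mul_ne_zero (mul_ne_zero hab hab) (mul_ne_zero hbc hbc))
    hac) ?_
  generalize algebraMap QT (SymRing m) t = τ at *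
  generalize (x ⟨i, by omega⟩ : SymRing m) = a at *
  generalize (x ⟨i + 1, hi'⟩ : SymRing m) = b at *
  generalize (x ⟨i + 1 + 1, hi⟩ : SymRing m) = c at *
  generalize swapHom (i + 1) hi (swapHom i hi' (swapHom (i + 1) hi f)) = f121 at *
  generalize swapHom (i + 1) hi (swapHom i hi' f) = f21 at *
  generalize swapHom i hi' (swapHom (i + 1) hi f) = f12 at *
  generalize swapHom i hi' (swapHom (i + 1) hi (heckeT i hi' f)) = A7 at *
  generalize swapHom (i + 1) hi (swapHom i hi' (heckeT (i + 1) hi f)) = B7 at *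
  generalize swapHom i hi' (heckeT (i + 1) hi (heckeT i hi' f)) = A4 at *
  generalize swapHom (i + 1) hi (heckeT i hi' (heckeT (i + 1) hi f)) = B4 at *
  generalize heckeT i hi' (heckeT (i + 1) hi (heckeT i hi' f)) = A3 at *
  generalize heckeT (i + 1) hi (heckeT i hi' (heckeT (i + 1) hi f)) = B3 at *
  generalize heckeT (i + 1) hi (heckeT i hi' f) = A2 at *
  generalize heckeT i hi' (heckeT (i + 1) hi f) = B2 at *
  generalize swapHom (i + 1) hi (heckeT i hi' f) = A5 at *
  generalize swapHom i hi' (heckeT (i + 1) hi f) = B5 at *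
  generalize swapHom i hi' (heckeT i hi' f) = A6 at *
  generalize swapHom (i + 1) hi (heckeT (i + 1) hi f) = B6 at *
  generalize heckeT i hi' f = A1 at *
  generalize heckeT (i + 1) hi f = B1 at *
  generalize swapHom i hi' f = f1 at *
  generalize swapHom (i + 1) hi f = f2 at *
  have hA : (a - b) * (a - b) * ((b - c) * (b - c)) * (a - c) * A3 =
      (b - c) * (τ * a - b) * ((τ * a - c) * (a - b) * ((τ * b - c) * f121 + (1 - τ) * c * f12)
        - (1 - τ) * c * (b - c) * ((τ * b - a) * f + (1 - τ) * a * f1)) +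
      (1 - τ) * b * (b - c) * ((τ * b - c) * (a - b) * ((τ * a - c) * f21 + (1 - τ) * c * f2) +
        (1 - τ) * c * (a - c) * ((τ * a - b) * f1 + (1 - τ) * b * f)) := by
    linear_combination (a - b) * (b - c) * (b - c) * (a - c) * a3 +
      (a - b) * (b - c) * (b - c) * (τ * a - b) * a4 +
      (a - b) * (b - c) * (a - c) * (1 - τ) * b * a2 +
      (a - b) * (b - c) * (τ * a - b) * (τ * a - c) * a7 -
      (b - c) * (b - c) * (τ * a - b) * (1 - τ) * c * a6 +
      (a - b) * (b - c) * (1 - τ) * b * (τ * b - c) * a5 +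
      (b - c) * (a - c) * (1 - τ) * b * (1 - τ) * c * a1
  have hB : (a - b) * (a - b) * ((b - c) * (b - c)) * (a - c) * B3 =
      (a - b) * (b - c) * (τ * b - c) * (τ * a - c) * ((τ * a - b) * f121 + (1 - τ) * b * f21) -
      (a - b) * (a - b) * (τ * b - c) * (1 - τ) * c * ((τ * c - b) * f + (1 - τ) * b * f2) +
      (1 - τ) * c * (a - b) * (b - c) * (τ * a - b) * ((τ * a - c) * f12 + (1 - τ) * c * f1) +
      (1 - τ) * c * (a - b) * (a - c) * (1 - τ) * b * ((τ * b - c) * f2 + (1 - τ) * c * f) := by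
    linear_combination (a - b) * (a - b) * (b - c) * (a - c) * b3 +
      (a - b) * (a - b) * (b - c) * (τ * b - c) * b4 +
      (a - b) * (b - c) * (τ * b - c) * (τ * a - c) * b7 -
      (a - b) * (a - b) * (τ * b - c) * (1 - τ) * c * b6 +
      (a - b) * (b - c) * (a - c) * (1 - τ) * c * b2 +
      (a - b) * (b - c) * (1 - τ) * c * (τ * a - b) * b5 +
      (a - b) * (a - c) * (1 - τ) * c * (1 - τ) * b * b1
  rw [hA, hB]
  ring

/-- `T_i` is linear over the functions that are symmetric in `x_i, x_{i+1}`. -/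
theorem heckeT_mul_of_swapHom_eq {m : ℕ} (i : ℕ) (hi : i + 1 < m) (f g : SymRing m)
    (hg : swapHom i hi g = g) : heckeT i hi (f * g) = heckeT i hi f * g := by
  refine mul_left_cancel₀ (x_sub_x_ne_zero i hi) ?_
  have h1 := heckeT_spec i hi f
  have h2 := heckeT_spec i hi (f * g)
  rw [map_mul (swapHom i hi), hg] at h2
  linear_combination h2 - g * h1

theorem heckeT_of_swapHom_eq {m : ℕ} (i : ℕ) (hi : i + 1 < m) (f : SymRing m)
    (hf : swapHom i hi f = f) : heckeT i hi f = t • f := by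
  refine mul_left_cancel₀ (x_sub_x_ne_zero i hi) ?_
  have h1 := heckeT_spec i hi f
  rw [hf] at h1
  rw [Algebra.smul_def]
  linear_combination h1

theorem t_ne_zero : t ≠ 0 := RatFunc.X_ne_zero

theorem swapVar_eq_of_heckeT_eq {m : ℕ} (i : ℕ) (hi : i + 1 < m) (f : SymRing m)
    (hf : heckeT i hi f = t • f) : swapVar i hi f = f := by
  have h1 := heckeT_spec i hi f
  rw [hf, Algebra.smul_def] at h1
  have hne : algebraMap QT (SymRing m) t * x ⟨i, by omega⟩ - x ⟨i + 1, hi⟩ ≠ 0 := by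
    intro h
    have h' := congrArg
      (fun f : SymRing m => MvPowerSeries.coeff (Finsupp.single (i + 1) 1) f.1) h
    rw [← Algebra.smul_def] at h'
    simp [x, MvPowerSeries.coeff_X, Finsupp.single_left_inj] at h'
  rw [← swapHom_apply]
  refine mul_left_cancel₀ hne ?_
  linear_combination -h1

/-! ### Families indexed by compositions -/

theorem swapComp_left {m : ℕ} (i : ℕ) (hi : i + 1 < m) (a : Fin m → ℕ) :
    swapComp i hi a ⟨i, by omega⟩ = a ⟨i + 1, hi⟩ := by
  simp [swapComp]

theorem swapComp_right {m : ℕ} (i : ℕ) (hi : i + 1 < m) (a : Fin m → ℕ) :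
    swapComp i hi a ⟨i + 1, hi⟩ = a ⟨i, by omega⟩ := by
  simp [swapComp]

theorem swapComp_of_ne {m : ℕ} (i : ℕ) (hi : i + 1 < m) (a : Fin m → ℕ) (j : ℕ) (hj : j < m)
    (h0 : j ≠ i) (h1 : j ≠ i + 1) : swapComp i hi a ⟨j, hj⟩ = a ⟨j, hj⟩ := by
  rw [swapComp, Function.comp_apply, Equiv.swap_apply_of_ne_of_ne] <;> simp [Fin.ext_iff, h0, h1]

theorem swapComp_swapComp {m : ℕ} (i : ℕ) (hi : i + 1 < m) (a : Fin m → ℕ) :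
    swapComp i hi (swapComp i hi a) = a := by
  funext j
  simp [swapComp]

theorem swapComp_of_eq {m : ℕ} (i : ℕ) (hi : i + 1 < m) (a : Fin m → ℕ)
    (h : a ⟨i, by omega⟩ = a ⟨i + 1, hi⟩) : swapComp i hi a = a := by
  funext j
  simp only [swapComp, Function.comp_apply, Equiv.swap_apply_def]
  split_ifs with h1 h2
  · rw [h1, h]
  · rw [h2, h]
  · rfl

theorem swapComp_comm {m : ℕ} (i j : ℕ) (hi : i + 1 < m) (hj : j + 1 < m) (hij : i + 1 < j)
    (a : Fin m → ℕ) :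
    swapComp i hi (swapComp j hj a) = swapComp j hj (swapComp i hi a) := by
  funext k
  simp only [swapComp, Function.comp_apply]
  congr 1
  apply Fin.ext
  simp only [Equiv.swap_apply_def, Fin.ext_iff, apply_ite Fin.val]
  split_ifs <;> omega

theorem swapComp_braid {m : ℕ} (i : ℕ) (hi : i + 1 + 1 < m) (a : Fin m → ℕ) :
    swapComp i (by omega) (swapComp (i + 1) hi (swapComp i (by omega) a)) =
      swapComp (i + 1) hi (swapComp i (by omega) (swapComp (i + 1) hi a)) := by
  funext k
  simp only [swapComp, Function.comp_apply]
  congr 1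
  apply Fin.ext
  simp only [Equiv.swap_apply_def, Fin.ext_iff, apply_ite Fin.val]
  split_ifs <;> omega

/-- A composition is dominant if it has no ascent. -/
def Dominant {m : ℕ} (a : Fin m → ℕ) : Prop :=
  ¬∃ i, ∃ hi : i + 1 < m, a ⟨i, by omega⟩ < a ⟨i + 1, hi⟩

theorem Dominant.antitone {m : ℕ} {a : Fin m → ℕ} (h : Dominant a) : Antitone a := by
  have key : ∀ (n i : ℕ) (hi : i + n < m), a ⟨i + n, hi⟩ ≤ a ⟨i, by omega⟩ := by
    intro n
    induction n with
    | zero => exact fun i hi => le_rfl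
    | succ n ih =>
      intro i hi
      refine le_trans ?_ (ih i (by omega))
      by_contra hlt
      exact h ⟨i + n, hi, not_le.1 hlt⟩
  intro i j hij
  have := key (j - i) i (by have := j.isLt; omega)
  simpa [Nat.add_sub_cancel' (show (i : ℕ) ≤ j from hij)] using this

/-- Operators satisfying the braid relations, and a family of vectors built from the dominant
compositions by removing one ascent at a time: the result does not depend on the ascent chosen, and
equal consecutive entries give eigenvectors. The induction is on the number of steps to the dominant
composition; two different ascents are compared by a commutation or a braid relation. -/
theorem ascent_recursion {m : ℕ} {V : Type*} [AddCommGroup V] [Module QT V]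
    (U : ∀ i, i + 1 < m → V →ₗ[QT] V)
    (hcomm : ∀ i j (hi : i + 1 < m) (hj : j + 1 < m), i + 1 < j → ∀ v,
      U i hi (U j hj v) = U j hj (U i hi v))
    (hbraid : ∀ i (hi : i + 1 + 1 < m) v,
      U i (by omega) (U (i + 1) hi (U i (by omega) v)) =
        U (i + 1) hi (U i (by omega) (U (i + 1) hi v)))
    (κ : QT) (F : (Fin m → ℕ) → V)
    (hdom : ∀ a, Dominant a → ∀ i (hi : i + 1 < m), a ⟨i, by omega⟩ = a ⟨i + 1, hi⟩ →
      U i hi (F a) = κ • F a)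
    (hrec : ∀ a, ¬Dominant a → ∃ i, ∃ hi : i + 1 < m,
      a ⟨i, by omega⟩ < a ⟨i + 1, hi⟩ ∧ F a = U i hi (F (swapComp i hi a)))
    (a : Fin m → ℕ) :
    (∀ i (hi : i + 1 < m), a ⟨i, by omega⟩ < a ⟨i + 1, hi⟩ → F a = U i hi (F (swapComp i hi a))) ∧
    (∀ i (hi : i + 1 < m), a ⟨i, by omega⟩ = a ⟨i + 1, hi⟩ → U i hi (F a) = κ • F a) := by
  induction hN : ∑ j : Fin m, (j : ℕ) * a j using Nat.strong_induction_on generalizing a with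
  | _ N ih =>
  subst hN
  have ih' : ∀ j (hj : j + 1 < m), a ⟨j, by omega⟩ < a ⟨j + 1, hj⟩ →
      ∀ k (hk : k + 1 < m), swapComp j hj a ⟨k, by omega⟩ < swapComp j hj a ⟨k + 1, hk⟩ →
      ∀ i (hi : i + 1 < m),
      (swapComp k hk (swapComp j hj a) ⟨i, by omega⟩ <
        swapComp k hk (swapComp j hj a) ⟨i + 1, hi⟩ →
        F (swapComp k hk (swapComp j hj a)) =
          U i hi (F (swapComp i hi (swapComp k hk (swapComp j hj a))))) ∧
      (swapComp k hk (swapComp j hj a) ⟨i, by omega⟩ =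
        swapComp k hk (swapComp j hj a) ⟨i + 1, hi⟩ →
        U i hi (F (swapComp k hk (swapComp j hj a))) =
          κ • F (swapComp k hk (swapComp j hj a))) := by
    intro j hj h k hk h' i hi
    have := ih _ ((weight_swapComp_lt k hk _ h').trans (weight_swapComp_lt j hj a h)) _ rfl
    exact ⟨this.1 i hi, this.2 i hi⟩
  by_cases hD : Dominant a
  · exact ⟨fun i hi h => (hD ⟨i, hi, h⟩).elim, hdom a hD⟩
  obtain ⟨k, hk, hak, hF⟩ := hrec a hD
  have ihk := ih _ (weight_swapComp_lt k hk a hak) _ rfl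
  constructor
  · intro i hi hai
    have ihi := ih _ (weight_swapComp_lt i hi a hai) _ rfl
    rcases lt_trichotomy i k with h | rfl | h
    · rcases Nat.lt_or_ge (i + 1) k with h' | h'
      · rw [hF, ihk.1 i hi (by
            rwa [swapComp_of_ne _ _ _ _ _ (by omega) (by omega),
              swapComp_of_ne _ _ _ _ _ (by omega) (by omega)]),
          ihi.1 k hk (by
            rwa [swapComp_of_ne _ _ _ _ _ (by omega) (by omega),
              swapComp_of_ne _ _ _ _ _ (by omega) (by omega)]),
          hcomm i k hi hk h', swapComp_comm i k hi hk h']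
      · obtain rfl : k = i + 1 := by omega
        have e1 : swapComp (i + 1) hk a ⟨i, by omega⟩ = a ⟨i, by omega⟩ :=
          swapComp_of_ne _ _ _ _ _ (by omega) (by omega)
        have e2 : swapComp i hi a ⟨i + 1 + 1, hk⟩ = a ⟨i + 1 + 1, hk⟩ :=
          swapComp_of_ne _ _ _ _ _ (by omega) (by omega)
        have e3 := swapComp_left (i + 1) hk a
        have e4 := swapComp_right (i + 1) hk a
        have e5 := swapComp_left i hi a
        have e6 := swapComp_right i hi a
        have h1 : swapComp (i + 1) hk a ⟨i, by omega⟩ < swapComp (i + 1) hk a ⟨i + 1, hi⟩ := by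
          rw [e1, e3]; omega
        have h2 : swapComp i hi a ⟨i + 1, hi⟩ < swapComp i hi a ⟨i + 1 + 1, hk⟩ := by
          rw [e2, e6]; omega
        have h3 := (ih' (i + 1) hk hak i hi h1 (i + 1) hk).1 (by
          rw [swapComp_right i hi, swapComp_of_ne i _ _ _ _ (by omega) (by omega), e1, e4]
          exact hai)
        have h4 := (ih' i hi hai (i + 1) hk h2 i hi).1 (by
          rw [swapComp_left (i + 1) hk, swapComp_of_ne (i + 1) _ _ _ _ (by omega) (by omega),
            e2, e5]
          exact hak)
        rw [hF, ihk.1 i hi h1, h3, ihi.1 (i + 1) hk h2, h4, hbraid, swapComp_braid]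
    · exact hF
    · rcases Nat.lt_or_ge (k + 1) i with h' | h'
      · rw [hF, ihk.1 i hi (by
            rwa [swapComp_of_ne _ _ _ _ _ (by omega) (by omega),
              swapComp_of_ne _ _ _ _ _ (by omega) (by omega)]),
          ihi.1 k hk (by
            rwa [swapComp_of_ne _ _ _ _ _ (by omega) (by omega),
              swapComp_of_ne _ _ _ _ _ (by omega) (by omega)]),
          hcomm k i hk hi h', swapComp_comm k i hk hi h']
      · obtain rfl : i = k + 1 := by omega
        have e1 : swapComp (k + 1) hi a ⟨k, by omega⟩ = a ⟨k, by omega⟩ :=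
          swapComp_of_ne _ _ _ _ _ (by omega) (by omega)
        have e2 : swapComp k hk a ⟨k + 1 + 1, hi⟩ = a ⟨k + 1 + 1, hi⟩ :=
          swapComp_of_ne _ _ _ _ _ (by omega) (by omega)
        have e3 := swapComp_left (k + 1) hi a
        have e4 := swapComp_right (k + 1) hi a
        have e5 := swapComp_left k hk a
        have e6 := swapComp_right k hk a
        have h1 : swapComp (k + 1) hi a ⟨k, by omega⟩ < swapComp (k + 1) hi a ⟨k + 1, hk⟩ := by
          rw [e1, e3]; omega
        have h2 : swapComp k hk a ⟨k + 1, hk⟩ < swapComp k hk a ⟨k + 1 + 1, hi⟩ := by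
          rw [e2, e6]; omega
        have h3 := (ih' (k + 1) hi hai k hk h1 (k + 1) hi).1 (by
          rw [swapComp_right k hk, swapComp_of_ne k _ _ _ _ (by omega) (by omega), e1, e4]
          exact hak)
        have h4 := (ih' k hk hak (k + 1) hi h2 k hk).1 (by
          rw [swapComp_left (k + 1) hi, swapComp_of_ne (k + 1) _ _ _ _ (by omega) (by omega),
            e2, e5]
          exact hai)
        rw [hF, ihk.1 (k + 1) hi h2, h4, ihi.1 k hk h1, h3, hbraid, swapComp_braid]
  · intro i hi hai
    have hik : i ≠ k := by rintro rfl; omega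
    rcases lt_or_gt_of_ne hik with h | h
    · rcases Nat.lt_or_ge (i + 1) k with h' | h'
      · rw [hF, hcomm i k hi hk h', ihk.2 i hi (by
            rwa [swapComp_of_ne _ _ _ _ _ (by omega) (by omega),
              swapComp_of_ne _ _ _ _ _ (by omega) (by omega)]), map_smul]
      · obtain rfl : k = i + 1 := by omega
        have e1 : swapComp (i + 1) hk a ⟨i, by omega⟩ = a ⟨i, by omega⟩ :=
          swapComp_of_ne _ _ _ _ _ (by omega) (by omega)
        have e3 := swapComp_left (i + 1) hk a
        have e4 := swapComp_right (i + 1) hk a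
        have h1 : swapComp (i + 1) hk a ⟨i, by omega⟩ < swapComp (i + 1) hk a ⟨i + 1, hi⟩ := by
          rw [e1, e3]; omega
        have h3 := (ih' (i + 1) hk hak i hi h1 (i + 1) hk).2 (by
          rw [swapComp_right i hi, swapComp_of_ne i _ _ _ _ (by omega) (by omega), e1, e4]
          exact hai)
        rw [hF, ihk.1 i hi h1, hbraid, h3, map_smul, map_smul]
    · rcases Nat.lt_or_ge (k + 1) i with h' | h'
      · rw [hF, ← hcomm k i hk hi h', ihk.2 i hi (by
            rwa [swapComp_of_ne _ _ _ _ _ (by omega) (by omega),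
              swapComp_of_ne _ _ _ _ _ (by omega) (by omega)]), map_smul]
      · obtain rfl : i = k + 1 := by omega
        have e2 : swapComp k hk a ⟨k + 1 + 1, hi⟩ = a ⟨k + 1 + 1, hi⟩ :=
          swapComp_of_ne _ _ _ _ _ (by omega) (by omega)
        have e5 := swapComp_left k hk a
        have e6 := swapComp_right k hk a
        have h2 : swapComp k hk a ⟨k + 1, hk⟩ < swapComp k hk a ⟨k + 1 + 1, hi⟩ := by
          rw [e2, e6]; omega
        have h4 := (ih' k hk hak (k + 1) hi h2 k hk).2 (by
          rw [swapComp_left (k + 1) hi, swapComp_of_ne (k + 1) _ _ _ _ (by omega) (by omega),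
            e2, e5]
          exact hai)
        rw [hF, ihk.1 (k + 1) hi h2, ← hbraid, h4, map_smul, map_smul]

/-! ### The action of the Hecke generators on `k_Λ` -/

theorem hallLittlewood_of_dominant {m : ℕ} {a : Fin m → ℕ} (h : Dominant a) :
    hallLittlewood a = ∏ j, x j ^ a j := by
  rw [hallLittlewood, dif_neg h]

theorem exists_hallLittlewood_eq {m : ℕ} {a : Fin m → ℕ} (h : ¬Dominant a) :
    ∃ i, ∃ hi : i + 1 < m, a ⟨i, by omega⟩ < a ⟨i + 1, hi⟩ ∧
      hallLittlewood a = heckeT i hi (hallLittlewood (swapComp i hi a)) := by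
  have h' := not_not.1 h
  refine ⟨h'.choose, h'.choose_spec.choose, h'.choose_spec.choose_spec, ?_⟩
  conv_lhs => rw [hallLittlewood, dif_pos h']

theorem hallLittlewood_recursion {m : ℕ} (a : Fin m → ℕ) :
    (∀ i (hi : i + 1 < m), a ⟨i, by omega⟩ < a ⟨i + 1, hi⟩ →
      hallLittlewood a = heckeT i hi (hallLittlewood (swapComp i hi a))) ∧
    (∀ i (hi : i + 1 < m), a ⟨i, by omega⟩ = a ⟨i + 1, hi⟩ →
      heckeT i hi (hallLittlewood a) = t • hallLittlewood a) := by
  refine ascent_recursion (fun i hi => heckeT i hi) heckeT_comm heckeT_braid t hallLittlewood ?_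
    (fun a h => exists_hallLittlewood_eq h) a
  intro a hD i hi h
  refine heckeT_of_swapHom_eq i hi _ ?_
  rw [hallLittlewood_of_dominant hD, map_prod]
  simp only [map_pow, swapHom_x]
  rw [← Equiv.prod_comp (Equiv.swap (⟨i, by omega⟩ : Fin m) ⟨i + 1, hi⟩)
    (fun j => (x j : SymRing m) ^ a j)]
  refine Finset.prod_congr rfl fun j _ => ?_
  have := congrFun (swapComp_of_eq i hi a h) j
  rw [swapComp, Function.comp_apply] at this
  rw [this]

theorem swapHom_hSym {m : ℕ} (i : ℕ) (hi : i + 1 < m) (r : ℕ) :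
    swapHom i hi (hSym m r) = hSym m r := by
  -- The series `h_r` is symmetric in all variables, hence lies in `R_0`.
  exact Subtype.ext ((hSym 0 r).2.2 (Equiv.swap i (i + 1)) (by simp))

theorem swapHom_schur {m : ℕ} (i : ℕ) (hi : i + 1 < m) (lam : YoungDiagram) :
    swapHom i hi (schur m lam) = schur m lam := by
  rw [schur, AlgHom.map_det]
  congr 1
  ext r c
  simp only [AlgHom.mapMatrix_apply, Matrix.map_apply, Matrix.of_apply]
  split_ifs
  · rw [swapHom_hSym]
  · rw [map_zero]

theorem heckeT_kFun_of_gt {m : ℕ} (i : ℕ) (hi : i + 1 < m) (Λ : MPartition m)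
    (h : Λ.comp ⟨i + 1, hi⟩ < Λ.comp ⟨i, by omega⟩) :
    heckeT i hi (kFun Λ) = kFun (Λ.swap i hi) := by
  rw [kFun, kFun, heckeT_mul_of_swapHom_eq i hi _ _ (swapHom_schur i hi _)]
  have := (hallLittlewood_recursion (swapComp i hi Λ.comp)).1 i hi (by
    rwa [swapComp_left, swapComp_right])
  rw [swapComp_swapComp] at this
  rw [MPartition.swap, this]

theorem heckeT_kFun_of_eq {m : ℕ} (i : ℕ) (hi : i + 1 < m) (Λ : MPartition m)
    (h : Λ.comp ⟨i, by omega⟩ = Λ.comp ⟨i + 1, hi⟩) :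
    heckeT i hi (kFun Λ) = t • kFun Λ := by
  rw [kFun, heckeT_mul_of_swapHom_eq i hi _ _ (swapHom_schur i hi _),
    (hallLittlewood_recursion Λ.comp).2 i hi h, smul_mul_assoc]

theorem MPartition.swap_swap {m : ℕ} (i : ℕ) (hi : i + 1 < m) (Λ : MPartition m) :
    (Λ.swap i hi).swap i hi = Λ := by
  rw [MPartition.swap, MPartition.swap, swapComp_swapComp]

theorem heckeT_kFun_of_lt {m : ℕ} (i : ℕ) (hi : i + 1 < m) (Λ : MPartition m)
    (h : Λ.comp ⟨i, by omega⟩ < Λ.comp ⟨i + 1, hi⟩) :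
    heckeT i hi (kFun Λ) = (t - 1) • kFun Λ + t • kFun (Λ.swap i hi) := by
  have h1 := heckeT_kFun_of_gt i hi (Λ.swap i hi) (by
    change swapComp i hi Λ.comp _ < swapComp i hi Λ.comp _
    rwa [swapComp_left, swapComp_right])
  rw [MPartition.swap_swap] at h1
  rw [← h1, heckeT_quadratic]

/-! ### Leading terms of the Hall–Littlewood polynomials -/

theorem sum_update_update (g : ℕ → ℕ → ℕ) (hg : ∀ n, g n 0 = 0) (i : ℕ) (e : ℕ →₀ ℕ) (u v : ℕ) :
    ((e.update i u).update (i + 1) v).sum g + (g i (e i) + g (i + 1) (e (i + 1))) =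
      e.sum g + (g i u + g (i + 1) v) := by
  have key : ∀ (e : ℕ →₀ ℕ) (n u : ℕ), (e.update n u).sum g + g n (e n) = e.sum g + g n u := by
    intro e n u
    have h1 := Finsupp.add_sum_erase' e n g hg
    have h2 := Finsupp.add_sum_erase' (e.update n u) n g hg
    rw [Finsupp.erase_update_eq_erase] at h2
    simp only [Finsupp.coe_update, Function.update_self] at h2
    omega
  have h1 := key e i u
  have h2 := key (e.update i u) (i + 1) v
  have h3 : (e.update i u) (i + 1) = e (i + 1) := by simp
  rw [h3] at h2
  omega

/-- The sum of the squares of the exponents of a monomial. -/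
def sqNorm (d : ℕ →₀ ℕ) : ℕ := d.sum fun _ n => n ^ 2

theorem sqNorm_update_update (i : ℕ) (e : ℕ →₀ ℕ) (u v : ℕ) :
    sqNorm ((e.update i u).update (i + 1) v) + (e i ^ 2 + e (i + 1) ^ 2) =
      sqNorm e + (u ^ 2 + v ^ 2) :=
  sum_update_update (fun _ n => n ^ 2) (fun _ => rfl) i e u v

theorem coe_heckeT {m : ℕ} (i : ℕ) (hi : i + 1 < m) (f : SymRing m) :
    (heckeT i hi f : MvPowerSeries ℕ QT) = t • f.1 +
      (t • MvPowerSeries.X i - MvPowerSeries.X (i + 1)) * quotSeries i f.1 := by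
  have h : (divDiff i hi f : MvPowerSeries ℕ QT) = quotSeries i f.1 := by
    have h1 : (MvPowerSeries.X i - MvPowerSeries.X (i + 1)) * (divDiff i hi f).1 =
      MvPowerSeries.renameEquiv QT (Equiv.swap i (i + 1)) f.1 - f.1 :=
      congrArg Subtype.val (divDiff_spec i hi f)
    refine mul_left_cancel₀ (fun h0 => ?_) (h1.trans (quotSeries_mul i f.1).symm)
    have h' := congrArg (MvPowerSeries.coeff (Finsupp.single i 1)) h0
    simp [MvPowerSeries.coeff_X, Finsupp.single_left_inj] at h'
  rw [← h]
  rfl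

/-- The antisymmetrized coefficient that the divided difference sums up. -/
noncomputable def altCoeff (i : ℕ) (f : MvPowerSeries ℕ QT) (d : ℕ →₀ ℕ) (k : ℕ) : QT :=
  MvPowerSeries.coeff ((d.update i k).update (i + 1) (d i + d (i + 1) - k)) f -
    MvPowerSeries.coeff ((d.update i (d i + d (i + 1) - k)).update (i + 1) k) f

theorem update_update_congr {e e' : ℕ →₀ ℕ} {i : ℕ} (u v : ℕ)
    (h : ∀ n, n ≠ i → n ≠ i + 1 → e n = e' n) :
    (e.update i u).update (i + 1) v = (e'.update i u).update (i + 1) v := by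
  ext n
  simp only [Finsupp.coe_update, Function.update_apply]
  split_ifs with h1 h2
  · rfl
  · rfl
  · exact h n h2 h1

theorem coeff_X_mul_quotSeries (i : ℕ) (f : MvPowerSeries ℕ QT) (d : ℕ →₀ ℕ) :
    MvPowerSeries.coeff d (MvPowerSeries.X i * quotSeries i f) =
      ∑ k ∈ Finset.range (min (d i) (d (i + 1) + 1)), altCoeff i f d k := by
  rw [MvPowerSeries.X, MvPowerSeries.coeff_monomial_mul, one_mul]
  split_ifs with h
  · have hpos : 1 ≤ d i := by simpa using h i
    have hi0 : (d - Finsupp.single i 1 : ℕ →₀ ℕ) i = d i - 1 := by simp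
    have hi1 : (d - Finsupp.single i 1 : ℕ →₀ ℕ) (i + 1) = d (i + 1) := by simp
    rw [MvPowerSeries.coeff_apply, quotSeries, hi0, hi1,
      show min (d i - 1) (d (i + 1)) + 1 = min (d i) (d (i + 1) + 1) by omega,
      show d i - 1 + d (i + 1) + 1 = d i + d (i + 1) by omega]
    refine Finset.sum_congr rfl fun k _ => ?_
    have hn : ∀ n, n ≠ i → n ≠ i + 1 → (d - Finsupp.single i 1 : ℕ →₀ ℕ) n = d n := by
      intro n h0 h1
      simp [h0.symm]
    rw [altCoeff, update_update_congr _ _ hn, update_update_congr _ _ hn]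
  · have hz : d i = 0 := by
      by_contra h0
      exact h (Finsupp.single_le_iff.2 (Nat.one_le_iff_ne_zero.2 h0))
    simp [hz]

theorem coeff_X_succ_mul_quotSeries (i : ℕ) (f : MvPowerSeries ℕ QT) (d : ℕ →₀ ℕ) :
    MvPowerSeries.coeff d (MvPowerSeries.X (i + 1) * quotSeries i f) =
      ∑ k ∈ Finset.range (min (d i + 1) (d (i + 1))), altCoeff i f d k := by
  rw [MvPowerSeries.X, MvPowerSeries.coeff_monomial_mul, one_mul]
  split_ifs with h
  · have hpos : 1 ≤ d (i + 1) := by simpa using h (i + 1)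
    have hi0 : (d - Finsupp.single (i + 1) 1 : ℕ →₀ ℕ) i = d i := by simp
    have hi1 : (d - Finsupp.single (i + 1) 1 : ℕ →₀ ℕ) (i + 1) = d (i + 1) - 1 := by simp
    rw [MvPowerSeries.coeff_apply, quotSeries, hi0, hi1,
      show min (d i) (d (i + 1) - 1) + 1 = min (d i + 1) (d (i + 1)) by omega,
      show d i + (d (i + 1) - 1) + 1 = d i + d (i + 1) by omega]
    refine Finset.sum_congr rfl fun k _ => ?_
    have hn : ∀ n, n ≠ i → n ≠ i + 1 → (d - Finsupp.single (i + 1) 1 : ℕ →₀ ℕ) n = d n := by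
      intro n h0 h1
      simp [h1.symm]
    rw [altCoeff, update_update_congr _ _ hn, update_update_congr _ _ hn]
  · have hz : d (i + 1) = 0 := by
      by_contra h0
      exact h (Finsupp.single_le_iff.2 (Nat.one_le_iff_ne_zero.2 h0))
    simp [hz]

/-- The coefficients of `T_i f`. -/
theorem coeff_heckeT {m : ℕ} (i : ℕ) (hi : i + 1 < m) (f : SymRing m) (d : ℕ →₀ ℕ) :
    MvPowerSeries.coeff d (heckeT i hi f).1 =
      (if d (i + 1) < d i then
          t * MvPowerSeries.coeff ((d.update i (d (i + 1))).update (i + 1) (d i)) f.1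
        else if d i < d (i + 1) then
          (t - 1) * MvPowerSeries.coeff d f.1 +
            MvPowerSeries.coeff ((d.update i (d (i + 1))).update (i + 1) (d i)) f.1
        else t * MvPowerSeries.coeff d f.1) +
      (t - 1) * ∑ k ∈ Finset.range (min (d i) (d (i + 1))), altCoeff i f.1 d k := by
  have h4 : (d.update i (d i)).update (i + 1) (d (i + 1)) = d := by
    rw [Finsupp.update_self, Finsupp.update_self]
  rw [coe_heckeT, sub_mul, smul_mul_assoc, map_add, map_sub, map_smul, map_smul,
    coeff_X_mul_quotSeries, coeff_X_succ_mul_quotSeries, smul_eq_mul, smul_eq_mul]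
  split_ifs with h1 h2
  · rw [show min (d i) (d (i + 1) + 1) = d (i + 1) + 1 by omega,
      show min (d i + 1) (d (i + 1)) = d (i + 1) by omega,
      show min (d i) (d (i + 1)) = d (i + 1) by omega, Finset.sum_range_succ]
    conv_lhs => enter [2, 1, 2, 2]; rw [altCoeff, Nat.add_sub_cancel, h4]
    ring
  · rw [show min (d i) (d (i + 1) + 1) = d i by omega,
      show min (d i + 1) (d (i + 1)) = d i + 1 by omega,
      show min (d i) (d (i + 1)) = d i by omega, Finset.sum_range_succ]
    conv_lhs => enter [2, 2, 2]; rw [altCoeff, Nat.add_sub_cancel_left, h4]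
    ring
  · rw [show min (d i) (d (i + 1) + 1) = min (d i) (d (i + 1)) by omega,
      show min (d i + 1) (d (i + 1)) = min (d i) (d (i + 1)) by omega]
    ring

/-- A coefficient of `T_i f` that does not vanish comes from a coefficient of `f` that does not
vanish; the two exponents have the same entries in positions `i`, `i + 1`, or those of the second
one are further apart. -/
theorem exists_coeff_of_coeff_heckeT {m : ℕ} (i : ℕ) (hi : i + 1 < m) (f : SymRing m) (d : ℕ →₀ ℕ)
    (hd : MvPowerSeries.coeff d (heckeT i hi f).1 ≠ 0) :
    ∃ u v, u + v = d i + d (i + 1) ∧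
      MvPowerSeries.coeff ((d.update i u).update (i + 1) v) f.1 ≠ 0 ∧
      ((u = d i ∧ v = d (i + 1)) ∨ (u = d (i + 1) ∧ v = d i) ∨
        d i ^ 2 + d (i + 1) ^ 2 < u ^ 2 + v ^ 2) := by
  have h4 : (d.update i (d i)).update (i + 1) (d (i + 1)) = d := by
    rw [Finsupp.update_self, Finsupp.update_self]
  by_contra! hcon
  apply hd
  have e1 : MvPowerSeries.coeff d f.1 = 0 := by
    by_contra h
    exact (hcon (d i) (d (i + 1)) rfl (by rwa [h4])).1 rfl rfl
  have e2 : MvPowerSeries.coeff ((d.update i (d (i + 1))).update (i + 1) (d i)) f.1 = 0 := by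
    by_contra h
    exact (hcon (d (i + 1)) (d i) (add_comm _ _) h).2.1 rfl rfl
  rw [coeff_heckeT, e1, e2, Finset.sum_eq_zero]
  · simp
  intro k hk
  rw [Finset.mem_range, lt_min_iff] at hk
  obtain ⟨p', hp'⟩ := Nat.exists_eq_add_of_lt hk.1
  obtain ⟨q', hq'⟩ := Nat.exists_eq_add_of_lt hk.2
  have hs : d i + d (i + 1) - k = k + p' + q' + 2 := by omega
  rw [altCoeff, hs, sub_eq_zero]
  trans 0
  · by_contra h
    have := (hcon k (k + p' + q' + 2) (by omega) h).2.2
    rw [hp', hq'] at this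
    nlinarith
  · symm
    by_contra h
    have := (hcon (k + p' + q' + 2) k (by omega) h).2.2
    rw [hp', hq'] at this
    nlinarith

/-- The exponent of the monomial `x^a` times the monomial of `x_{m+1}, x_{m+2}, …` with exponents
the parts of `λ`. -/
noncomputable def expo {m : ℕ} (Λ : MPartition m) : ℕ →₀ ℕ :=
  Finsupp.onFinset (Finset.range (m + Λ.part.colLen 0))
    (fun j => if h : j < m then Λ.comp ⟨j, h⟩ else Λ.part.rowLen (j - m)) (by
      intro j hj
      rw [Finset.mem_range]
      split_ifs at hj with h
      · omega
      · have := YoungDiagram.mem_iff_lt_colLen.1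
          (YoungDiagram.mem_iff_lt_rowLen.2 (Nat.pos_of_ne_zero hj))
        omega)

theorem expo_of_lt {m : ℕ} (Λ : MPartition m) (j : ℕ) (h : j < m) :
    expo Λ j = Λ.comp ⟨j, h⟩ := by
  simp [expo, h]

theorem expo_mk_of_lt {m : ℕ} (a : Fin m → ℕ) (lam : YoungDiagram) (j : ℕ) (h : j < m) :
    expo ⟨a, lam⟩ j = a ⟨j, h⟩ := expo_of_lt _ j h

theorem expo_add {m : ℕ} (Λ : MPartition m) (r : ℕ) : expo Λ (m + r) = Λ.part.rowLen r := by
  simp [expo]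

theorem rowLen_bot (r : ℕ) : (⊥ : YoungDiagram).rowLen r = 0 := by
  by_contra h
  exact YoungDiagram.notMem_bot (r, 0) (YoungDiagram.mem_iff_lt_rowLen.2 (Nat.pos_of_ne_zero h))

theorem expo_bot_of_ge {m : ℕ} (a : Fin m → ℕ) (j : ℕ) (h : m ≤ j) : expo ⟨a, ⊥⟩ j = 0 := by
  obtain ⟨r, rfl⟩ := Nat.exists_eq_add_of_le h
  rw [expo_add, rowLen_bot]

theorem expo_swapComp {m : ℕ} (i : ℕ) (hi : i + 1 < m) (a : Fin m → ℕ) :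
    ((expo ⟨a, ⊥⟩).update i (expo ⟨a, ⊥⟩ (i + 1))).update (i + 1) (expo ⟨a, ⊥⟩ i) =
      expo ⟨swapComp i hi a, ⊥⟩ := by
  ext j
  simp only [Finsupp.coe_update, Function.update_apply]
  split_ifs with h1 h2
  · subst h1
    rw [expo_mk_of_lt _ _ _ hi, expo_mk_of_lt _ _ _ (by omega), swapComp_right]
  · subst h2
    rw [expo_mk_of_lt _ _ _ hi, expo_mk_of_lt _ _ _ (by omega), swapComp_left]
  · rcases Nat.lt_or_ge j m with h | h
    · rw [expo_mk_of_lt _ _ _ h, expo_mk_of_lt _ _ _ h, swapComp_of_ne _ _ _ _ _ h2 h1]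
    · rw [expo_bot_of_ge _ _ h, expo_bot_of_ge _ _ h]

/-- The operator `T_i` takes a leading monomial with a descent to the one with an ascent. -/
theorem heckeT_leading {m : ℕ} (i : ℕ) (hi : i + 1 < m) (f : SymRing m) (c c' : ℕ →₀ ℕ)
    (hc' : c' = (c.update i (c (i + 1))).update (i + 1) (c i)) (hlt : c i < c (i + 1))
    (h1 : MvPowerSeries.coeff c' f.1 = 1)
    (h2 : ∀ d, MvPowerSeries.coeff d f.1 ≠ 0 → d = c' ∨ sqNorm d < sqNorm c) :
    MvPowerSeries.coeff c (heckeT i hi f).1 = 1 ∧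
      ∀ d, MvPowerSeries.coeff d (heckeT i hi f).1 ≠ 0 → d = c ∨ sqNorm d < sqNorm c := by
  have hci : c' i = c (i + 1) := by simp [hc']
  have hci' : c' (i + 1) = c i := by simp [hc']
  have hsw : (c'.update i (c' (i + 1))).update (i + 1) (c' i) = c := by
    rw [hci, hci', hc']
    ext n
    simp only [Finsupp.coe_update, Function.update_apply]
    split_ifs with h1 h2
    · rw [h1]
    · rw [h2]
    · rfl
  have hsq : sqNorm c' = sqNorm c := by
    have := sqNorm_update_update i c (c (i + 1)) (c i)
    rw [← hc'] at this
    omega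
  have hne : c ≠ c' := by
    intro h
    rw [← h] at hci
    omega
  have hbig : ∀ d, sqNorm c ≤ sqNorm d → d ≠ c' → MvPowerSeries.coeff d f.1 = 0 := by
    intro d h3 h4
    by_contra h
    rcases h2 d h with h5 | h5
    · exact h4 h5
    · omega
  have halt : ∀ d, sqNorm d = sqNorm c →
      ∑ k ∈ Finset.range (min (d i) (d (i + 1))), altCoeff i f.1 d k = 0 := by
    intro d hdc
    refine Finset.sum_eq_zero fun k hk => ?_
    rw [Finset.mem_range, lt_min_iff] at hk
    obtain ⟨p', hp'⟩ := Nat.exists_eq_add_of_lt hk.1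
    obtain ⟨q', hq'⟩ := Nat.exists_eq_add_of_lt hk.2
    have key : ∀ u v, u + v = d i + d (i + 1) → (u = k ∨ v = k) →
        MvPowerSeries.coeff ((d.update i u).update (i + 1) v) f.1 = 0 := by
      intro u v huv hk'
      have h5 := sqNorm_update_update i d u v
      have h6 : sqNorm c < sqNorm ((d.update i u).update (i + 1) v) := by
        rw [hp', hq', hdc] at h5
        rcases hk' with rfl | rfl
        · obtain rfl : v = u + p' + q' + 2 := by omega
          nlinarith
        · obtain rfl : u = v + p' + q' + 2 := by omega
          nlinarith
      refine hbig _ h6.le fun h7 => ?_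
      rw [h7] at h6
      omega
    rw [altCoeff, key _ _ (by omega) (Or.inl rfl), key _ _ (by omega) (Or.inr rfl), sub_zero]
  constructor
  · rw [coeff_heckeT, if_neg (by omega), if_pos hlt, ← hc', h1, hbig c le_rfl hne, halt c rfl]
    ring
  · intro d hd
    obtain ⟨u, v, huv, hne0, hcase⟩ := exists_coeff_of_coeff_heckeT i hi _ d hd
    have h5 := sqNorm_update_update i d u v
    rcases h2 _ hne0 with g3 | g3
    · rcases hcase with ⟨rfl, rfl⟩ | ⟨rfl, rfl⟩ | h
      · -- The exponent `c'` itself does not occur in `T_i f`, as it has a descent.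
        rw [Finsupp.update_self, Finsupp.update_self] at g3
        subst g3
        exfalso
        apply hd
        rw [coeff_heckeT, if_pos (by omega), hsw, hbig c le_rfl hne, halt d hsq]
        ring
      · left
        have hg : ∀ n, c' n = if n = i + 1 then d i else if n = i then d (i + 1) else d n := by
          intro n
          rw [← g3]
          simp only [Finsupp.coe_update, Function.update_apply]
        rw [← hsw, hg i, hg (i + 1), if_pos rfl, if_neg (by omega), if_pos rfl]
        ext n
        simp only [Finsupp.coe_update, Function.update_apply, hg n]
        split_ifs with h7 h8
        · rw [h7]
        · rw [h8]
        · rfl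
      · right
        rw [g3] at h5
        omega
    · right
      rcases hcase with ⟨rfl, rfl⟩ | ⟨rfl, rfl⟩ | h <;> omega

/-- The polynomial `H_a` is homogeneous in `x_1, …, x_m`, and it is the sum of `x^a` and of
monomials whose exponents have a smaller sum of squares. -/
theorem coeff_hallLittlewood {m : ℕ} (a : Fin m → ℕ) :
    MvPowerSeries.coeff (expo ⟨a, ⊥⟩) (hallLittlewood a).1 = 1 ∧
    ∀ d, MvPowerSeries.coeff d (hallLittlewood a).1 ≠ 0 →
      (∀ j, m ≤ j → d j = 0) ∧ d.degree = (expo ⟨a, ⊥⟩).degree ∧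
        (d = expo ⟨a, ⊥⟩ ∨ sqNorm d < sqNorm (expo ⟨a, ⊥⟩)) := by
  induction hN : ∑ j : Fin m, (j : ℕ) * a j using Nat.strong_induction_on generalizing a with
  | _ N ih =>
  subst hN
  by_cases hD : Dominant a
  · have h : (hallLittlewood a).1 = MvPowerSeries.monomial (expo ⟨a, ⊥⟩) (1 : QT) := by
      rw [hallLittlewood_of_dominant hD]
      have h1 : ((∏ j, x j ^ a j : SymRing m) : MvPowerSeries ℕ QT) =
          ∏ j : Fin m, MvPowerSeries.monomial (Finsupp.single (j : ℕ) (a j)) (1 : QT) := by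
        rw [SubmonoidClass.coe_finsetProd]
        refine Finset.prod_congr rfl fun j _ => ?_
        rw [SubmonoidClass.coe_pow, x, MvPowerSeries.X_pow_eq]
      rw [h1, MvPowerSeries.prod_monomial, Finset.prod_const_one]
      congr 2
      ext n
      rw [Finsupp.finsetSum_apply]
      rcases Nat.lt_or_ge n m with h | h
      · rw [expo_mk_of_lt _ _ _ h, Finset.sum_eq_single ⟨n, h⟩]
        · simp
        · intro j _ hj
          rw [Finsupp.single_apply, if_neg]
          exact fun h' => hj (Fin.ext h')
        · simp
      · rw [expo_bot_of_ge _ _ h, Finset.sum_eq_zero]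
        intro j _
        rw [Finsupp.single_apply, if_neg]
        have := j.isLt
        omega
    rw [h]
    refine ⟨MvPowerSeries.coeff_monomial_same _ _, fun d hd => ?_⟩
    have := MvPowerSeries.eq_of_coeff_monomial_ne_zero hd
    subst this
    exact ⟨fun j hj => expo_bot_of_ge _ _ hj, rfl, Or.inl rfl⟩
  obtain ⟨i, hi, hlt, hH⟩ := exists_hallLittlewood_eq hD
  obtain ⟨ih1, ih2⟩ := ih _ (weight_swapComp_lt i hi a hlt) _ rfl
  have hcs := expo_swapComp i hi a
  have hci := expo_mk_of_lt a ⊥ i (by omega)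
  have hci' := expo_mk_of_lt a ⊥ (i + 1) hi
  have hdeg := degree_update_update i (expo ⟨a, ⊥⟩) (expo ⟨a, ⊥⟩ (i + 1)) (expo ⟨a, ⊥⟩ i)
  have hsq := sqNorm_update_update i (expo ⟨a, ⊥⟩) (expo ⟨a, ⊥⟩ (i + 1)) (expo ⟨a, ⊥⟩ i)
  rw [hcs] at hdeg hsq
  obtain ⟨g1, g2⟩ := heckeT_leading i hi (hallLittlewood (swapComp i hi a)) (expo ⟨a, ⊥⟩)
    (expo ⟨swapComp i hi a, ⊥⟩) hcs.symm (by rw [hci, hci']; exact hlt) ih1 (fun d hd => by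
      have := (ih2 d hd).2.2
      rwa [show sqNorm (expo ⟨swapComp i hi a, ⊥⟩) = sqNorm (expo ⟨a, ⊥⟩) by omega] at this)
  rw [hH]
  refine ⟨g1, fun d hd => ?_⟩
  obtain ⟨u, v, huv, hne0, -⟩ := exists_coeff_of_coeff_heckeT i hi _ d hd
  obtain ⟨g3, g4, -⟩ := ih2 _ hne0
  have h6 := degree_update_update i d u v
  refine ⟨fun j hj => ?_, by omega, g2 d hd⟩
  have := g3 j hj
  simp only [Finsupp.coe_update, Function.update_apply] at this
  rwa [if_neg (by omega), if_neg (by omega)] at this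

/-! ### Leading terms of the Schur functions -/

/-- The coefficient of `X_j ^ n` in `f`, as a power series in the other variables. -/
noncomputable def slice (j n : ℕ) : MvPowerSeries ℕ QT →ₗ[QT] MvPowerSeries ℕ QT where
  toFun f := fun d => if d j = 0 then MvPowerSeries.coeff (d + Finsupp.single j n) f else 0
  map_add' f g := by
    funext d
    change (if d j = 0 then _ else (0 : QT)) =
      (if d j = 0 then _ else (0 : QT)) + (if d j = 0 then _ else (0 : QT))
    split_ifs
    · rw [map_add]
    · rw [add_zero]
  map_smul' c f := by
    funext d
    change (if d j = 0 then _ else (0 : QT)) = c • (if d j = 0 then _ else (0 : QT))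
    split_ifs
    · rw [map_smul]
    · rw [smul_zero]

theorem coeff_slice (j n : ℕ) (f : MvPowerSeries ℕ QT) (d : ℕ →₀ ℕ) :
    MvPowerSeries.coeff d (slice j n f) =
      if d j = 0 then MvPowerSeries.coeff (d + Finsupp.single j n) f else 0 := rfl

theorem coeff_eq_coeff_slice (j : ℕ) (f : MvPowerSeries ℕ QT) (d : ℕ →₀ ℕ) :
    MvPowerSeries.coeff d f = MvPowerSeries.coeff (d.erase j) (slice j (d j) f) := by
  rw [coeff_slice, if_pos Finsupp.erase_same, Finsupp.erase_add_single]

/-- The power series in which the variable `X_j` does not occur. -/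
noncomputable def freeOf (j : ℕ) : Subalgebra QT (MvPowerSeries ℕ QT) where
  carrier := {g | ∀ d, MvPowerSeries.coeff d g ≠ 0 → d j = 0}
  mul_mem' := by
    intro f g hf hg d hd
    rw [MvPowerSeries.coeff_mul] at hd
    obtain ⟨p, hp, hne⟩ := Finset.exists_ne_zero_of_sum_ne_zero hd
    rw [Finset.HasAntidiagonal.mem_antidiagonal] at hp
    rw [← hp, Finsupp.add_apply, hf _ (left_ne_zero_of_mul hne), hg _ (right_ne_zero_of_mul hne)]
  add_mem' := by
    intro f g hf hg d hd
    by_cases h : MvPowerSeries.coeff d f = 0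
    · exact hg d fun h' => hd (by rw [map_add, h, h', add_zero])
    · exact hf d h
  algebraMap_mem' := by
    intro c d hd
    rw [MvPowerSeries.algebraMap_apply, MvPowerSeries.coeff_C] at hd
    by_cases h : d = 0
    · simp [h]
    · simp [h] at hd

theorem slice_mul_of_mem_freeOf {j : ℕ} {g : MvPowerSeries ℕ QT} (hg : g ∈ freeOf j) (n : ℕ)
    (f : MvPowerSeries ℕ QT) : slice j n (g * f) = g * slice j n f := by
  have hg' : ∀ d : ℕ →₀ ℕ, d j ≠ 0 → MvPowerSeries.coeff d g = 0 := by
    intro d hd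
    by_contra h
    exact hd (hg d h)
  ext d
  rw [coeff_slice, MvPowerSeries.coeff_mul]
  split_ifs with h
  · rw [MvPowerSeries.coeff_mul]
    symm
    refine Finset.sum_of_injOn (fun p => (p.1, p.2 + Finsupp.single j n)) ?_ ?_ ?_ ?_
    · intro p _ q _ hpq
      simp only [Prod.mk.injEq, add_left_inj] at hpq
      exact Prod.ext hpq.1 hpq.2
    · intro p hp
      simp only [Finset.mem_coe, Finset.HasAntidiagonal.mem_antidiagonal] at hp ⊢
      rw [← hp, add_assoc]
    · intro p hp hp'
      rw [Finset.HasAntidiagonal.mem_antidiagonal] at hp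
      rcases eq_or_ne (p.1 j) 0 with h0 | h0
      · exfalso
        refine hp' ⟨(p.1, p.2.erase j), ?_, ?_⟩
        · rw [Finset.mem_coe, Finset.HasAntidiagonal.mem_antidiagonal]
          ext k
          have := congrArg (fun d => d k) hp
          simp only [Finsupp.add_apply] at this ⊢
          rcases eq_or_ne k j with rfl | hk
          · rw [Finsupp.erase_same, h0, h, add_zero]
          · rw [Finsupp.erase_ne hk, this, Finsupp.single_eq_of_ne hk, add_zero]
        · refine Prod.ext rfl ?_
          have := congrArg (fun d => d j) hp
          simp only [Finsupp.add_apply, h0, h, Finsupp.single_eq_same, zero_add] at this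
          rw [← this]
          exact Finsupp.erase_add_single _ _
      · rw [hg' _ h0, zero_mul]
    · intro p hp
      rw [Finset.HasAntidiagonal.mem_antidiagonal] at hp
      have := congrArg (fun d => d j) hp
      simp only [Finsupp.add_apply, h] at this
      rw [coeff_slice, if_pos (by omega)]
  · rw [MvPowerSeries.coeff_mul, Finset.sum_eq_zero]
    intro p hp
    rw [Finset.HasAntidiagonal.mem_antidiagonal] at hp
    have := congrArg (fun d => d j) hp
    simp only [Finsupp.add_apply] at this
    rcases eq_or_ne (p.1 j) 0 with h0 | h0
    · rw [coeff_slice, if_neg (by omega), mul_zero]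
    · rw [hg' _ h0, zero_mul]

/-- The complete homogeneous symmetric function of degree `z` in all variables other than
`X_m, …, X_{m+k-1}`; it is `0` for negative `z`. -/
noncomputable def hCut (m k : ℕ) (z : ℤ) : MvPowerSeries ℕ QT := fun d =>
  open Classical in if (d.degree : ℤ) = z ∧ ∀ j, m ≤ j → j < m + k → d j = 0 then 1 else 0

open Classical in
theorem coeff_hCut (m k : ℕ) (z : ℤ) (d : ℕ →₀ ℕ) :
    MvPowerSeries.coeff d (hCut m k z) =
      if (d.degree : ℤ) = z ∧ ∀ j, m ≤ j → j < m + k → d j = 0 then 1 else 0 := rfl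

theorem hCut_of_neg (m k : ℕ) (z : ℤ) (hz : z < 0) : hCut m k z = 0 := by
  ext d
  rw [coeff_hCut, if_neg, map_zero]
  omega

theorem hCut_zero (m k : ℕ) : hCut m k 0 = 1 := by
  classical
  ext d
  rw [coeff_hCut, MvPowerSeries.coeff_one]
  refine if_congr ?_ rfl rfl
  constructor
  · intro h
    exact (Finsupp.degree_eq_zero_iff d).1 (by exact_mod_cast h.1)
  · rintro rfl
    simp

theorem hCut_sub_mul (m k : ℕ) (z : ℤ) :
    hCut m k z = hCut m (k + 1) z + MvPowerSeries.X (m + k) * hCut m k (z - 1) := by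
  ext d
  rw [map_add, MvPowerSeries.X, MvPowerSeries.coeff_monomial_mul, one_mul, coeff_hCut, coeff_hCut,
    coeff_hCut]
  by_cases h : d (m + k) = 0
  · have h2 : ¬ Finsupp.single (m + k) 1 ≤ d := by
      rw [Finsupp.single_le_iff]; omega
    rw [if_neg h2, add_zero]
    refine if_congr (and_congr_right fun _ => ⟨fun hd j h3 h4 => ?_, fun hd j h3 h4 => ?_⟩) rfl rfl
    · rcases eq_or_ne j (m + k) with rfl | h5
      · exact h
      · exact hd j h3 (by omega)
    · exact hd j h3 (by omega)
  · have h2 : Finsupp.single (m + k) 1 ≤ d := by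
      rw [Finsupp.single_le_iff]; omega
    have h3 : ((d - Finsupp.single (m + k) 1).degree : ℤ) = d.degree - 1 := by
      have := congrArg Finsupp.degree (tsub_add_cancel_of_le h2)
      rw [map_add, Finsupp.degree_single] at this
      omega
    rw [if_pos h2, if_neg (c := _ ∧ ∀ j, m ≤ j → j < m + (k + 1) → d j = 0)
      (fun h4 => h (h4.2 _ (by omega) (by omega))), zero_add, h3]
    refine if_congr (and_congr (by omega) (forall_congr' fun j => imp_congr_right fun h5 =>
      imp_congr_right fun h6 => ?_)) rfl rfl
    rw [Finsupp.tsub_apply, Finsupp.single_eq_of_ne (by omega), tsub_zero]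

theorem hCut_mem_freeOf (m k : ℕ) (z : ℤ) : hCut m (k + 1) z ∈ freeOf (m + k) := by
  intro d hd
  rw [coeff_hCut] at hd
  by_contra h
  exact hd (if_neg fun h' => h (h'.2 _ (by omega) (by omega)))

theorem slice_hCut (m k n : ℕ) (z : ℤ) :
    slice (m + k) n (hCut m k z) = hCut m (k + 1) (z - n) := by
  ext d
  rw [coeff_slice, coeff_hCut, coeff_hCut, map_add Finsupp.degree, Finsupp.degree_single]
  split_ifs with h0 h1 h2 h2 h2
  · rfl
  · exfalso
    refine h2 ⟨by push_cast at h1; omega, fun j h3 h4 => ?_⟩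
    rcases eq_or_ne j (m + k) with rfl | h5
    · exact h0
    · have := h1.2 j h3 (by omega)
      rw [Finsupp.add_apply] at this
      omega
  · exfalso
    refine h1 ⟨by push_cast; omega, fun j h3 h4 => ?_⟩
    rw [Finsupp.add_apply, Finsupp.single_eq_of_ne (by omega), add_zero]
    exact h2.2 j h3 (by omega)
  · rfl
  · exact absurd (h2.2 _ (by omega) (by omega)) h0
  · rfl

/-- The Jacobi–Trudi determinant of the sequence `α` in all variables other than
`X_m, …, X_{m+k-1}`. -/
noncomputable def jacobiTrudi (m k n : ℕ) (α : ℕ → ℕ) : MvPowerSeries ℕ QT :=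
  Matrix.det (Matrix.of fun i j : Fin n => hCut m k ((α i : ℤ) - i + j))

theorem det_mem {n : ℕ} (A : Subalgebra QT (MvPowerSeries ℕ QT))
    (M : Matrix (Fin n) (Fin n) (MvPowerSeries ℕ QT)) (hM : ∀ i j, M i j ∈ A) : M.det ∈ A := by
  rw [Matrix.det_apply]
  refine A.sum_mem fun σ _ => ?_
  rw [Units.smul_def]
  exact zsmul_mem (A.prod_mem fun i _ => hM _ _) _

/-- After column operations only the first column of the Jacobi–Trudi matrix involves the variable
`X_{m+k}`; the determinant is then expanded along that column. -/
theorem slice_jacobiTrudi (m k n N : ℕ) (α : ℕ → ℕ) :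
    slice (m + k) N (jacobiTrudi m k (n + 1) α) =
      ∑ i : Fin (n + 1), (-1) ^ (i : ℕ) *
        Matrix.det (Matrix.of fun r c : Fin n =>
          hCut m (k + 1) ((α (i.succAbove r) : ℤ) - (i.succAbove r : ℕ) + (c + 1))) *
        hCut m (k + 1) ((α i : ℤ) - i - N) := by
  rw [jacobiTrudi, Matrix.det_eq_of_forall_col_eq_smul_add_pred
    (B := Matrix.of fun i j : Fin (n + 1) => if j = 0 then hCut m k ((α i : ℤ) - i)
      else hCut m (k + 1) ((α i : ℤ) - i + j)) (fun _ => MvPowerSeries.X (m + k)),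
    Matrix.det_succ_column_zero, map_sum]
  · refine Finset.sum_congr rfl fun i _ => ?_
    have hsub : ((Matrix.of fun i j : Fin (n + 1) => if j = 0 then hCut m k ((α i : ℤ) - i)
        else hCut m (k + 1) ((α i : ℤ) - i + j)).submatrix i.succAbove Fin.succ) =
        Matrix.of fun r c : Fin n =>
          hCut m (k + 1) ((α (i.succAbove r) : ℤ) - (i.succAbove r : ℕ) + (c + 1)) := by
      ext1 r c
      simp
    rw [hsub, Matrix.of_apply, if_pos rfl, mul_right_comm, slice_mul_of_mem_freeOf, slice_hCut]
    refine (freeOf _).mul_mem ((freeOf _).pow_mem ((freeOf _).neg_mem (freeOf _).one_mem) _)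
      (det_mem _ _ fun r c => hCut_mem_freeOf _ _ _)
  · intro i
    simp
  · intro i j
    simp only [Matrix.of_apply, if_neg (Fin.succ_ne_zero j)]
    rw [hCut_sub_mul m k]
    congr 3
    simp
    ring

theorem slice_jacobiTrudi_of_lt (m k n N : ℕ) (α : ℕ → ℕ) (hα : Antitone α) (hN : α 0 < N) :
    slice (m + k) N (jacobiTrudi m k (n + 1) α) = 0 := by
  rw [slice_jacobiTrudi, Finset.sum_eq_zero]
  intro i _
  have := hα (Nat.zero_le (i : ℕ))
  rw [hCut_of_neg _ _ _ (by omega), mul_zero]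

theorem slice_jacobiTrudi_self (m k n : ℕ) (α : ℕ → ℕ) (hα : Antitone α) :
    slice (m + k) (α 0) (jacobiTrudi m k (n + 1) α) =
      jacobiTrudi m (k + 1) n fun r => α (r + 1) := by
  rw [slice_jacobiTrudi, Finset.sum_eq_single 0]
  · rw [jacobiTrudi]
    simp only [Fin.val_zero, pow_zero, one_mul, CharP.cast_eq_zero, sub_zero, sub_self, hCut_zero,
      mul_one, Fin.succAbove_zero, Fin.val_succ]
    congr 1
    ext1 r c
    simp only [Matrix.of_apply]
    congr 1
    push_cast
    ring
  · intro i _ hi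
    have := hα (Nat.zero_le (i : ℕ))
    have : 0 < (i : ℕ) := Nat.pos_of_ne_zero fun h => hi (Fin.ext h)
    rw [hCut_of_neg _ _ _ (by omega), mul_zero]
  · simp

/-- The coefficient extraction behind the triangularity of the Schur functions: `G` is a power
series in `X_0, …, X_{m-1}`. -/
theorem coeff_mul_jacobiTrudi (m n : ℕ) (G : MvPowerSeries ℕ QT) (hG : ∀ j, m ≤ j → G ∈ freeOf j)
    (k : ℕ) (α : ℕ → ℕ) (hα : Antitone α) (hn : ∀ r, n ≤ r → α r = 0) (d : ℕ →₀ ℕ)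
    (hd : ∀ j, m ≤ j → j < m + k → d j = 0) :
    (∀ r₀, (∀ r < r₀, d (m + k + r) = α r) → α r₀ < d (m + k + r₀) →
      MvPowerSeries.coeff d (G * jacobiTrudi m k n α) = 0) ∧
    ((∀ r, d (m + k + r) = α r) → MvPowerSeries.coeff d (G * jacobiTrudi m k n α) =
      MvPowerSeries.coeff (d.filter (· < m)) G) := by
  induction n generalizing k α d with
  | zero =>
    have h1 : jacobiTrudi m k 0 α = 1 := Matrix.det_fin_zero
    rw [h1, mul_one]
    constructor
    · intro r₀ _ h
      by_contra h'
      have := hG (m + k + r₀) (by omega) d h'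
      omega
    · intro h
      refine congrArg (fun e => MvPowerSeries.coeff e G) ?_
      ext j
      rw [Finsupp.filter_apply]
      split_ifs with hj
      · rfl
      · rcases Nat.lt_or_ge j (m + k) with h2 | h2
        · exact hd j (by omega) h2
        · obtain ⟨r, rfl⟩ := Nat.exists_eq_add_of_le h2
          rw [h, hn r (Nat.zero_le _)]
  | succ n ih =>
    have hmul : MvPowerSeries.coeff d (G * jacobiTrudi m k (n + 1) α) =
        MvPowerSeries.coeff (d.erase (m + k))
          (G * slice (m + k) (d (m + k)) (jacobiTrudi m k (n + 1) α)) := by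
      rw [coeff_eq_coeff_slice (m + k), slice_mul_of_mem_freeOf (hG _ (by omega))]
    have hih := ih (k + 1) (fun r => α (r + 1)) (fun a b hab => hα (by omega))
      (fun r hr => hn _ (by omega)) (d.erase (m + k)) (fun j h1 h2 => by
        rcases eq_or_ne j (m + k) with rfl | h3
        · exact Finsupp.erase_same
        · rw [Finsupp.erase_ne h3]
          exact hd j h1 (by omega))
    have hsh : ∀ r, d.erase (m + k) (m + (k + 1) + r) = d (m + k + (r + 1)) := by
      intro r
      rw [Finsupp.erase_ne (by omega)]
      congr 1
      ring
    constructor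
    · intro r₀ h1 h2
      rw [hmul]
      cases r₀ with
      | zero => rw [slice_jacobiTrudi_of_lt m k n (d (m + k)) α hα h2, mul_zero, map_zero]
      | succ r₀ =>
        have h0 : d (m + k) = α 0 := h1 0 (by omega)
        rw [h0, slice_jacobiTrudi_self _ _ _ _ hα]
        refine hih.1 r₀ (fun r hr => ?_) ?_
        · rw [hsh]
          exact h1 (r + 1) (by omega)
        · rw [hsh]
          exact h2
    · intro h
      have h0 : d (m + k) = α 0 := h 0
      rw [hmul, h0, slice_jacobiTrudi_self _ _ _ _ hα, hih.2 (fun r => by rw [hsh]; exact h _)]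
      refine congrArg (fun e => MvPowerSeries.coeff e G) ?_
      ext j
      rw [Finsupp.filter_apply, Finsupp.filter_apply]
      split_ifs with hj
      · exact Finsupp.erase_ne (by omega)
      · rfl

theorem coe_schur (m : ℕ) (lam : YoungDiagram) :
    (schur m lam : MvPowerSeries ℕ QT) = jacobiTrudi m 0 (lam.colLen 0) lam.rowLen := by
  rw [schur, jacobiTrudi]
  refine ((SymRing m).val.map_det _).trans ?_
  congr 1
  ext1 i j
  simp only [AlgHom.mapMatrix_apply, Matrix.map_apply, Matrix.of_apply]
  split_ifs with h
  · ext d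
    rw [coeff_hCut]
    change (if d.degree = _ then (1 : QT) else 0) = _
    refine if_congr ⟨fun h1 => ⟨by omega, fun j h1 h2 => by omega⟩, fun h1 => ?_⟩ rfl rfl
    have := h1.1
    omega
  · rw [hCut_of_neg _ _ _ (by omega), map_zero]

theorem rowLen_antitone (lam : YoungDiagram) : Antitone lam.rowLen :=
  fun _ _ h => lam.rowLen_anti _ _ h

theorem rowLen_eq_zero {lam : YoungDiagram} {r : ℕ} (h : lam.colLen 0 ≤ r) : lam.rowLen r = 0 := by
  by_contra h'
  have := YoungDiagram.mem_iff_lt_colLen.1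
    (YoungDiagram.mem_iff_lt_rowLen.2 (Nat.pos_of_ne_zero h'))
  omega

theorem hallLittlewood_mem_freeOf {m : ℕ} (a : Fin m → ℕ) (j : ℕ) (hj : m ≤ j) :
    (hallLittlewood a).1 ∈ freeOf j :=
  fun d hd => ((coeff_hallLittlewood a).2 d hd).1 j hj

theorem coeff_kFun_of_lex_lt {m : ℕ} (Λ Ω : MPartition m)
    (h : toLex Λ.part.rowLen < toLex Ω.part.rowLen) :
    MvPowerSeries.coeff (expo Ω) (kFun Λ).1 = 0 := by
  obtain ⟨r₀, h1, h2⟩ := h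
  change MvPowerSeries.coeff (expo Ω) ((hallLittlewood Λ.comp).1 * (schur m Λ.part).1) = 0
  rw [coe_schur]
  refine (coeff_mul_jacobiTrudi m _ _ (hallLittlewood_mem_freeOf _) 0 _ (rowLen_antitone _)
    (fun r hr => rowLen_eq_zero hr) _ (fun j _ _ => by omega)).1 r₀ (fun r hr => ?_) ?_
  · rw [add_zero, expo_add]
    exact (h1 r hr).symm
  · rw [add_zero, expo_add]
    exact h2

theorem coeff_kFun_of_part_eq {m : ℕ} (Λ Ω : MPartition m) (h : Λ.part = Ω.part) :
    MvPowerSeries.coeff (expo Ω) (kFun Λ).1 =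
      MvPowerSeries.coeff (expo ⟨Ω.comp, ⊥⟩) (hallLittlewood Λ.comp).1 := by
  change MvPowerSeries.coeff (expo Ω) ((hallLittlewood Λ.comp).1 * (schur m Λ.part).1) = _
  rw [coe_schur, (coeff_mul_jacobiTrudi m _ _ (hallLittlewood_mem_freeOf _) 0 _ (rowLen_antitone _)
    (fun r hr => rowLen_eq_zero hr) _ (fun j _ _ => by omega)).2]
  · refine congrArg (fun e => MvPowerSeries.coeff e (hallLittlewood Λ.comp).1) ?_
    ext j
    rw [Finsupp.filter_apply]
    split_ifs with hj
    · rw [expo_of_lt _ _ hj, expo_mk_of_lt _ _ _ hj]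
    · rw [expo_bot_of_ge _ _ (by omega)]
  · intro r
    rw [add_zero, expo_add, h]

/-! ### The functions `k_Λ` form a basis -/

/-- The homogeneous power series of degree `z`. -/
noncomputable def homog (z : ℤ) : Submodule QT (MvPowerSeries ℕ QT) where
  carrier := {f | ∀ d, MvPowerSeries.coeff d f ≠ 0 → (d.degree : ℤ) = z}
  zero_mem' := fun d hd => absurd (map_zero _) hd
  add_mem' := by
    intro f g hf hg d hd
    by_cases h : MvPowerSeries.coeff d f = 0
    · exact hg d fun h' => hd (by rw [map_add, h, h', add_zero])
    · exact hf d h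
  smul_mem' := by
    intro c f hf d hd
    refine hf d fun h => hd ?_
    rw [map_smul, h, smul_zero]

theorem mul_mem_homog {z w : ℤ} {f g : MvPowerSeries ℕ QT} (hf : f ∈ homog z) (hg : g ∈ homog w) :
    f * g ∈ homog (z + w) := by
  intro d hd
  rw [MvPowerSeries.coeff_mul] at hd
  obtain ⟨p, hp, hne⟩ := Finset.exists_ne_zero_of_sum_ne_zero hd
  rw [Finset.HasAntidiagonal.mem_antidiagonal] at hp
  have h1 := hf _ (left_ne_zero_of_mul hne)
  have h2 := hg _ (right_ne_zero_of_mul hne)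
  rw [← hp, map_add Finsupp.degree]
  push_cast
  omega

theorem one_mem_homog : (1 : MvPowerSeries ℕ QT) ∈ homog 0 := by
  classical
  intro d hd
  rw [MvPowerSeries.coeff_one] at hd
  have : d = 0 := by
    by_contra h
    exact hd (if_neg h)
  simp [this]

theorem prod_mem_homog {ι : Type*} (s : Finset ι) (f : ι → MvPowerSeries ℕ QT) (z : ι → ℤ)
    (h : ∀ i ∈ s, f i ∈ homog (z i)) : ∏ i ∈ s, f i ∈ homog (∑ i ∈ s, z i) := by
  classical
  induction s using Finset.induction_on with
  | empty => exact one_mem_homog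
  | insert i s hi ih =>
    rw [Finset.prod_insert hi, Finset.sum_insert hi]
    exact mul_mem_homog (h i (Finset.mem_insert_self _ _))
      (ih fun j hj => h j (Finset.mem_insert_of_mem hj))

theorem jacobiTrudi_mem_homog (m k n : ℕ) (α : ℕ → ℕ) :
    jacobiTrudi m k n α ∈ homog (∑ i : Fin n, (α i : ℤ)) := by
  rw [jacobiTrudi, Matrix.det_apply]
  refine Submodule.sum_mem _ fun σ _ => ?_
  rw [Units.smul_def]
  refine zsmul_mem ?_ _
  have h := prod_mem_homog Finset.univ
    (fun i : Fin n => hCut m k ((α (σ i) : ℤ) - (σ i : ℕ) + (i : ℕ)))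
    (fun i : Fin n => (α (σ i) : ℤ) - (σ i : ℕ) + (i : ℕ)) (fun i _ d hd => by
      rw [coeff_hCut] at hd
      by_contra h
      exact hd (if_neg fun h' => h h'.1))
  rw [Finset.sum_add_distrib, Finset.sum_sub_distrib,
    Equiv.sum_comp σ (fun i : Fin n => (α i : ℤ)),
    Equiv.sum_comp σ (fun i : Fin n => ((i : ℕ) : ℤ)), sub_add_cancel] at h
  exact h

theorem degree_eq_sum_of_support_subset (d : ℕ →₀ ℕ) (s : Finset ℕ)
    (h : ∀ j, j ∉ s → d j = 0) : d.degree = ∑ j ∈ s, d j := by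
  refine Finset.sum_subset (fun j hj => ?_) fun j _ hj => Finsupp.notMem_support_iff.1 hj
  by_contra h'
  exact Finsupp.mem_support_iff.1 hj (h j h')

theorem card_eq_sum_rowLen (lam : YoungDiagram) :
    lam.card = ∑ r ∈ Finset.range (lam.colLen 0), lam.rowLen r := by
  rw [YoungDiagram.card, Finset.card_eq_sum_card_fiberwise (f := Prod.fst)
    (t := Finset.range (lam.colLen 0))]
  · refine Finset.sum_congr rfl fun r _ => ?_
    rw [YoungDiagram.rowLen_eq_card]
    rfl
  · intro c hc
    rw [Finset.mem_coe, Finset.mem_range, ← YoungDiagram.mem_iff_lt_colLen]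
    exact lam.up_left_mem le_rfl (Nat.zero_le _) (show (c.1, c.2) ∈ lam from hc)

theorem degree_expo_bot {m : ℕ} (a : Fin m → ℕ) : (expo ⟨a, ⊥⟩).degree = ∑ j, a j := by
  rw [degree_eq_sum_of_support_subset _ (Finset.range m) fun j hj =>
    expo_bot_of_ge _ _ (by simpa using hj), Finset.sum_range]
  exact Finset.sum_congr rfl fun j _ => expo_mk_of_lt _ _ _ j.isLt

/-- The degree of `k_Λ`. -/
noncomputable def MPartition.size {m : ℕ} (Λ : MPartition m) : ℕ := ∑ j, Λ.comp j + Λ.part.card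

theorem degree_expo {m : ℕ} (Λ : MPartition m) : (expo Λ).degree = Λ.size := by
  rw [degree_eq_sum_of_support_subset _ (Finset.range (m + Λ.part.colLen 0)) fun j hj => ?_,
    Finset.sum_range_add, MPartition.size, card_eq_sum_rowLen, Finset.sum_range]
  · congr 1
    · exact Finset.sum_congr rfl fun j _ => expo_of_lt _ _ j.isLt
    · exact Finset.sum_congr rfl fun j _ => expo_add _ _
  · rw [Finset.mem_range, not_lt] at hj
    obtain ⟨r, rfl⟩ := Nat.exists_eq_add_of_le hj
    rw [add_assoc, expo_add, rowLen_eq_zero (by omega)]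

theorem degree_of_coeff_kFun {m : ℕ} (Λ : MPartition m) (d : ℕ →₀ ℕ)
    (hd : MvPowerSeries.coeff d (kFun Λ).1 ≠ 0) : d.degree = Λ.size := by
  have h1 : (hallLittlewood Λ.comp).1 ∈ homog (∑ j, Λ.comp j : ℕ) := by
    intro d hd
    rw [((coeff_hallLittlewood Λ.comp).2 d hd).2.1, degree_expo_bot]
  have h2 := mul_mem_homog h1 (jacobiTrudi_mem_homog m 0 (Λ.part.colLen 0) Λ.part.rowLen)
  rw [← coe_schur] at h2
  have h3 := h2 d hd
  rw [MPartition.size, card_eq_sum_rowLen, Finset.sum_range]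
  exact_mod_cast h3

theorem finite_size_le (m D : ℕ) : {Λ : MPartition m | Λ.size ≤ D}.Finite := by
  refine Set.Finite.of_injOn (f := fun Λ => (Λ.comp, Λ.part.cells))
    (t := Set.Iic (fun _ => D) ×ˢ
      ((Finset.range D ×ˢ Finset.range D).powerset : Set (Finset (ℕ × ℕ)))) ?_ ?_
    ((Set.finite_Iic _).prod (Finset.finite_toSet _))
  · intro Λ hΛ
    simp only [Set.mem_ofPred_eq, MPartition.size] at hΛ
    refine ⟨fun j => ?_, ?_⟩
    · have := Finset.single_le_sum (f := Λ.comp) (fun i _ => Nat.zero_le _) (Finset.mem_univ j)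
      change Λ.comp j ≤ D
      omega
    · rw [Finset.mem_coe, Finset.mem_powerset]
      intro c hc
      have h1 := YoungDiagram.mem_iff_lt_rowLen.1 (show (c.1, c.2) ∈ Λ.part from hc)
      have h2 := YoungDiagram.mem_iff_lt_colLen.1 (show (c.1, c.2) ∈ Λ.part from hc)
      have h3 : Λ.part.rowLen c.1 ≤ Λ.part.card := by
        rw [YoungDiagram.rowLen_eq_card]
        exact Finset.card_le_card (Finset.filter_subset _ _)
      have h4 : Λ.part.colLen c.2 ≤ Λ.part.card := by
        rw [YoungDiagram.colLen_eq_card]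
        exact Finset.card_le_card (Finset.filter_subset _ _)
      rw [Finset.mem_product, Finset.mem_range, Finset.mem_range]
      omega
  · intro Λ _ Ω _ h
    simp only [Prod.mk.injEq] at h
    exact MPartition.ext h.1 (YoungDiagram.ext h.2)

theorem linearIndependent_of_triangular {K ι V P : Type*} [Field K] [AddCommGroup V] [Module K V]
    [LinearOrder P] (v : ι → V) (φ : ι → V →ₗ[K] K) (ρ : ι → P) (h1 : ∀ i, φ i (v i) ≠ 0)
    (h2 : ∀ i j, i ≠ j → ρ i ≤ ρ j → φ j (v i) = 0) : LinearIndependent K v := by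
  classical
  rw [linearIndependent_iff']
  intro s g hg
  by_contra! hcon
  obtain ⟨i, hi, hgi⟩ := hcon
  obtain ⟨j, hj, hmax⟩ := Finset.exists_max_image (s.filter fun i => g i ≠ 0) ρ
    ⟨i, Finset.mem_filter.2 ⟨hi, hgi⟩⟩
  rw [Finset.mem_filter] at hj
  have h := congrArg (φ j) hg
  rw [map_sum, map_zero, Finset.sum_eq_single j] at h
  · rw [map_smul, smul_eq_mul] at h
    exact mul_ne_zero hj.2 (h1 j) h
  · intro k hk hkj
    rw [map_smul]
    by_cases hgk : g k = 0
    · rw [hgk, zero_smul]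
    · rw [h2 k j hkj (hmax k (Finset.mem_filter.2 ⟨hk, hgk⟩)), smul_zero]
  · exact fun h => absurd hj.1 h

/-- The coefficient of the monomial with exponent `d`, as a linear form on `R_m`. -/
noncomputable def coeffForm (m : ℕ) (d : ℕ →₀ ℕ) : SymRing m →ₗ[QT] QT :=
  (MvPowerSeries.coeff d).comp (SymRing m).val.toLinearMap

theorem coeffForm_apply (m : ℕ) (d : ℕ →₀ ℕ) (f : SymRing m) :
    coeffForm m d f = MvPowerSeries.coeff d f.1 := rfl

theorem eq_of_rowLen_eq {lam mu : YoungDiagram} (h : lam.rowLen = mu.rowLen) : lam = mu := by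
  refine YoungDiagram.ext (Finset.ext fun c => ?_)
  change (c.1, c.2) ∈ lam ↔ (c.1, c.2) ∈ mu
  rw [YoungDiagram.mem_iff_lt_rowLen, YoungDiagram.mem_iff_lt_rowLen, h]

theorem linearIndependent_kFun (m : ℕ) :
    LinearIndependent QT (kFun : MPartition m → SymRing m) := by
  refine linearIndependent_of_triangular (P := Lex (Lex (ℕ → ℕ) × ℕ)) kFun
    (fun Ω => coeffForm m (expo Ω))
    (fun Λ => toLex (toLex Λ.part.rowLen, sqNorm (expo ⟨Λ.comp, ⊥⟩))) ?_ ?_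
  · intro Λ
    rw [coeffForm_apply, coeff_kFun_of_part_eq _ _ rfl, (coeff_hallLittlewood Λ.comp).1]
    exact one_ne_zero
  · intro Λ Ω hne hle
    rw [coeffForm_apply]
    rcases Prod.Lex.toLex_le_toLex.1 hle with h | ⟨h, h'⟩
    · exact coeff_kFun_of_lex_lt Λ Ω h
    · have hp : Λ.part = Ω.part := eq_of_rowLen_eq (toLex.injective h)
      rw [coeff_kFun_of_part_eq Λ Ω hp]
      by_contra hc
      rcases ((coeff_hallLittlewood Λ.comp).2 _ hc).2.2 with h3 | h3
      · refine hne (MPartition.ext (funext fun j => ?_) hp)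
        have := congrArg (fun d => d (j : ℕ)) h3
        simp only [expo_mk_of_lt _ _ _ j.isLt] at this
        exact this.symm
      · simp only at h'
        omega

theorem coeff_swap_of_ge {m : ℕ} (f : SymRing m) (j : ℕ) (hj : m ≤ j) (d : ℕ →₀ ℕ) :
    MvPowerSeries.coeff ((d.update j (d (j + 1))).update (j + 1) (d j)) f.1 =
      MvPowerSeries.coeff d f.1 := by
  have h := MvPowerSeries.coeff_embDomain_rename (Equiv.swap j (j + 1)).toEmbedding f.1
    ((d.update j (d (j + 1))).update (j + 1) (d j))
  have he : Finsupp.embDomain (Equiv.swap j (j + 1)).toEmbedding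
      ((d.update j (d (j + 1))).update (j + 1) (d j)) = d := by
    ext n
    obtain ⟨n, rfl⟩ := (Equiv.swap j (j + 1)).surjective n
    refine (Finsupp.embDomain_apply_self _ _ n).trans ?_
    simp only [Finsupp.coe_update, Function.update_apply]
    split_ifs with g1 g2
    · simp [g1]
    · simp [g2]
    · rw [Equiv.swap_apply_of_ne_of_ne g2 g1]
  rw [he] at h
  rw [← h]
  have h' := f.2.2 (Equiv.swap j (j + 1)) fun k hk => by
    rw [Equiv.swap_apply_of_ne_of_ne] <;> omega
  exact congrArg (MvPowerSeries.coeff d) h'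

/-- An element of `R_m` is determined by its coefficients at the exponents which are weakly
decreasing from position `m` on. -/
theorem eq_zero_of_coeff_expo {m : ℕ} (f : SymRing m)
    (h : ∀ Ω : MPartition m, MvPowerSeries.coeff (expo Ω) f.1 = 0) : f = 0 := by
  apply Subtype.ext
  ext d
  induction hN : (d.sum fun j n => j * n) using Nat.strong_induction_on generalizing d with
  | _ N ih =>
  subst hN
  by_cases hD : ∃ j, m ≤ j ∧ d j < d (j + 1)
  · obtain ⟨j, hj, hlt⟩ := hD
    rw [← coeff_swap_of_ge f j hj d]
    refine ih _ ?_ _ rfl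
    have := sum_update_update (fun j n => j * n) (fun n => mul_zero n) j d (d (j + 1)) (d j)
    nlinarith
  · push Not at hD
    have hanti : Antitone fun r => d (m + r) := antitone_nat_of_succ_le fun r => hD (m + r) (by omega)
    obtain ⟨N, hN⟩ : ∃ N, ∀ j, N ≤ j → d j = 0 := by
      refine ⟨d.support.sup id + 1, fun j hj => ?_⟩
      by_contra h0
      have := Finset.le_sup (f := id) (Finsupp.mem_support_iff.2 h0)
      simp only [id] at this
      omega
    let lam : YoungDiagram := ⟨(Finset.range N ×ˢ Finset.range (d m)).filter
      fun c => c.2 < d (m + c.1), by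
        intro c c' hcc hc
        simp only [Finset.coe_filter, Finset.mem_product, Finset.mem_range, Set.mem_ofPred_eq]
          at hc ⊢
        have h1 : c'.1 ≤ c.1 := hcc.1
        have h2 : c'.2 ≤ c.2 := hcc.2
        have h3 := hanti h1
        simp only at h3
        omega⟩
    have hrow : ∀ r, lam.rowLen r = d (m + r) := by
      intro r
      have hmem : ∀ c, c < lam.rowLen r ↔ c < d (m + r) := by
        intro c
        rw [← YoungDiagram.mem_iff_lt_rowLen, ← YoungDiagram.mem_cells]
        simp only [lam, Finset.mem_filter, Finset.mem_product, Finset.mem_range]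
        refine ⟨fun h => h.2, fun h => ⟨⟨?_, ?_⟩, h⟩⟩
        · by_contra h0
          rw [hN (m + r) (by omega)] at h
          omega
        · have := hanti (Nat.zero_le r)
          simp only [add_zero] at this
          omega
      have h1 := hmem (d (m + r))
      have h2 := hmem (lam.rowLen r)
      omega
    have hd : d = expo ⟨fun j : Fin m => d j, lam⟩ := by
      ext j
      rcases Nat.lt_or_ge j m with hj | hj
      · rw [expo_mk_of_lt _ _ _ hj]
      · obtain ⟨r, rfl⟩ := Nat.exists_eq_add_of_le hj
        rw [expo_add, hrow]
    rw [hd, h]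
    rfl

/-- The elements of `R_m` of degree at most `D`. -/
noncomputable def degLE (m D : ℕ) : Submodule QT (SymRing m) where
  carrier := {f | ∀ d, MvPowerSeries.coeff d f.1 ≠ 0 → d.degree ≤ D}
  zero_mem' := fun d hd => absurd (map_zero _) hd
  add_mem' := by
    intro f g hf hg d hd
    by_cases h : MvPowerSeries.coeff d f.1 = 0
    · exact hg d fun h' => hd (by
        rw [Subalgebra.coe_add, map_add, h, h', add_zero])
    · exact hf d h
  smul_mem' := by
    intro c f hf d hd
    refine hf d fun h => hd ?_
    rw [Subalgebra.coe_smul, map_smul, h, smul_zero]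

theorem span_eq_top_of_injective {K ι V : Type*} [Field K] [AddCommGroup V] [Module K V] [Fintype ι]
    (v : ι → V) (hv : LinearIndependent K v) (F : V →ₗ[K] (ι → K)) (hF : Function.Injective F) :
    Submodule.span K (Set.range v) = ⊤ := by
  have : FiniteDimensional K V := Module.Finite.of_injective F hF
  refine hv.span_eq_top_of_card_eq_finrank' (le_antisymm hv.fintype_card_le_finrank ?_)
  have := LinearMap.finrank_le_finrank_of_injective hF
  rwa [Module.finrank_fintype_fun_eq_card] at this

/-- In degrees at most `D` there are as many functions `k_Λ` as there are coefficients that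
determine an element of `R_m`, so that the `k_Λ`, being independent, generate. -/
theorem degLE_le_span (m D : ℕ) :
    degLE m D ≤ Submodule.span QT (Set.range (kFun : MPartition m → SymRing m)) := by
  have : Fintype {Λ : MPartition m // Λ.size ≤ D} := (finite_size_le m D).fintype
  let F : degLE m D →ₗ[QT] ({Λ : MPartition m // Λ.size ≤ D} → QT) :=
    LinearMap.pi fun Λ => (coeffForm m (expo Λ.1)).comp (degLE m D).subtype
  have hF : Function.Injective F := by
    rw [injective_iff_map_eq_zero]
    intro f hf
    apply Subtype.ext
    refine eq_zero_of_coeff_expo f.1 fun Ω => ?_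
    by_cases hΩ : Ω.size ≤ D
    · exact congrFun hf ⟨Ω, hΩ⟩
    · by_contra h
      exact hΩ (degree_expo Ω ▸ f.2 _ h)
  let v : {Λ : MPartition m // Λ.size ≤ D} → degLE m D := fun Λ => ⟨kFun Λ.1, fun d hd =>
    (degree_of_coeff_kFun Λ.1 d hd).le.trans Λ.2⟩
  have hv : LinearIndependent QT v :=
    LinearIndependent.of_comp (degLE m D).subtype
      ((linearIndependent_kFun m).comp Subtype.val Subtype.val_injective)
  have htop := span_eq_top_of_injective v hv F hF
  intro f hf
  have hmem : (⟨f, hf⟩ : degLE m D) ∈ Submodule.span QT (Set.range v) := by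
    rw [htop]; trivial
  have h2 := Submodule.mem_map_of_mem (f := (degLE m D).subtype) hmem
  rw [Submodule.map_span] at h2
  refine Submodule.span_mono ?_ h2
  rintro _ ⟨_, ⟨Λ, rfl⟩, rfl⟩
  exact ⟨Λ.1, rfl⟩

/-- The basis `k_Λ` of `R_m`. -/
noncomputable def kBasis (m : ℕ) : Module.Basis (MPartition m) QT (SymRing m) :=
  Module.Basis.mk (linearIndependent_kFun m) (by
    intro f _
    obtain ⟨D, hD⟩ := f.2.1
    exact degLE_le_span m D hD)

theorem kBasis_apply {m : ℕ} (Λ : MPartition m) : kBasis m Λ = kFun Λ :=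
  Module.Basis.mk_apply _ _ _

/-! ### The scalar product and the adjoints of the Hecke generators -/

theorem kBasis_coord {m : ℕ} (Λ Ω : MPartition m) [Decidable (Λ = Ω)] :
    (kBasis m).coord Λ (kFun Ω) = if Λ = Ω then 1 else 0 := by
  classical
  rw [← kBasis_apply, Module.Basis.coord_apply, Module.Basis.repr_self, Finsupp.single_apply]
  exact if_congr eq_comm rfl rfl

theorem isScalarProduct_constr (m : ℕ) :
    IsScalarProduct m ((kBasis m).constr QT fun Λ => (kBasis m).coord Λ) := by
  intro Λ Ω
  classical
  rw [← kBasis_apply Λ, Module.Basis.constr_basis, kBasis_coord]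

theorem existsUnique_isScalarProduct (m : ℕ) : ∃! B, IsScalarProduct m B := by
  refine ⟨_, isScalarProduct_constr m, fun B hB => ?_⟩
  refine (kBasis m).ext fun Λ => (kBasis m).ext fun Ω => ?_
  rw [kBasis_apply, kBasis_apply, hB Λ Ω, isScalarProduct_constr m Λ Ω]

theorem isScalarProduct_scalarProduct (m : ℕ) : IsScalarProduct m (scalarProduct m) :=
  Classical.epsilon_spec (existsUnique_isScalarProduct m).exists

theorem scalarProduct_kFun_left {m : ℕ} (Λ : MPartition m) :
    scalarProduct m (kFun Λ) = (kBasis m).coord Λ := by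
  classical
  refine (kBasis m).ext fun Ω => ?_
  rw [kBasis_apply, kBasis_coord, isScalarProduct_scalarProduct m Λ Ω]

theorem scalarProduct_comm {m : ℕ} (f g : SymRing m) :
    scalarProduct m f g = scalarProduct m g f := by
  classical
  have h : scalarProduct m = LinearMap.flip (scalarProduct m) := by
    refine (kBasis m).ext fun Λ => (kBasis m).ext fun Ω => ?_
    rw [LinearMap.flip_apply, kBasis_apply, kBasis_apply, isScalarProduct_scalarProduct m Λ Ω,
      isScalarProduct_scalarProduct m Ω Λ]
    exact if_congr eq_comm rfl rfl
  exact LinearMap.congr_fun (LinearMap.congr_fun h f) g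

theorem eq_of_scalarProduct_right {m : ℕ} {f g : SymRing m}
    (h : ∀ v, scalarProduct m v f = scalarProduct m v g) : f = g := by
  refine (kBasis m).ext_elem fun Λ => ?_
  have := h (kFun Λ)
  rwa [scalarProduct_kFun_left] at this

theorem MPartition.comp_swap_left {m : ℕ} (i : ℕ) (hi : i + 1 < m) (Λ : MPartition m) :
    (Λ.swap i hi).comp ⟨i, by omega⟩ = Λ.comp ⟨i + 1, hi⟩ := swapComp_left i hi _

theorem MPartition.comp_swap_right {m : ℕ} (i : ℕ) (hi : i + 1 < m) (Λ : MPartition m) :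
    (Λ.swap i hi).comp ⟨i + 1, hi⟩ = Λ.comp ⟨i, by omega⟩ := swapComp_right i hi _

/-- The value of the adjoint of `T_i` on `k_Λ`: the transpose of the matrix of `T_i`. -/
noncomputable def starValue {m : ℕ} (i : ℕ) (hi : i + 1 < m) (Λ : MPartition m) : SymRing m :=
  if Λ.comp ⟨i + 1, hi⟩ < Λ.comp ⟨i, by omega⟩ then t • kFun (Λ.swap i hi)
  else if Λ.comp ⟨i, by omega⟩ < Λ.comp ⟨i + 1, hi⟩ then (t - 1) • kFun Λ + kFun (Λ.swap i hi)
  else t • kFun Λ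

set_option linter.unusedSimpArgs false in
theorem scalarProduct_heckeT_kFun {m : ℕ} (i : ℕ) (hi : i + 1 < m) (Λ Ω : MPartition m) :
    scalarProduct m (heckeT i hi (kFun Λ)) (kFun Ω) =
      scalarProduct m (kFun Λ) (starValue i hi Ω) := by
  classical
  have hB := isScalarProduct_scalarProduct m
  have l1 := Λ.comp_swap_left i hi
  have l2 := Λ.comp_swap_right i hi
  have hsw : Λ.swap i hi = Ω ↔ Λ = Ω.swap i hi := by
    constructor
    · rintro rfl; rw [MPartition.swap_swap]
    · rintro rfl; rw [MPartition.swap_swap]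
  have hB1 := hB Λ Ω
  have hB2 := hB Λ (Ω.swap i hi)
  have hB3 := hB (Λ.swap i hi) Ω
  rw [starValue]
  rcases lt_trichotomy (Λ.comp ⟨i, by omega⟩) (Λ.comp ⟨i + 1, hi⟩) with h | h | h
  · rw [heckeT_kFun_of_lt i hi Λ h]
    split_ifs with h1 h2
    · have hne : Λ ≠ Ω := by rintro rfl; omega
      rw [if_neg hne] at hB1
      rw [if_congr hsw rfl rfl] at hB3
      simp only [map_add, map_smul, LinearMap.add_apply, LinearMap.smul_apply, hB1, hB2, hB3,
        smul_zero, zero_add, add_zero]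
    · have hne' : Λ ≠ Ω.swap i hi := by
        intro h'
        rw [hsw.2 h'] at l1 l2
        omega
      rw [if_neg hne'] at hB2
      rw [if_neg (fun h => hne' (hsw.1 h))] at hB3
      simp only [map_add, map_smul, LinearMap.add_apply, LinearMap.smul_apply, hB1, hB2, hB3,
        smul_zero, zero_add, add_zero]
    · have hne : Λ ≠ Ω := by rintro rfl; omega
      have hne' : Λ ≠ Ω.swap i hi := by
        intro h'
        rw [hsw.2 h'] at l1 l2
        omega
      rw [if_neg hne] at hB1
      rw [if_neg hne'] at hB2
      rw [if_neg (fun h => hne' (hsw.1 h))] at hB3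
      simp only [map_add, map_smul, LinearMap.add_apply, LinearMap.smul_apply, hB1, hB2, hB3,
        smul_zero, zero_add, add_zero]
  · rw [heckeT_kFun_of_eq i hi Λ h]
    split_ifs with h1 h2
    · have hne : Λ ≠ Ω := by rintro rfl; omega
      have hne' : Λ ≠ Ω.swap i hi := by
        intro h'
        rw [hsw.2 h'] at l1 l2
        omega
      rw [if_neg hne] at hB1
      rw [if_neg hne'] at hB2
      rw [if_neg (fun h => hne' (hsw.1 h))] at hB3
      simp only [map_add, map_smul, LinearMap.add_apply, LinearMap.smul_apply, hB1, hB2, hB3,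
        smul_zero, zero_add, add_zero]
    · have hne : Λ ≠ Ω := by rintro rfl; omega
      have hne' : Λ ≠ Ω.swap i hi := by
        intro h'
        rw [hsw.2 h'] at l1 l2
        omega
      rw [if_neg hne] at hB1
      rw [if_neg hne'] at hB2
      rw [if_neg (fun h => hne' (hsw.1 h))] at hB3
      simp only [map_add, map_smul, LinearMap.add_apply, LinearMap.smul_apply, hB1, hB2, hB3,
        smul_zero, zero_add, add_zero]
    · simp only [map_smul, LinearMap.smul_apply]
  · rw [heckeT_kFun_of_gt i hi Λ h]
    split_ifs with h1 h2
    · have hne' : Λ ≠ Ω.swap i hi := by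
        intro h'
        rw [hsw.2 h'] at l1 l2
        omega
      rw [if_neg hne'] at hB2
      rw [if_neg (fun h => hne' (hsw.1 h))] at hB3
      simp only [map_add, map_smul, LinearMap.add_apply, LinearMap.smul_apply, hB1, hB2, hB3,
        smul_zero, zero_add, add_zero]
    · have hne : Λ ≠ Ω := by rintro rfl; omega
      rw [if_neg hne] at hB1
      rw [if_congr hsw rfl rfl] at hB3
      simp only [map_add, map_smul, LinearMap.add_apply, LinearMap.smul_apply, hB1, hB2, hB3,
        smul_zero, zero_add, add_zero]
    · have hne : Λ ≠ Ω := by rintro rfl; omega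
      have hne' : Λ ≠ Ω.swap i hi := by
        intro h'
        rw [hsw.2 h'] at l1 l2
        omega
      rw [if_neg hne] at hB1
      rw [if_neg hne'] at hB2
      rw [if_neg (fun h => hne' (hsw.1 h))] at hB3
      simp only [map_add, map_smul, LinearMap.add_apply, LinearMap.smul_apply, hB1, hB2, hB3,
        smul_zero, zero_add, add_zero]

theorem isHeckeAdjoint_constr {m : ℕ} (i : ℕ) (hi : i + 1 < m) :
    IsHeckeAdjoint i hi ((kBasis m).constr QT (starValue i hi)) := by
  have h : LinearMap.comp (scalarProduct m) (heckeT i hi) =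
      LinearMap.compl₂ (scalarProduct m) ((kBasis m).constr QT (starValue i hi)) := by
    refine (kBasis m).ext fun Λ => (kBasis m).ext fun Ω => ?_
    rw [LinearMap.comp_apply, LinearMap.compl₂_apply, Module.Basis.constr_basis, kBasis_apply,
      kBasis_apply, scalarProduct_heckeT_kFun]
  intro f g
  exact LinearMap.congr_fun (LinearMap.congr_fun h f) g

theorem existsUnique_isHeckeAdjoint {m : ℕ} (i : ℕ) (hi : i + 1 < m) :
    ∃! S, IsHeckeAdjoint i hi S := by
  refine ⟨_, isHeckeAdjoint_constr i hi, fun S hS => ?_⟩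
  refine LinearMap.ext fun g => eq_of_scalarProduct_right fun v => ?_
  rw [← hS v g, isHeckeAdjoint_constr i hi v g]

theorem isHeckeAdjoint_heckeTStar {m : ℕ} (i : ℕ) (hi : i + 1 < m) :
    IsHeckeAdjoint i hi (heckeTStar i hi) :=
  Classical.epsilon_spec (existsUnique_isHeckeAdjoint i hi).exists

theorem heckeTStar_quadratic {m : ℕ} (i : ℕ) (hi : i + 1 < m) (g : SymRing m) :
    heckeTStar i hi (heckeTStar i hi g) = (t - 1) • heckeTStar i hi g + t • g := by
  refine eq_of_scalarProduct_right fun v => ?_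
  have h := isHeckeAdjoint_heckeTStar i hi
  rw [← h, ← h, heckeT_quadratic, map_add, map_smul, map_smul, map_add, map_smul, map_smul, ← h]
  simp only [LinearMap.add_apply, LinearMap.smul_apply]

theorem heckeTStar_comm {m : ℕ} (i j : ℕ) (hi : i + 1 < m) (hj : j + 1 < m) (hij : i + 1 < j)
    (g : SymRing m) :
    heckeTStar i hi (heckeTStar j hj g) = heckeTStar j hj (heckeTStar i hi g) := by
  refine eq_of_scalarProduct_right fun v => ?_
  have h1 := isHeckeAdjoint_heckeTStar i hi
  have h2 := isHeckeAdjoint_heckeTStar j hj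
  rw [← h1, ← h2, ← h2, ← h1, heckeT_comm i j hi hj hij]

theorem heckeTStar_braid {m : ℕ} (i : ℕ) (hi : i + 1 + 1 < m) (g : SymRing m) :
    heckeTStar i (by omega) (heckeTStar (i + 1) hi (heckeTStar i (by omega) g)) =
      heckeTStar (i + 1) hi (heckeTStar i (by omega) (heckeTStar (i + 1) hi g)) := by
  refine eq_of_scalarProduct_right fun v => ?_
  have h1 := isHeckeAdjoint_heckeTStar i (show i + 1 < m by omega)
  have h2 := isHeckeAdjoint_heckeTStar (i + 1) hi
  rw [← h1, ← h2, ← h1, ← h2, ← h1, ← h2, heckeT_braid]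

/-! ### Bracketing of words -/

section Bracketing

variable {α β : Type*}

/-- The pairing of the letters `i + 1` and `i` of a word whose positions carry labels in `α`; `e` is
the letter at a label, `o` and `f` are the labels of the letters `i + 1`, `i` that are unpaired so
far, most recent first. The result is the final value of `(f, o)`. -/
def labelScan (i : ℕ) (e : α → ℕ) : List α → List α → List α → List α × List α
  | [], o, f => (f, o)
  | x :: L, o, f =>
    if e x = i + 1 then labelScan i e L (x :: o) f
    else if e x = i then
      match o with
      | [] => labelScan i e L [] (x :: f)
      | _ :: o' => labelScan i e L o' f
    else labelScan i e L o f

theorem labelScan_cons (i : ℕ) (e : α → ℕ) (x : α) (L o f : List α) :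
    labelScan i e (x :: L) o f =
      labelScan i e L (labelScan i e [x] o f).2 (labelScan i e [x] o f).1 := by
  simp only [labelScan]
  split_ifs
  · rfl
  · cases o <;> rfl
  · rfl

theorem labelScan_append (i : ℕ) (e : α → ℕ) (L L' o f : List α) :
    labelScan i e (L ++ L') o f =
      labelScan i e L' (labelScan i e L o f).2 (labelScan i e L o f).1 := by
  induction L generalizing o f with
  | nil => rfl
  | cons x L ih => rw [List.cons_append, labelScan_cons, ih, ← labelScan_cons]

theorem labelScan_singleton_of_succ {i : ℕ} {e : α → ℕ} {x : α} (h : e x = i + 1)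
    (o f : List α) : labelScan i e [x] o f = (f, x :: o) := by
  simp [labelScan, h]

theorem labelScan_singleton_nil {i : ℕ} {e : α → ℕ} {x : α} (h : e x = i) (f : List α) :
    labelScan i e [x] [] f = (x :: f, []) := by
  simp [labelScan, h]

theorem labelScan_singleton_cons {i : ℕ} {e : α → ℕ} {x : α} (h : e x = i) (y : α)
    (o f : List α) : labelScan i e [x] (y :: o) f = (f, o) := by
  simp [labelScan, h]

theorem labelScan_singleton_of_ne {i : ℕ} {e : α → ℕ} {x : α} (h0 : e x ≠ i) (h1 : e x ≠ i + 1)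
    (o f : List α) : labelScan i e [x] o f = (f, o) := by
  simp [labelScan, h0, h1]

/-- Only the positions of the letters `i` and `i + 1` matter. -/
theorem labelScan_congr {i i' : ℕ} {e e' : α → ℕ} (L : List α)
    (h : ∀ x ∈ L, (e x = i ↔ e' x = i') ∧ (e x = i + 1 ↔ e' x = i' + 1)) (o f : List α) :
    labelScan i e L o f = labelScan i' e' L o f := by
  induction L generalizing o f with
  | nil => rfl
  | cons x L ih =>
    have ih' := ih fun y hy => h y (List.mem_cons_of_mem _ hy)
    obtain ⟨h1, h2⟩ := h x List.mem_cons_self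
    simp only [labelScan, h1, h2]
    split_ifs
    · exact ih' _ _
    · cases o <;> exact ih' _ _
    · exact ih' _ _

theorem labelScan_filter (i : ℕ) (e : α → ℕ) (L o f : List α) :
    labelScan i e (L.filter fun x => e x = i ∨ e x = i + 1) o f = labelScan i e L o f := by
  induction L generalizing o f with
  | nil => rfl
  | cons x L ih =>
    rw [List.filter_cons]
    split_ifs with h
    · rw [labelScan_cons, ih, ← labelScan_cons]
    · simp only [decide_eq_true_eq, not_or] at h
      rw [labelScan_cons i e x L, labelScan_singleton_of_ne h.1 h.2, ih]

theorem labelScan_map (i : ℕ) (e : α → ℕ) (g : β → α) (L o f : List β) :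
    labelScan i e (L.map g) (o.map g) (f.map g) =
      ((labelScan i (e ∘ g) L o f).1.map g, (labelScan i (e ∘ g) L o f).2.map g) := by
  induction L generalizing o f with
  | nil => rfl
  | cons x L ih =>
    simp only [List.map_cons, labelScan, Function.comp_apply]
    split_ifs
    · exact ih (x :: o) f
    · cases o with
      | nil => exact ih [] (x :: f)
      | cons y o => exact ih o f
    · exact ih o f

theorem mem_of_mem_labelScan (i : ℕ) (e : α → ℕ) (L o f : List α) (x : α)
    (h : x ∈ (labelScan i e L o f).1 ∨ x ∈ (labelScan i e L o f).2) : x ∈ L ∨ x ∈ o ∨ x ∈ f := by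
  induction L generalizing o f with
  | nil => exact Or.inr h.symm
  | cons y L ih =>
    simp only [labelScan] at h
    split_ifs at h
    · rcases ih _ _ h with h' | h' | h'
      · simp [h']
      · rcases List.mem_cons.1 h' with rfl | h' <;> simp [*]
      · simp [h']
    · cases o with
      | nil =>
        rcases ih _ _ h with h' | h' | h'
        · simp [h']
        · simp at h'
        · rcases List.mem_cons.1 h' with rfl | h' <;> simp [*]
      | cons z o =>
        rcases ih _ _ h with h' | h' | h' <;> simp [h']
    · rcases ih _ _ h with h' | h' | h' <;> simp [h']

theorem labelScan_letters (i : ℕ) (e : α → ℕ) (L o f : List α) (ho : ∀ x ∈ o, e x = i + 1)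
    (hf : ∀ x ∈ f, e x = i) : (∀ x ∈ (labelScan i e L o f).1, e x = i) ∧
      ∀ x ∈ (labelScan i e L o f).2, e x = i + 1 := by
  induction L generalizing o f with
  | nil => exact ⟨hf, ho⟩
  | cons y L ih =>
    simp only [labelScan]
    split_ifs with h1 h2
    · exact ih _ _ (by simpa [h1] using ho) hf
    · cases o with
      | nil => exact ih _ _ ho (by simpa [h2] using hf)
      | cons z o => exact ih _ _ (fun x hx => ho x (List.mem_cons_of_mem _ hx)) hf
    · exact ih _ _ ho hf

theorem labelScan_count (i : ℕ) (e : α → ℕ) (L o f : List α) :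
    L.countP (fun x => e x = i + 1) + o.length + (labelScan i e L o f).1.length =
      L.countP (fun x => e x = i) + (labelScan i e L o f).2.length + f.length := by
  induction L generalizing o f with
  | nil => simp only [labelScan, List.countP_nil]
  | cons x L ih =>
    simp only [labelScan, List.countP_cons, decide_eq_true_eq]
    split_ifs with h1 h2 h2
    · omega
    · have := ih (x :: o) f
      simp only [List.length_cons] at this
      omega
    · cases o with
      | nil =>
        have := ih [] (x :: f)
        simp only [List.length_cons, List.length_nil] at this ⊢
        omega
      | cons z o =>
        have := ih o f
        simp only [List.length_cons] at this ⊢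
        omega
    · have := ih o f
      omega

theorem labelScan_all_succ {i : ℕ} {e : α → ℕ} (L : List α) (h : ∀ x ∈ L, e x = i + 1)
    (o f : List α) : labelScan i e L o f = (f, L.reverse ++ o) := by
  induction L generalizing o f with
  | nil => rfl
  | cons x L ih =>
    rw [labelScan_cons, labelScan_singleton_of_succ (h x List.mem_cons_self),
      ih fun y hy => h y (List.mem_cons_of_mem _ hy)]
    simp

theorem labelScan_all_eq {i : ℕ} {e : α → ℕ} (L : List α) (h : ∀ x ∈ L, e x = i)
    (o' o f : List α) (hlen : o'.length = L.length) :
    labelScan i e L (o' ++ o) f = (f, o) := by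
  induction L generalizing o' with
  | nil =>
    rw [List.eq_nil_of_length_eq_zero hlen]
    rfl
  | cons x L ih =>
    cases o' with
    | nil => simp at hlen
    | cons y o' =>
      rw [labelScan_cons, List.cons_append, labelScan_singleton_cons (h x List.mem_cons_self),
        ih (fun y hy => h y (List.mem_cons_of_mem _ hy)) o' (by simpa using hlen)]

/-- The labels of the letters that stay unpaired: those of the letters `i`, then those of the
letters `i + 1`. -/
def unpaired (i : ℕ) (e : α → ℕ) (L : List α) : List α :=
  (labelScan i e L [] []).1.reverse ++ (labelScan i e L [] []).2.reverse

/-- The number of unpaired letters `i + 1`. -/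
def numOpen (i : ℕ) (e : α → ℕ) (L : List α) : ℕ := (labelScan i e L [] []).2.length

open Classical in
/-- The letter at a label after `σ_i` has been applied. -/
noncomputable def flipLetter (i : ℕ) (e : α → ℕ) (L : List α) (x : α) : ℕ :=
  if x ∈ (unpaired i e L).take (numOpen i e L) then i
  else if x ∈ (unpaired i e L).drop (numOpen i e L) then i + 1
  else e x

theorem mem_of_mem_unpaired {i : ℕ} {e : α → ℕ} {L : List α} {x : α} (h : x ∈ unpaired i e L) :
    x ∈ L := by
  rw [unpaired, List.mem_append, List.mem_reverse, List.mem_reverse] at h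
  simpa using mem_of_mem_labelScan i e L [] [] x h

theorem flipLetter_of_notMem {i : ℕ} {e : α → ℕ} {L : List α} {x : α} (h : x ∉ unpaired i e L) :
    flipLetter i e L x = e x := by
  rw [flipLetter, if_neg fun h' => h (List.mem_of_mem_take h'),
    if_neg fun h' => h (List.mem_of_mem_drop h')]

theorem pairScan_map (i : ℕ) (e : α → ℕ) (pos : α → ℕ) (L : List α) (p : ℕ) (o f : List α)
    (h : L.map pos = List.range' p L.length) :
    pairScan i (L.map e) p (o.map pos) (f.map pos) =
      ((labelScan i e L o f).1.map pos, (labelScan i e L o f).2.map pos) := by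
  induction L generalizing p o f with
  | nil => rfl
  | cons x L ih =>
    rw [List.map_cons, List.length_cons, List.range'_succ, List.cons.injEq] at h
    have ih' := fun o f => ih (p + 1) o f h.2
    rw [List.map_cons]
    simp only [pairScan, labelScan]
    split_ifs
    · rw [← ih', List.map_cons, h.1]
    · cases o with
      | nil => rw [← ih', List.map_cons, h.1]; rfl
      | cons y o => exact ih' o f
    · exact ih' o f

/-- The operator `σ_i` in terms of labels. -/
theorem wordSwap_map (i : ℕ) (e : α → ℕ) (L : List α) (hL : L.Nodup) :
    wordSwap i (L.map e) = L.map (flipLetter i e L) := by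
  classical
  have hpos : L.map (fun x => L.idxOf x) = List.range' 0 L.length := by
    refine List.ext_getElem (by simp) fun n h1 h2 => ?_
    simp only [List.getElem_map, List.getElem_range']
    rw [hL.idxOf_getElem]
    omega
  have hscan := pairScan_map i e (fun x => L.idxOf x) L 0 [] [] hpos
  rw [List.map_nil] at hscan
  have hmem : ∀ (M : List α), (∀ x ∈ M, x ∈ L) → ∀ (n : ℕ) (hn : n < L.length),
      n ∈ M.map (fun x => L.idxOf x) ↔ L[n] ∈ M := by
    intro M hM n hn
    rw [List.mem_map]
    constructor
    · rintro ⟨x, hx, rfl⟩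
      rwa [List.getElem_idxOf]
    · exact fun h => ⟨_, h, hL.idxOf_getElem n hn⟩
  have hunp : (pairScan i (L.map e) 0 [] []).1.reverse ++
      (pairScan i (L.map e) 0 [] []).2.reverse = (unpaired i e L).map fun x => L.idxOf x := by
    rw [hscan, unpaired, List.map_append, List.map_reverse, List.map_reverse]
  have hlen : (pairScan i (L.map e) 0 [] []).2.reverse.length = numOpen i e L := by
    rw [hscan, List.length_reverse, List.length_map, numOpen]
  have hw : wordSwap i (L.map e) = (L.map e).mapIdx fun p c =>
      if p ∈ ((unpaired i e L).take (numOpen i e L)).map (fun x => L.idxOf x) then i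
      else if p ∈ ((unpaired i e L).drop (numOpen i e L)).map (fun x => L.idxOf x) then i + 1
      else c := by
    simp only [wordSwap, hunp, hlen, List.map_take, List.map_drop]
  rw [hw]
  refine List.ext_getElem (by simp) fun n h1 h2 => ?_
  have hn : n < L.length := by simpa using h2
  simp only [List.getElem_mapIdx, List.getElem_map]
  rw [flipLetter]
  exact if_congr (hmem _ (fun x hx => mem_of_mem_unpaired (List.mem_of_mem_take hx)) n hn) rfl
    (if_congr (hmem _ (fun x hx => mem_of_mem_unpaired (List.mem_of_mem_drop hx)) n hn) rfl rfl)

/-- A word all of whose letters `i`, `i + 1` are paired. -/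
def Balanced (i : ℕ) (e : α → ℕ) (B : List α) : Prop :=
  ∀ o f, labelScan i e B o f = (f, o)

/-- The word `L` consists of the unpaired labels `U`, separated by balanced words. -/
inductive Decomposes (i : ℕ) (e : α → ℕ) : List α → List α → Prop
  | base {B : List α} : Balanced i e B → Decomposes i e B []
  | snoc {L U B : List α} {x : α} : Decomposes i e L U → Balanced i e B →
      Decomposes i e (L ++ x :: B) (U ++ [x])

theorem balanced_nil (i : ℕ) (e : α → ℕ) : Balanced i e [] := fun _ _ => rfl

theorem Balanced.append {i : ℕ} {e : α → ℕ} {B B' : List α} (h : Balanced i e B)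
    (h' : Balanced i e B') : Balanced i e (B ++ B') := by
  intro o f
  rw [labelScan_append, h, h']

theorem Decomposes.append {i : ℕ} {e : α → ℕ} {L U B : List α} (h : Decomposes i e L U)
    (hB : Balanced i e B) : Decomposes i e (L ++ B) U := by
  cases h with
  | base h => exact .base (h.append hB)
  | snoc h h' =>
    rw [List.append_assoc, List.cons_append]
    exact .snoc h (h'.append hB)

theorem Decomposes.exists_of_snoc {i : ℕ} {e : α → ℕ} {L V W : List α} {y : α}
    (h : Decomposes i e L V) (hV : V = W ++ [y]) :
    ∃ L' B, L = L' ++ y :: B ∧ Decomposes i e L' W ∧ Balanced i e B := by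
  cases h with
  | base h => simp at hV
  | snoc h h' =>
    obtain ⟨rfl, hx⟩ := List.append_inj' hV rfl
    obtain rfl : _ = y := by simpa using hx
    exact ⟨_, _, rfl, h, h'⟩

theorem decomposes_unpaired (i : ℕ) (e : α → ℕ) (L : List α) :
    Decomposes i e L (unpaired i e L) := by
  induction L using List.reverseRecOn with
  | nil => exact .base (balanced_nil i e)
  | append_singleton L x ih =>
    have hlet := labelScan_letters i e L [] [] (by simp) (by simp)
    rw [unpaired] at ih ⊢
    rw [labelScan_append]
    by_cases h1 : e x = i + 1
    · rw [labelScan_singleton_of_succ h1]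
      simp only [List.reverse_cons]
      rw [← List.append_assoc]
      exact .snoc ih (balanced_nil i e)
    by_cases h2 : e x = i
    · cases ho : (labelScan i e L [] []).2 with
      | nil =>
        rw [labelScan_singleton_nil h2]
        rw [ho] at ih
        simp only [List.reverse_cons, List.reverse_nil, List.append_nil] at ih ⊢
        exact .snoc ih (balanced_nil i e)
      | cons y o =>
        rw [labelScan_singleton_cons h2]
        rw [ho] at ih
        obtain ⟨L', B, rfl, hL', hB⟩ := ih.exists_of_snoc (y := y)
          (W := (labelScan i e L [] []).1.reverse ++ o.reverse) (by simp)
        have hy : e y = i + 1 := hlet.2 y (by rw [ho]; exact List.mem_cons_self)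
        have hbal : Balanced i e (y :: B ++ [x]) := by
          intro o f
          rw [labelScan_append, labelScan_cons i e y B, labelScan_singleton_of_succ hy, hB,
            labelScan_singleton_cons h2]
        rw [List.append_assoc]
        exact hL'.append hbal
    · rw [labelScan_singleton_of_ne h2 h1]
      exact ih.append fun o f => labelScan_singleton_of_ne h2 h1 o f

theorem Decomposes.sublist {i : ℕ} {e : α → ℕ} {L U : List α} (h : Decomposes i e L U) :
    U.Sublist L := by
  induction h with
  | base => exact List.nil_sublist _
  | snoc _ _ ih => exact ih.append (List.singleton_sublist.2 List.mem_cons_self)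

theorem Decomposes.congr {i : ℕ} {e e' : α → ℕ} {L U : List α} (h : Decomposes i e L U)
    (hL : L.Nodup) (he : ∀ x ∈ L, x ∉ U → e' x = e x) : Decomposes i e' L U := by
  have key : ∀ {B : List α}, Balanced i e B → (∀ x ∈ B, e' x = e x) → Balanced i e' B := by
    intro B hB hx o f
    rw [← hB o f]
    exact labelScan_congr _ (fun x hx' => by rw [hx x hx']; exact ⟨Iff.rfl, Iff.rfl⟩) o f
  induction h with
  | base hB => exact .base (key hB fun x hx => he x hx (by simp))
  | @snoc L U B x h hB ih =>
    rw [List.nodup_append] at hL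
    have hU := h.sublist.subset
    obtain ⟨h1, h2, h3⟩ := hL
    refine .snoc (ih h1 fun y hy hyU => he y (List.mem_append_left _ hy) ?_) (key hB fun y hy => ?_)
    · rw [List.mem_append, List.mem_singleton]
      rintro (h4 | rfl)
      · exact hyU h4
      · exact h3 y hy y List.mem_cons_self rfl
    · refine he y (List.mem_append_right _ (List.mem_cons_of_mem _ hy)) ?_
      rw [List.mem_append, List.mem_singleton]
      rintro (h4 | rfl)
      · exact h3 y (hU h4) y (List.mem_cons_of_mem _ hy) rfl
      · exact (List.nodup_cons.1 h2).1 hy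

theorem Decomposes.labelScan_eq {i : ℕ} {e : α → ℕ} {L U : List α} (h : Decomposes i e L U)
    (F O : List α) (hU : U = F ++ O) (hF : ∀ x ∈ F, e x = i) (hO : ∀ x ∈ O, e x = i + 1) :
    labelScan i e L [] [] = (F.reverse, O.reverse) := by
  induction h generalizing F O with
  | base hB =>
    obtain ⟨rfl, rfl⟩ := List.append_eq_nil_iff.1 hU.symm
    exact hB [] []
  | @snoc L U B x h hB ih =>
    rw [labelScan_append]
    rcases List.eq_nil_or_concat O with rfl | ⟨O', y, rfl⟩
    · rw [List.append_nil] at hU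
      subst hU
      rw [ih U [] (by simp) (fun z hz => hF z (List.mem_append_left _ hz)) (by simp),
        labelScan_cons, List.reverse_nil, labelScan_singleton_nil (hF x (by simp)), hB]
      simp
    · rw [List.concat_eq_append] at hU hO ⊢
      rw [← List.append_assoc] at hU
      obtain ⟨hU', hx⟩ := List.append_inj' hU rfl
      obtain rfl : x = y := by simpa using hx
      rw [ih F O' hU' hF (fun z hz => hO z (by simp [hz])), labelScan_cons,
        labelScan_singleton_of_succ (hO x (by simp)), hB]
      simp

theorem numOpen_le (i : ℕ) (e : α → ℕ) (L : List α) :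
    numOpen i e L ≤ (unpaired i e L).length := by
  simp [numOpen, unpaired]

/-- After `σ_i` has been applied the same positions are unpaired. -/
theorem labelScan_flipLetter (i : ℕ) (e : α → ℕ) (L : List α) (hL : L.Nodup) :
    labelScan i (flipLetter i e L) L [] [] =
      (((unpaired i e L).take (numOpen i e L)).reverse,
        ((unpaired i e L).drop (numOpen i e L)).reverse) := by
  have hdec := decomposes_unpaired i e L
  have hnd : (unpaired i e L).Nodup := hL.sublist hdec.sublist
  refine (hdec.congr hL fun x _ hx => flipLetter_of_notMem hx).labelScan_eq _ _
    (List.take_append_drop _ _).symm (fun x hx => if_pos hx) fun x hx => ?_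
  rw [← List.take_append_drop (numOpen i e L) (unpaired i e L), List.nodup_append] at hnd
  rw [flipLetter, if_neg fun h => hnd.2.2 x h x hx rfl, if_pos hx]

theorem unpaired_flipLetter (i : ℕ) (e : α → ℕ) (L : List α) (hL : L.Nodup) :
    unpaired i (flipLetter i e L) L = unpaired i e L := by
  rw [unpaired, labelScan_flipLetter i e L hL, List.reverse_reverse, List.reverse_reverse,
    List.take_append_drop]

theorem flipLetter_flipLetter (i : ℕ) (e : α → ℕ) (L : List α) (hL : L.Nodup) (x : α) :
    flipLetter i (flipLetter i e L) L x = e x := by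
  have hlet := labelScan_letters i e L [] [] (by simp) (by simp)
  have hnum : numOpen i (flipLetter i e L) L = (labelScan i e L [] []).1.reverse.length := by
    rw [numOpen, labelScan_flipLetter i e L hL, List.length_reverse, List.length_drop, unpaired,
      List.length_append, List.length_reverse, List.length_reverse, numOpen]
    omega
  have htake : (unpaired i e L).take (labelScan i e L [] []).1.reverse.length =
      (labelScan i e L [] []).1.reverse := by rw [unpaired, List.take_left]
  have hdrop : (unpaired i e L).drop (labelScan i e L [] []).1.reverse.length =
      (labelScan i e L [] []).2.reverse := by rw [unpaired, List.drop_left]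
  by_cases h : x ∈ unpaired i e L
  · rw [flipLetter, unpaired_flipLetter i e L hL, hnum, htake, hdrop]
    split_ifs with h1 h2
    · exact (hlet.1 x (List.mem_reverse.1 h1)).symm
    · exact (hlet.2 x (List.mem_reverse.1 h2)).symm
    · rw [unpaired, List.mem_append] at h
      tauto
  · rw [flipLetter_of_notMem (by rwa [unpaired_flipLetter i e L hL]), flipLetter_of_notMem h]

theorem flipLetter_mem {i : ℕ} {e : α → ℕ} {L : List α} (x : α) (hx : e x = i ∨ e x = i + 1) :
    flipLetter i e L x = i ∨ flipLetter i e L x = i + 1 := by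
  rw [flipLetter]
  split_ifs
  · exact Or.inl rfl
  · exact Or.inr rfl
  · exact hx

/-- A factor `(i + 1) i` of the new word was already there: it is paired in both words. -/
theorem eq_of_flipLetter_adjacent {i : ℕ} {e : α → ℕ} {L L₁ L₂ : List α} {x y : α}
    (hL : L.Nodup) (hLe : L = L₁ ++ x :: y :: L₂) (hx : flipLetter i e L x = i + 1)
    (hy : flipLetter i e L y = i) : e x = i + 1 ∧ e y = i := by
  have key : ∀ z, z ∈ unpaired i e L → z ∈ L₁ ∨ z ∈ L₂ := by
    intro z hz
    rw [← unpaired_flipLetter i e L hL, unpaired, List.mem_append, List.mem_reverse,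
      List.mem_reverse] at hz
    generalize flipLetter i e L = e' at *
    rw [hLe, labelScan_append, labelScan_cons, labelScan_singleton_of_succ hx, labelScan_cons,
      labelScan_singleton_cons hy] at hz
    rcases mem_of_mem_labelScan _ _ _ _ _ _ hz with h | h | h
    · exact Or.inr h
    · simpa using mem_of_mem_labelScan i e' L₁ [] [] z (Or.inr h) |>.imp_right fun h => by simp at h
    · simpa using mem_of_mem_labelScan i e' L₁ [] [] z (Or.inl h) |>.imp_right fun h => by simp at h
  have hnd := hL
  rw [hLe, List.nodup_append] at hnd
  obtain ⟨-, h2, h3⟩ := hnd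
  rw [List.nodup_cons, List.nodup_cons] at h2
  constructor
  · rw [← hx]
    refine (flipLetter_of_notMem fun h => ?_).symm
    rcases key x h with h | h
    · exact h3 x h x List.mem_cons_self rfl
    · exact h2.1 (List.mem_cons_of_mem _ h)
  · rw [← hy]
    refine (flipLetter_of_notMem fun h => ?_).symm
    rcases key y h with h | h
    · exact h3 y h y (List.mem_cons_of_mem _ List.mem_cons_self) rfl
    · exact h2.2.1 h

/-- The operator `σ_i` exchanges the numbers of letters `i` and `i + 1`. -/
theorem countP_flipLetter (i : ℕ) (e : α → ℕ) (L : List α) (hL : L.Nodup)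
    (he : ∀ x ∈ L, e x = i ∨ e x = i + 1) :
    L.countP (fun x => flipLetter i e L x = i) = L.countP (fun x => e x = i + 1) := by
  have htot : ∀ e' : α → ℕ, (∀ x ∈ L, e' x = i ∨ e' x = i + 1) →
      L.countP (fun x => e' x = i) + L.countP (fun x => e' x = i + 1) = L.length := by
    intro e' h
    rw [List.length_eq_countP_add_countP (fun x => decide (e' x = i)) (l := L)]
    congr 1
    refine List.countP_congr fun x hx => ?_
    have := h x hx
    simp only [decide_eq_true_eq]
    omega
  have h1 := labelScan_count i e L [] []
  have h2 := labelScan_count i (flipLetter i e L) L [] []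
  have h3 := htot e he
  have h4 := htot (flipLetter i e L) fun x hx => flipLetter_mem x (he x hx)
  rw [labelScan_flipLetter i e L hL] at h2
  have h5 := numOpen_le i e L
  simp only [List.length_reverse, List.length_take, List.length_drop, List.length_nil,
    Nat.min_eq_left h5] at h1 h2
  have h6 : (unpaired i e L).length =
      (labelScan i e L [] []).1.length + (labelScan i e L [] []).2.length := by
    simp [unpaired]
  have h7 : numOpen i e L = (labelScan i e L [] []).2.length := rfl
  omega

end Bracketing

/-! ### The row reading of a skew tableau -/

/-- The cells of row `r` of `μ/λ`, from left to right. -/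
def rowCells (μ lam : YoungDiagram) (r : ℕ) : List (ℕ × ℕ) :=
  ((List.range (μ.rowLen r)).filter fun c => decide (lam.rowLen r ≤ c)).map fun c => (r, c)

/-- The cells of the first `R` rows of `μ/λ`, row by row from bottom to top, each row being read
from left to right. -/
def readCells (μ lam : YoungDiagram) (R : ℕ) : List (ℕ × ℕ) :=
  (List.range R).reverse.flatMap (rowCells μ lam)

theorem mem_rowCells {μ lam : YoungDiagram} {r : ℕ} {x : ℕ × ℕ} :
    x ∈ rowCells μ lam r ↔ x.1 = r ∧ x ∈ μ ∧ x ∉ lam := by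
  obtain ⟨r', c⟩ := x
  simp only [rowCells, List.mem_map, List.mem_filter, List.mem_range, decide_eq_true_eq,
    Prod.mk.injEq, YoungDiagram.mem_iff_lt_rowLen, not_lt]
  constructor
  · rintro ⟨c', ⟨h1, h2⟩, rfl, rfl⟩
    exact ⟨rfl, h1, h2⟩
  · rintro ⟨rfl, h1, h2⟩
    exact ⟨c, ⟨h1, h2⟩, rfl, rfl⟩

theorem pairwise_rowCells (μ lam : YoungDiagram) (r : ℕ) :
    (rowCells μ lam r).Pairwise fun x y => x.2 < y.2 := by
  rw [rowCells, List.pairwise_map]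
  exact (List.pairwise_lt_range).filter _

theorem readCells_succ (μ lam : YoungDiagram) (R : ℕ) :
    readCells μ lam (R + 1) = rowCells μ lam R ++ readCells μ lam R := by
  simp [readCells, List.range_succ]

theorem mem_readCells {μ lam : YoungDiagram} {R : ℕ} {x : ℕ × ℕ} :
    x ∈ readCells μ lam R ↔ x.1 < R ∧ x ∈ μ ∧ x ∉ lam := by
  simp [readCells, mem_rowCells]

/-- Each row is read from left to right, and a row is read after the rows below it. -/
theorem pairwise_readCells (μ lam : YoungDiagram) (R : ℕ) :
    (readCells μ lam R).Pairwise fun x y => y.1 < x.1 ∨ x.1 = y.1 ∧ x.2 < y.2 := by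
  induction R with
  | zero => simp [readCells]
  | succ R ih =>
    rw [readCells_succ, List.pairwise_append]
    refine ⟨(pairwise_rowCells μ lam R).imp_of_mem fun hx hy h => Or.inr ⟨?_, h⟩, ih,
      fun x hx y hy => Or.inl ?_⟩
    · rw [(mem_rowCells.1 hx).1, (mem_rowCells.1 hy).1]
    · rw [(mem_rowCells.1 hx).1]
      exact (mem_readCells.1 hy).1

theorem nodup_readCells (μ lam : YoungDiagram) (R : ℕ) : (readCells μ lam R).Nodup :=
  (pairwise_readCells μ lam R).imp fun {x y} h he => by
    subst he
    omega

theorem filter_append_filter_not_of_pairwise {α : Type*} {R : α → α → Prop} {l : List α}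
    (q : α → Bool) (hl : l.Pairwise R)
    (hq : ∀ x ∈ l, ∀ y ∈ l, R x y → q y = true → q x = true) :
    l = l.filter q ++ l.filter fun x => !q x := by
  induction l with
  | nil => rfl
  | cons x l ih =>
    rw [List.pairwise_cons] at hl
    have ih' := ih hl.2 fun y hy z hz => hq y (List.mem_cons_of_mem _ hy) z (List.mem_cons_of_mem _ hz)
    by_cases hx : q x = true
    · rw [List.filter_cons_of_pos hx, List.filter_cons_of_neg (by simp [hx]), List.cons_append,
        ← ih']
    · have hn : ∀ y ∈ l, ¬ q y = true := fun y hy h =>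
        hx (hq x List.mem_cons_self y (List.mem_cons_of_mem _ hy) (hl.1 y hy) h)
      rw [List.filter_cons_of_neg hx, List.filter_cons_of_pos (by simpa using hx),
        List.filter_eq_nil_iff.2 hn, List.nil_append, List.filter_eq_self.2 fun y hy => by
          simpa using hn y hy]

/-- The letter `k` occurs in column `c`. -/
def HasLetter (E : ℕ → ℕ → ℕ) (k c : ℕ) : Prop := ∃ r, E r c = k

/-- Exactly one of the letters `j`, `j + 1` occurs in column `c`. -/
def SingleCol (E : ℕ → ℕ → ℕ) (j c : ℕ) : Prop :=
  (HasLetter E j c ∧ ¬HasLetter E (j + 1) c) ∨ (HasLetter E (j + 1) c ∧ ¬HasLetter E j c)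

open Classical in
/-- The columns with exactly one of the letters `j`, `j + 1`, from left to right. -/
noncomputable def singleCols (E : ℕ → ℕ → ℕ) (j N : ℕ) : List ℕ :=
  (List.range N).filter fun c => SingleCol E j c

namespace SkewTableau

variable {μ lam : YoungDiagram} (S : SkewTableau μ lam)

theorem mem_of_entry_ne_zero {r c : ℕ} (h : S.entry r c ≠ 0) : (r, c) ∈ μ ∧ (r, c) ∉ lam := by
  by_contra h'
  exact h (S.entry_zero r c h')

theorem mem_of_entry_eq {r c j : ℕ} (hj : 1 ≤ j) (h : S.entry r c = j) :
    (r, c) ∈ μ ∧ (r, c) ∉ lam := S.mem_of_entry_ne_zero (by omega)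

theorem entry_lt_iff {r r' c : ℕ} (h : S.entry r c ≠ 0) (h' : S.entry r' c ≠ 0) :
    S.entry r c < S.entry r' c ↔ r < r' := by
  obtain ⟨h1, h2⟩ := S.mem_of_entry_ne_zero h
  obtain ⟨h3, h4⟩ := S.mem_of_entry_ne_zero h'
  constructor
  · intro hlt
    by_contra hle
    rcases (not_lt.1 hle).eq_or_lt with rfl | h5
    · exact lt_irrefl _ hlt
    · exact lt_asymm hlt (S.col_strict r' r c h5 h4 h1)
  · exact fun h5 => S.col_strict r r' c h5 h2 h3

theorem row_eq_of_entry_eq {r r' c : ℕ} (h : S.entry r c ≠ 0) (he : S.entry r c = S.entry r' c) :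
    r = r' := by
  have h1 := S.entry_lt_iff h (he ▸ h)
  have h2 := S.entry_lt_iff (he ▸ h) h
  omega

/-- Consecutive letters in a column are in adjacent cells. -/
theorem row_eq_succ {r r' c j : ℕ} (hj : 1 ≤ j) (h : S.entry r c = j)
    (h' : S.entry r' c = j + 1) : r' = r + 1 := by
  have hlt : r < r' := (S.entry_lt_iff (c := c) (by omega) (by omega)).1 (by omega)
  by_contra hne
  obtain ⟨h1, h2⟩ := S.mem_of_entry_eq hj h
  obtain ⟨h3, h4⟩ := S.mem_of_entry_eq (by omega) h'
  have hμ : (r + 1, c) ∈ μ := μ.up_left_mem hlt le_rfl h3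
  have hl : (r + 1, c) ∉ lam := fun hm => h2 (lam.up_left_mem (Nat.le_succ r) le_rfl hm)
  have := S.col_strict r (r + 1) c (by omega) h2 hμ
  have := S.col_strict (r + 1) r' c (by omega) hl h3
  omega

/-- If `j` is in cell `(r, c)`, above a `j + 1`, then so is each `j` to the left of that cell. -/
theorem entry_succ_of_left {r c c' j : ℕ} (hj : 1 ≤ j) (hc : c' < c) (h : S.entry r c = j)
    (h1 : S.entry (r + 1) c = j + 1) (h' : S.entry r c' = j) : S.entry (r + 1) c' = j + 1 := by
  obtain ⟨h2, h3⟩ := S.mem_of_entry_eq hj h'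
  obtain ⟨h4, h5⟩ := S.mem_of_entry_eq (by omega) h1
  have hμ : (r + 1, c') ∈ μ := μ.up_left_mem le_rfl hc.le h4
  have hl : (r + 1, c') ∉ lam := fun hm => h3 (lam.up_left_mem (Nat.le_succ r) le_rfl hm)
  have := S.col_strict r (r + 1) c' (by omega) h3 hμ
  have := S.row_weak (r + 1) c' c hc hl h4
  omega

/-- If `j + 1` is in cell `(r + 1, c)`, below a `j`, then so is each `j + 1` to the right of that
cell. -/
theorem entry_eq_of_right {r c c' j : ℕ} (hj : 1 ≤ j) (hc : c < c') (h : S.entry r c = j)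
    (h' : S.entry (r + 1) c' = j + 1) : S.entry r c' = j := by
  obtain ⟨h2, h3⟩ := S.mem_of_entry_eq hj h
  obtain ⟨h4, h5⟩ := S.mem_of_entry_eq (by omega) h'
  have hμ : (r, c') ∈ μ := μ.up_left_mem (Nat.le_succ r) le_rfl h4
  have hl : (r, c') ∉ lam := fun hm => h3 (lam.up_left_mem le_rfl hc.le hm)
  have := S.col_strict r (r + 1) c' (by omega) hl h4
  have := S.row_weak r c c' hc h3 hμ
  omega

/-- The entry of a cell. -/
def cellEntry (x : ℕ × ℕ) : ℕ := S.entry x.1 x.2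

open Classical in
/-- The cells of the row reading that contain the only letter `j` or `j + 1` of their column. -/
noncomputable def singleCells (j R : ℕ) : List (ℕ × ℕ) :=
  (readCells μ lam R).filter fun x =>
    (S.cellEntry x = j ∨ S.cellEntry x = j + 1) ∧ SingleCol S.entry j x.2

open Classical in
/-- A row consists, as far as the letters `j` and `j + 1` are concerned, of letters `j` that lie
above a `j + 1`, letters alone in their columns, and letters `j + 1` that lie below a `j`. Hence in
the row reading, where the next row has been read before, the former and the latter are paired. -/
theorem labelScan_readCells {j : ℕ} (hj : 1 ≤ j) (R : ℕ) (o f : List (ℕ × ℕ)) :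
    labelScan j S.cellEntry (readCells μ lam R)
      (((rowCells μ lam R).filter fun x => S.cellEntry x = j + 1 ∧ HasLetter S.entry j x.2).reverse
        ++ o) f = labelScan j S.cellEntry (S.singleCells j R) o f := by
  induction R generalizing o f with
  | zero =>
    have h0 : ((rowCells μ lam 0).filter fun x =>
        S.cellEntry x = j + 1 ∧ HasLetter S.entry j x.2) = [] := by
      rw [List.filter_eq_nil_iff]
      rintro ⟨r, c⟩ hx
      simp only [decide_eq_true_eq]
      rintro ⟨h1, r', h2⟩
      obtain rfl := (mem_rowCells.1 hx).1
      have := S.row_eq_succ hj h2 h1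
      omega
    rw [h0]
    rfl
  | succ R ih =>
    set row := rowCells μ lam R with hrow
    set M := row.filter fun x => S.cellEntry x = j ∧ HasLetter S.entry (j + 1) x.2 with hM
    set P := row.filter fun x => S.cellEntry x = j + 1 ∧ HasLetter S.entry j x.2 with hP
    set F := row.filter fun x =>
      (S.cellEntry x = j ∨ S.cellEntry x = j + 1) ∧ SingleCol S.entry j x.2 with hF
    have hsplit : (row.filter fun x => S.cellEntry x = j ∨ S.cellEntry x = j + 1) =
        M ++ (F ++ P) := by
      have hpw := (pairwise_rowCells μ lam R).filter
        fun x => decide (S.cellEntry x = j ∨ S.cellEntry x = j + 1)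
      have hmemrow : ∀ x ∈ row, x.1 = R := fun x hx => (mem_rowCells.1 hx).1
      rw [filter_append_filter_not_of_pairwise
        (fun x => decide (HasLetter S.entry (j + 1) x.2 ∧ S.cellEntry x = j)) hpw ?_]
      · congr 1
        · rw [List.filter_filter]
          refine List.filter_congr fun x _ => ?_
          rw [← Bool.decide_and, decide_eq_decide]
          tauto
        · rw [filter_append_filter_not_of_pairwise
            (fun x => decide ¬(HasLetter S.entry j x.2 ∧ S.cellEntry x = j + 1))
            (hpw.filter _) ?_]
          · congr 1
            · rw [List.filter_filter, List.filter_filter]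
              refine List.filter_congr fun x _ => ?_
              rw [← decide_not, ← Bool.decide_and, ← Bool.decide_and, decide_eq_decide]
              have h1 : S.cellEntry x = j → HasLetter S.entry j x.2 := fun h => ⟨x.1, h⟩
              have h2 : S.cellEntry x = j + 1 → HasLetter S.entry (j + 1) x.2 := fun h => ⟨x.1, h⟩
              have h3 : S.cellEntry x = j → S.cellEntry x ≠ j + 1 := by omega
              rw [SingleCol]
              tauto
            · rw [List.filter_filter, List.filter_filter]
              refine List.filter_congr fun x _ => ?_
              rw [← decide_not, ← decide_not, ← Bool.decide_and, ← Bool.decide_and,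
                decide_eq_decide]
              have h3 : S.cellEntry x = j → S.cellEntry x ≠ j + 1 := by omega
              tauto
          · rintro ⟨r, c⟩ hx ⟨r', c'⟩ hy hlt h
            simp only [List.mem_filter, decide_eq_true_eq] at hx hy h ⊢
            obtain rfl := hmemrow _ hx.1.1
            obtain rfl : r' = r := hmemrow _ hy.1.1
            rintro ⟨⟨s, hs⟩, h2⟩
            obtain rfl := S.row_eq_succ hj hs h2
            have h4 := (S.mem_of_entry_eq (by omega) h2).2
            have hy' := (mem_rowCells.1 hy.1.1).2.1
            have h5 := S.row_weak _ _ _ hlt h4 hy'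
            rcases hy.1.2 with h6 | h6
            · simp only [cellEntry] at h6 h2 h5
              omega
            · exact h ⟨⟨s, S.entry_eq_of_right hj hlt hs h6⟩, h6⟩
      · rintro ⟨r, c⟩ hx ⟨r', c'⟩ hy hlt h
        simp only [List.mem_filter, decide_eq_true_eq] at hx hy h ⊢
        obtain rfl := hmemrow _ hx.1
        obtain rfl : r' = r := hmemrow _ hy.1
        obtain ⟨⟨s, hs⟩, h2⟩ := h
        obtain rfl := S.row_eq_succ hj h2 hs
        have h4 := (mem_rowCells.1 hx.1).2.2
        have hy' := (mem_rowCells.1 hy.1).2.1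
        have h5 := S.row_weak _ _ _ hlt h4 hy'
        simp only [cellEntry] at hx h2 h5 ⊢
        have h6 : S.entry r' c = j := by omega
        exact ⟨⟨_, S.entry_succ_of_left hj hlt h2 hs h6⟩, h6⟩
    have hlen : ((rowCells μ lam (R + 1)).filter fun x =>
        S.cellEntry x = j + 1 ∧ HasLetter S.entry j x.2).reverse.length = M.length := by
      rw [List.length_reverse, ← List.length_map (fun x : ℕ × ℕ => x.2),
        ← List.length_map (as := M) (fun x : ℕ × ℕ => x.2)]
      have hnd : ∀ r (q : ℕ × ℕ → Bool),
          (((rowCells μ lam r).filter q).map fun x : ℕ × ℕ => x.2).Nodup := by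
        intro r q
        rw [List.nodup_iff_pairwise_ne, List.pairwise_map]
        exact ((pairwise_rowCells μ lam r).filter q).imp fun h => h.ne
      refine ((List.perm_ext_iff_of_nodup (hnd _ _) (hnd _ _)).2 fun c => ?_).length_eq
      simp only [List.mem_map, List.mem_filter, decide_eq_true_eq, Prod.exists]
      constructor
      · rintro ⟨r, c, ⟨h1, h2, s, h3⟩, rfl⟩
        have := S.row_eq_succ hj h3 h2
        have h4 : r = R + 1 := (mem_rowCells.1 h1).1
        obtain rfl : s = R := by omega
        exact ⟨s, c, ⟨mem_rowCells.2 ⟨rfl, S.mem_of_entry_eq hj h3⟩, h3, _, h2⟩, rfl⟩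
      · rintro ⟨r, c, ⟨h1, h2, s, h3⟩, rfl⟩
        have := S.row_eq_succ hj h2 h3
        have h4 : r = R := (mem_rowCells.1 h1).1
        obtain rfl : s = R + 1 := by omega
        exact ⟨R + 1, c, ⟨mem_rowCells.2 ⟨rfl, S.mem_of_entry_eq (by omega) h3⟩, h3, _, h2⟩, rfl⟩
    have hsc : S.singleCells j (R + 1) = F ++ S.singleCells j R := by
      rw [singleCells, readCells_succ, List.filter_append]
      rfl
    rw [readCells_succ, labelScan_append, ← labelScan_filter _ _ row, hsplit,
      labelScan_append _ _ M, labelScan_all_eq M (fun x hx => ?_) _ _ _ hlen,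
      labelScan_append _ _ F, labelScan_all_succ P (fun x hx => ?_), ih, hsc, labelScan_append]
    · exact (of_decide_eq_true (List.mem_filter.1 hx).2).1
    · exact (of_decide_eq_true (List.mem_filter.1 hx).2).1

/-- Cells with the only letter `j` or `j + 1` of their column are read from left to right. -/
theorem pairwise_singleCells {j : ℕ} (hj : 1 ≤ j) (R : ℕ) :
    (S.singleCells j R).Pairwise fun x y => x.2 < y.2 := by
  classical
  refine ((pairwise_readCells μ lam R).filter _).imp_of_mem ?_
  rintro ⟨r, c⟩ ⟨r', c'⟩ hx hy h
  simp only [List.mem_filter, decide_eq_true_eq] at hx hy h ⊢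
  rcases h with h | h
  · by_contra hle
    have hle : c' ≤ c := not_lt.1 hle
    obtain ⟨-, h1, h2⟩ := hx
    obtain ⟨-, h3, h4⟩ := hy
    simp only [cellEntry] at h1 h3
    obtain ⟨h5, h6⟩ := S.mem_of_entry_ne_zero (r := r) (c := c) (by omega)
    obtain ⟨h7, h8⟩ := S.mem_of_entry_ne_zero (r := r') (c := c') (by omega)
    have h9 : (r, c') ∈ μ := μ.up_left_mem le_rfl hle h5
    have h10 : (r, c') ∉ lam := fun hm => h8 (lam.up_left_mem h.le le_rfl hm)
    have h11 := S.col_strict r' r c' h h8 h9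
    have h12 : S.entry r c' ≤ S.entry r c := by
      rcases hle.eq_or_lt with rfl | hlt
      · exact le_rfl
      · exact S.row_weak r c' c hlt h10 h5
    have h13 : HasLetter S.entry j c' := ⟨r', by omega⟩
    have h14 : HasLetter S.entry (j + 1) c' := ⟨r, by omega⟩
    rw [SingleCol] at h4
    tauto
  · exact h.2

theorem map_singleCells {j : ℕ} (hj : 1 ≤ j) {R N : ℕ} (hR : μ.colLen 0 ≤ R)
    (hN : μ.rowLen 0 ≤ N) : (S.singleCells j R).map (fun x => x.2) = singleCols S.entry j N := by
  classical
  have h1 : ((S.singleCells j R).map fun x => x.2).Pairwise (· < ·) := by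
    rw [List.pairwise_map]
    exact S.pairwise_singleCells hj R
  have h2 : (singleCols S.entry j N).Pairwise (· < ·) := List.pairwise_lt_range.filter _
  refine List.Perm.eq_of_pairwise (le := (· < ·)) (fun a b _ _ h h' => (lt_asymm h h').elim) h1 h2
    ((List.perm_ext_iff_of_nodup (h1.imp fun h => h.ne) (h2.imp fun h => h.ne)).2 fun c => ?_)
  simp only [singleCols, singleCells, List.mem_map, List.mem_filter, decide_eq_true_eq,
    List.mem_range, mem_readCells]
  constructor
  · rintro ⟨⟨r, c⟩, ⟨⟨-, h3, -⟩, -, h4⟩, rfl⟩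
    have h5 : (0, c) ∈ μ := μ.up_left_mem (Nat.zero_le r) le_rfl h3
    exact ⟨(YoungDiagram.mem_iff_lt_rowLen.1 h5).trans_le hN, h4⟩
  · rintro ⟨-, h3⟩
    have h4 : ∃ r, S.entry r c = j ∨ S.entry r c = j + 1 := by
      rcases h3 with ⟨⟨r, hr⟩, -⟩ | ⟨⟨r, hr⟩, -⟩
      · exact ⟨r, Or.inl hr⟩
      · exact ⟨r, Or.inr hr⟩
    obtain ⟨r, hr⟩ := h4
    obtain ⟨h5, h6⟩ := S.mem_of_entry_ne_zero (r := r) (c := c) (by omega)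
    have h7 : (r, 0) ∈ μ := μ.up_left_mem le_rfl (Nat.zero_le c) h5
    exact ⟨(r, c), ⟨⟨(YoungDiagram.mem_iff_lt_colLen.1 h7).trans_le hR, h5, h6⟩, hr, h3⟩, rfl⟩

end SkewTableau

/-! ### Exchanging two letters in a tableau -/

section Toggle

variable (E : ℕ → ℕ → ℕ) (p N : ℕ)

open Classical in
/-- The letter among `p`, `p + 1` that occurs in a column where just one of them does. -/
noncomputable def colLetter (c : ℕ) : ℕ := if HasLetter E (p + 1) c then p + 1 else p

/-- The letter that the operator `σ_p`, applied to the word of the letters `colLetter` of the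
columns with exactly one of `p`, `p + 1`, puts in such a column. -/
noncomputable def newLetter (c : ℕ) : ℕ :=
  flipLetter p (colLetter E p) (singleCols E p N) c

open Classical in
/-- The filling obtained by applying `σ_p` to the word of the letters `p`, `p + 1` that are alone in
their columns, read from left to right; only the first `N` columns are considered. -/
noncomputable def toggle (r c : ℕ) : ℕ :=
  if SingleCol E p c ∧ (E r c = p ∨ E r c = p + 1) then newLetter E p N c else E r c

variable {E p N}

theorem nodup_singleCols : (singleCols E p N).Nodup := List.nodup_range.filter _

theorem mem_singleCols {c : ℕ} : c ∈ singleCols E p N ↔ c < N ∧ SingleCol E p c := by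
  simp [singleCols]

theorem colLetter_eq (c : ℕ) : colLetter E p c = p ∨ colLetter E p c = p + 1 := by
  rw [colLetter]
  split_ifs <;> simp

theorem newLetter_eq (c : ℕ) : newLetter E p N c = p ∨ newLetter E p N c = p + 1 :=
  flipLetter_mem c (colLetter_eq c)

theorem eq_colLetter {r c : ℕ} (hc : SingleCol E p c) (h : E r c = p ∨ E r c = p + 1) :
    E r c = colLetter E p c := by
  rw [colLetter]
  rw [SingleCol] at hc
  split_ifs with h1
  · refine h.resolve_left fun h2 => ?_
    have : HasLetter E p c := ⟨r, h2⟩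
    tauto
  · exact h.resolve_right fun h2 => h1 ⟨r, h2⟩

theorem hasLetter_colLetter {c : ℕ} (hc : SingleCol E p c) : HasLetter E (colLetter E p c) c := by
  rw [colLetter]
  rw [SingleCol] at hc
  split_ifs with h
  · exact h
  · tauto

theorem toggle_of_not_single {r c : ℕ} (hc : ¬SingleCol E p c) : toggle E p N r c = E r c :=
  if_neg fun h => hc h.1

theorem toggle_of_ne {r c : ℕ} (h : E r c ≠ p) (h' : E r c ≠ p + 1) :
    toggle E p N r c = E r c := if_neg fun h'' => h''.2.elim h h'

theorem toggle_of_single {r c : ℕ} (hc : SingleCol E p c) (h : E r c = p ∨ E r c = p + 1) :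
    toggle E p N r c = newLetter E p N c := if_pos ⟨hc, h⟩

theorem toggle_letter_iff {r c : ℕ} : (toggle E p N r c = p ∨ toggle E p N r c = p + 1) ↔
    (E r c = p ∨ E r c = p + 1) := by
  by_cases h : SingleCol E p c ∧ (E r c = p ∨ E r c = p + 1)
  · rw [toggle_of_single h.1 h.2]
    exact iff_of_true (newLetter_eq c) h.2
  · rw [toggle, if_neg h]

theorem toggle_eq_iff {r c k : ℕ} (h : k ≠ p) (h' : k ≠ p + 1) :
    toggle E p N r c = k ↔ E r c = k := by
  by_cases h1 : E r c = p ∨ E r c = p + 1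
  · have := (toggle_letter_iff (N := N)).2 h1
    omega
  · rw [not_or] at h1
    rw [toggle_of_ne h1.1 h1.2]

theorem hasLetter_toggle_of_single {c k : ℕ} (hc : SingleCol E p c) (hk : k = p ∨ k = p + 1) :
    HasLetter (toggle E p N) k c ↔ k = newLetter E p N c := by
  constructor
  · rintro ⟨r, hr⟩
    have h1 := toggle_letter_iff.1 (hr ▸ hk)
    rw [← hr, toggle_of_single hc h1]
  · rintro rfl
    obtain ⟨r, hr⟩ := hasLetter_colLetter hc
    exact ⟨r, toggle_of_single hc (hr ▸ colLetter_eq c)⟩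

theorem hasLetter_toggle_of_not_single {c k : ℕ} (hc : ¬SingleCol E p c) :
    HasLetter (toggle E p N) k c ↔ HasLetter E k c := by
  simp only [HasLetter, toggle_of_not_single hc]

theorem singleCol_toggle {c : ℕ} : SingleCol (toggle E p N) p c ↔ SingleCol E p c := by
  by_cases hc : SingleCol E p c
  · refine iff_of_true ?_ hc
    rw [SingleCol, hasLetter_toggle_of_single hc (Or.inl rfl),
      hasLetter_toggle_of_single hc (Or.inr rfl)]
    have := newLetter_eq (E := E) (p := p) (N := N) c
    omega
  · rw [SingleCol, hasLetter_toggle_of_not_single hc, hasLetter_toggle_of_not_single hc, SingleCol]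

theorem singleCols_toggle : singleCols (toggle E p N) p N = singleCols E p N := by
  classical
  refine List.filter_congr fun c _ => ?_
  rw [decide_eq_decide]
  exact singleCol_toggle

theorem colLetter_toggle {c : ℕ} (hc : SingleCol E p c) :
    colLetter (toggle E p N) p c = newLetter E p N c := by
  rw [colLetter, hasLetter_toggle_of_single hc (Or.inr rfl)]
  have := newLetter_eq (E := E) (p := p) (N := N) c
  split_ifs <;> omega

theorem flipLetter_congr {α : Type*} {i : ℕ} {e e' : α → ℕ} {L : List α}
    (h : ∀ x ∈ L, e x = e' x) {x : α} (hx : x ∈ L) : flipLetter i e L x = flipLetter i e' L x := by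
  have hs : labelScan i e L [] [] = labelScan i e' L [] [] :=
    labelScan_congr L (fun y hy => by rw [h y hy]; exact ⟨Iff.rfl, Iff.rfl⟩) [] []
  rw [flipLetter, flipLetter, unpaired, unpaired, numOpen, numOpen, hs, h x hx]

theorem newLetter_toggle {c : ℕ} (hc : SingleCol E p c) (hN : c < N) :
    newLetter (toggle E p N) p N c = colLetter E p c := by
  rw [newLetter, singleCols_toggle, flipLetter_congr (e' := flipLetter p (colLetter E p)
    (singleCols E p N)) (fun d hd => colLetter_toggle (mem_singleCols.1 hd).2)
    (mem_singleCols.2 ⟨hN, hc⟩), flipLetter_flipLetter _ _ _ nodup_singleCols]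

theorem toggle_toggle (hN : ∀ r c, N ≤ c → E r c = 0) (hp : 1 ≤ p) :
    toggle (toggle E p N) p N = E := by
  funext r c
  by_cases h : SingleCol E p c ∧ (E r c = p ∨ E r c = p + 1)
  · have hc : c < N := by
      by_contra hle
      have := hN r c (not_lt.1 hle)
      omega
    rw [toggle_of_single (singleCol_toggle.2 h.1) (toggle_letter_iff.2 h.2),
      newLetter_toggle h.1 hc, eq_colLetter h.1 h.2]
  · have h1 : toggle E p N r c = E r c := if_neg h
    rw [← h1]
    exact if_neg fun h' => h ⟨singleCol_toggle.1 h'.1, toggle_letter_iff.1 h'.2⟩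

end Toggle

namespace SkewTableau

variable {ν μ : YoungDiagram} (T : SkewTableau ν μ)

theorem entry_eq_zero_of_le {r c : ℕ} (hc : ν.rowLen 0 ≤ c) : T.entry r c = 0 := by
  refine T.entry_zero r c fun h => ?_
  have := YoungDiagram.mem_iff_lt_rowLen.1 (ν.up_left_mem (Nat.zero_le r) le_rfl h.1)
  omega

/-- The rows remain weakly increasing: if both columns have just one of the letters, a factor
`(p + 1) p` of the new word would be a factor of the old one. -/
theorem toggle_row_adjacent {p : ℕ} (hp : 1 ≤ p) {r c : ℕ} (h1 : (r, c) ∉ μ)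
    (h2 : (r, c + 1) ∈ ν) : toggle T.entry p (ν.rowLen 0) r c ≤
      toggle T.entry p (ν.rowLen 0) r (c + 1) := by
  have hle := T.row_weak r c (c + 1) (Nat.lt_succ_self c) h1 h2
  have hc : (r, c) ∈ ν := ν.up_left_mem le_rfl (Nat.le_succ c) h2
  have h1' : (r, c + 1) ∉ μ := fun h => h1 (μ.up_left_mem le_rfl (Nat.le_succ c) h)
  by_cases hA : T.entry r c = p ∨ T.entry r c = p + 1
  swap
  · rw [toggle_of_ne (r := r) (c := c) (by omega) (by omega)]
    by_cases hB : T.entry r (c + 1) = p ∨ T.entry r (c + 1) = p + 1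
    · have := (toggle_letter_iff (N := ν.rowLen 0)).2 hB
      omega
    · rw [toggle_of_ne (by omega) (by omega)]
      exact hle
  by_cases hB : T.entry r (c + 1) = p ∨ T.entry r (c + 1) = p + 1
  swap
  · rw [toggle_of_ne (r := r) (c := c + 1) (by omega) (by omega)]
    have := (toggle_letter_iff (N := ν.rowLen 0)).2 hA
    omega
  have hA' := (toggle_letter_iff (N := ν.rowLen 0)).2 hA
  have hB' := (toggle_letter_iff (N := ν.rowLen 0)).2 hB
  by_cases hs : SingleCol T.entry p c <;> by_cases hs' : SingleCol T.entry p (c + 1)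
  · by_contra hlt
    have hN : c + 1 < ν.rowLen 0 :=
      YoungDiagram.mem_iff_lt_rowLen.1 (ν.up_left_mem (Nat.zero_le r) le_rfl h2)
    have hcols : ∃ L₁ L₂, singleCols T.entry p (ν.rowLen 0) = L₁ ++ c :: (c + 1) :: L₂ := by
      classical
      obtain ⟨k, hk⟩ := Nat.exists_eq_add_of_lt hN
      refine ⟨(List.range c).filter fun c => SingleCol T.entry p c,
        ((List.range k).map (c + 2 + ·)).filter fun c => SingleCol T.entry p c, ?_⟩
      rw [singleCols, hk, show c + 1 + k + 1 = c + 2 + k by omega, List.range_add,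
        List.range_succ, List.range_succ]
      simp [hs, hs']
    obtain ⟨L₁, L₂, hL⟩ := hcols
    rw [toggle_of_single hs hA] at hA' hlt
    rw [toggle_of_single hs' hB] at hB' hlt
    have := eq_of_flipLetter_adjacent (i := p) (e := colLetter T.entry p) nodup_singleCols hL
      (show newLetter T.entry p (ν.rowLen 0) c = p + 1 by omega)
      (show newLetter T.entry p (ν.rowLen 0) (c + 1) = p by omega)
    rw [← eq_colLetter hs hA, ← eq_colLetter hs' hB] at this
    omega
  · -- the second column contains `p` and `p + 1`
    rw [toggle_of_not_single (c := c + 1) hs']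
    by_contra hlt
    have hB1 : T.entry r (c + 1) = p := by omega
    have hb : HasLetter T.entry (p + 1) (c + 1) := by
      have : HasLetter T.entry p (c + 1) := ⟨r, hB1⟩
      rw [SingleCol] at hs'
      tauto
    obtain ⟨r', hr'⟩ := hb
    obtain rfl := T.row_eq_succ hp hB1 hr'
    have hm := (T.mem_of_entry_eq (by omega) hr').1
    have hm' : (r + 1, c) ∈ ν := ν.up_left_mem le_rfl (Nat.le_succ c) hm
    have hn' : (r + 1, c) ∉ μ := fun h => h1 (μ.up_left_mem (Nat.le_succ r) le_rfl h)
    have g1 := T.col_strict r (r + 1) c (Nat.lt_succ_self r) h1 hm'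
    have g2 := T.row_weak (r + 1) c (c + 1) (Nat.lt_succ_self c) hn' hm
    have g3 : HasLetter T.entry p c := ⟨r, by omega⟩
    have g4 : HasLetter T.entry (p + 1) c := ⟨r + 1, by omega⟩
    rw [SingleCol] at hs
    tauto
  · -- the first column contains `p` and `p + 1`
    rw [toggle_of_not_single (r := r) (c := c) hs]
    by_contra hlt
    have hA1 : T.entry r c = p + 1 := by omega
    have hb : HasLetter T.entry p c := by
      have : HasLetter T.entry (p + 1) c := ⟨r, hA1⟩
      rw [SingleCol] at hs
      tauto
    obtain ⟨r', hr'⟩ := hb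
    obtain rfl := T.row_eq_succ hp hr' hA1
    have hn := (T.mem_of_entry_eq hp hr').2
    have hm' : (r', c + 1) ∈ ν := ν.up_left_mem (Nat.le_succ r') le_rfl h2
    have hn' : (r', c + 1) ∉ μ := fun h => hn (μ.up_left_mem le_rfl (Nat.le_succ c) h)
    have g1 := T.col_strict r' (r' + 1) (c + 1) (Nat.lt_succ_self r') hn' h2
    have g2 := T.row_weak r' c (c + 1) (Nat.lt_succ_self c) hn hm'
    have g3 : HasLetter T.entry p (c + 1) := ⟨r', by omega⟩
    have g4 : HasLetter T.entry (p + 1) (c + 1) := ⟨r' + 1, by omega⟩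
    rw [SingleCol] at hs'
    tauto
  · rw [toggle_of_not_single hs, toggle_of_not_single hs']
    exact hle

/-- The tableau obtained by applying `σ_p` to the letters `p`, `p + 1` alone in their columns. -/
noncomputable def swapLetters (p : ℕ) (hp : 1 ≤ p) : SkewTableau ν μ where
  entry := toggle T.entry p (ν.rowLen 0)
  le := T.le
  entry_pos r c h1 h2 := by
    have h3 := T.entry_pos r c h1 h2
    by_contra h
    have h4 : toggle T.entry p (ν.rowLen 0) r c = 0 := by omega
    rw [toggle_eq_iff (by omega) (by omega)] at h4
    omega
  entry_zero r c h := by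
    rw [toggle_eq_iff (by omega) (by omega)]
    exact T.entry_zero r c h
  row_weak r c c' hc h1 h2 := by
    induction c', hc using Nat.le_induction with
    | base => exact T.toggle_row_adjacent hp h1 h2
    | succ c' hc ih =>
      exact (ih (ν.up_left_mem le_rfl (Nat.le_succ c') h2)).trans (T.toggle_row_adjacent hp
        (fun h => h1 (μ.up_left_mem le_rfl (Nat.le_of_succ_le hc) h)) h2)
  col_strict r r' c hr h1 h2 := by
    have h := T.col_strict r r' c hr h1 h2
    by_cases hs : SingleCol T.entry p c
    · by_cases hA : T.entry r c = p ∨ T.entry r c = p + 1 <;>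
        by_cases hB : T.entry r' c = p ∨ T.entry r' c = p + 1
      · have := eq_colLetter hs hA
        have := eq_colLetter hs hB
        omega
      · have := (toggle_letter_iff (N := ν.rowLen 0)).2 hA
        rw [toggle_of_ne (r := r') (by omega) (by omega)]
        omega
      · have := (toggle_letter_iff (N := ν.rowLen 0)).2 hB
        rw [toggle_of_ne (r := r) (by omega) (by omega)]
        omega
      · rwa [toggle_of_ne (r := r) (by omega) (by omega),
          toggle_of_ne (r := r') (by omega) (by omega)]
    · rwa [toggle_of_not_single hs, toggle_of_not_single hs]

theorem ext_entry {T T' : SkewTableau ν μ} (h : T.entry = T'.entry) : T = T' := by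
  cases T
  cases T'
  congr

theorem swapLetters_swapLetters (p : ℕ) (hp : 1 ≤ p) :
    (T.swapLetters p hp).swapLetters p hp = T :=
  ext_entry (toggle_toggle (fun _ _ h => T.entry_eq_zero_of_le h) hp)

open Classical in
/-- A letter occurs at most once in a column. -/
theorem ncard_entry_eq {k N : ℕ} (hk : 1 ≤ k) (hN : ν.rowLen 0 ≤ N) :
    {x : ℕ × ℕ | T.entry x.1 x.2 = k}.ncard =
      (List.range N).countP fun c => HasLetter T.entry k c := by
  have hinj : Set.InjOn Prod.snd {x : ℕ × ℕ | T.entry x.1 x.2 = k} := by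
    rintro ⟨r, c⟩ h ⟨r', c'⟩ h' hc
    rw [Set.mem_ofPred_eq] at h h'
    simp only at hc h h'
    subst hc
    rw [T.row_eq_of_entry_eq (r := r) (r' := r') (c := c) (by omega) (h.trans h'.symm)]
  rw [← hinj.ncard_image]
  have himg : Prod.snd '' {x : ℕ × ℕ | T.entry x.1 x.2 = k} =
      (((Finset.range N).filter fun c => HasLetter T.entry k c : Finset ℕ) : Set ℕ) := by
    ext c
    rw [Finset.mem_coe, Finset.mem_filter, Finset.mem_range]
    simp only [Set.mem_image, Set.mem_ofPred_eq, Prod.exists, exists_eq_right, HasLetter]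
    refine ⟨fun ⟨r, hr⟩ => ⟨?_, r, hr⟩, fun h => h.2⟩
    by_contra hle
    have := T.entry_eq_zero_of_le (r := r) (c := c) (by omega)
    omega
  rw [himg, Set.ncard_coe_finset, List.countP_eq_length_filter]
  rfl

theorem ncard_swapLetters_eq (p : ℕ) (hp : 1 ≤ p) :
    {x : ℕ × ℕ | (T.swapLetters p hp).entry x.1 x.2 = p}.ncard =
      {x : ℕ × ℕ | T.entry x.1 x.2 = p + 1}.ncard := by
  classical
  rw [ncard_entry_eq _ hp le_rfl, ncard_entry_eq _ (by omega) le_rfl]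
  have hsplit : ∀ (l : List ℕ) (a b : ℕ → Prop), l.countP (fun c => a c) =
      (l.filter fun c => b c).countP (fun c => a c) +
        (l.filter fun c => ¬b c).countP (fun c => a c) := by
    intro l a b
    induction l with
    | nil => rfl
    | cons x l ih =>
      simp only [List.filter_cons, List.countP_cons]
      by_cases hb : b x <;> simp [hb, List.countP_cons] at ih ⊢ <;> omega
  rw [hsplit _ _ (SingleCol T.entry p),
    hsplit (List.range _) (fun c => HasLetter T.entry (p + 1) c) (SingleCol T.entry p)]
  congr 1
  · have := countP_flipLetter p (colLetter T.entry p) (singleCols T.entry p (ν.rowLen 0))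
      nodup_singleCols fun c _ => colLetter_eq c
    refine Eq.trans (List.countP_congr fun c hc => ?_) (this.trans (List.countP_congr fun c hc => ?_))
    · simp only [decide_eq_true_eq]
      exact (hasLetter_toggle_of_single (mem_singleCols.1 hc).2 (Or.inl rfl)).trans eq_comm
    · simp only [decide_eq_true_eq]
      rw [colLetter]
      split_ifs with h <;> simp [h]
  · refine List.countP_congr fun c hc => ?_
    simp only [List.mem_filter, decide_eq_true_eq] at hc ⊢
    refine (hasLetter_toggle_of_not_single hc.2).trans ?_
    have := hc.2
    rw [SingleCol] at this
    tauto

theorem ncard_swapLetters_eq_succ (p : ℕ) (hp : 1 ≤ p) :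
    {x : ℕ × ℕ | (T.swapLetters p hp).entry x.1 x.2 = p + 1}.ncard =
      {x : ℕ × ℕ | T.entry x.1 x.2 = p}.ncard := by
  rw [← ncard_swapLetters_eq _ p hp, swapLetters_swapLetters]

end SkewTableau

/-! ### Column lengths of `a ∪ λ` -/

/-- In a list sorted so that the elements with property `q` come first, these are the first
`countP q` ones. -/
theorem getElem_iff_lt_countP {α : Type*} {R : α → α → Prop} {l : List α} (q : α → Bool)
    (hl : l.Pairwise R) (hq : ∀ x ∈ l, ∀ y ∈ l, R x y → q y = true → q x = true) (n : ℕ)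
    (hn : n < l.length) : q l[n] = true ↔ n < l.countP q := by
  have h := filter_append_filter_not_of_pairwise q hl hq
  have hget : l[n] = (l.filter q ++ l.filter fun x => !q x)[n]'(h ▸ hn) := by
    congr 1
  rw [hget, List.countP_eq_length_filter]
  constructor
  · intro hqn
    by_contra hlt
    rw [List.getElem_append_right (not_lt.1 hlt)] at hqn
    have := List.getElem_mem (l := l.filter fun x => !q x) (n := n - (l.filter q).length)
      (by rw [h, List.length_append] at hn; omega)
    rw [List.mem_filter] at this
    simp [hqn] at this
  · intro hlt
    rw [List.getElem_append_left hlt]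
    exact (List.mem_filter.1 (List.getElem_mem hlt)).2

theorem countP_rowLens (lam : YoungDiagram) (c : ℕ) :
    lam.rowLens.countP (fun n => decide (c < n)) = lam.colLen c := by
  rw [YoungDiagram.rowLens, List.countP_map]
  have h : (List.range (lam.colLen 0)).countP ((fun n => decide (c < n)) ∘ lam.rowLen) =
      ((Finset.range (lam.colLen 0)).filter fun r => r < lam.colLen c).card := by
    rw [List.countP_congr (q := fun r => decide (r < lam.colLen c))]
    · rw [List.countP_eq_length_filter]
      rfl
    · intro r _
      simp only [Function.comp_apply, decide_eq_true_eq]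
      rw [← YoungDiagram.mem_iff_lt_rowLen, YoungDiagram.mem_iff_lt_colLen]
  have hle : lam.colLen c ≤ lam.colLen 0 := lam.colLen_anti 0 c (Nat.zero_le c)
  rw [h, show ((Finset.range (lam.colLen 0)).filter fun r => r < lam.colLen c) =
    Finset.range (lam.colLen c) by ext r; simp; omega, Finset.card_range]

theorem colLen_unionPart {m : ℕ} (a : Fin m → ℕ) (lam : YoungDiagram) (c : ℕ) :
    (unionPart a lam).colLen c =
      lam.colLen c + (Finset.univ.filter fun i : Fin m => c < a i).card := by
  set w := (↑(List.ofFn a ++ lam.rowLens) : Multiset ℕ).sort (· ≥ ·) with hw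
  have hpw : w.Pairwise (· ≥ ·) := Multiset.pairwise_sort _ _
  have hcount : w.countP (fun n => decide (c < n)) =
      lam.colLen c + (Finset.univ.filter fun i : Fin m => c < a i).card := by
    have hperm : w.Perm (List.ofFn a ++ lam.rowLens) := by
      rw [← Multiset.coe_eq_coe]
      exact Multiset.sort_eq _ _
    rw [hperm.countP_eq, List.countP_append, countP_rowLens, add_comm, List.ofFn_eq_map,
      List.countP_map, List.countP_eq_length_filter]
    congr 1
  have hmem : ∀ r, r < (unionPart a lam).colLen c ↔ r < w.countP fun n => decide (c < n) := by
    intro r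
    rw [← YoungDiagram.mem_iff_lt_colLen, unionPart, YoungDiagram.mem_ofRowLens]
    constructor
    · rintro ⟨h, h'⟩
      exact (getElem_iff_lt_countP (fun n => decide (c < n)) hpw (fun x _ y _ hxy hy => by
        simp only [decide_eq_true_eq] at hy ⊢; omega) r h).1 (decide_eq_true h')
    · intro h
      have hr : r < w.length := h.trans_le List.countP_le_length
      refine ⟨hr, ?_⟩
      exact of_decide_eq_true <| (getElem_iff_lt_countP (fun n => decide (c < n)) hpw (fun x _ y _ hxy hy => by
        simp only [decide_eq_true_eq] at hy ⊢; omega) r hr).2 h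
  rw [← hcount]
  exact le_antisymm (le_of_not_gt fun h => lt_irrefl _ ((hmem _).1 h))
    (le_of_not_gt fun h => lt_irrefl _ ((hmem _).2 h))

theorem le_of_colLen_le {μ ν : YoungDiagram} (h : ∀ c, μ.colLen c ≤ ν.colLen c) : μ ≤ ν := by
  rintro ⟨r, c⟩ hm
  exact YoungDiagram.mem_iff_lt_colLen.2 ((YoungDiagram.mem_iff_lt_colLen.1 hm).trans_le (h c))

theorem card_eq_sum_colLen (μ : YoungDiagram) {N : ℕ} (hN : μ.rowLen 0 ≤ N) :
    μ.card = ∑ c ∈ Finset.range N, μ.colLen c := by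
  have h : ∀ x ∈ μ.cells, x.2 ∈ Finset.range N := by
    rintro ⟨r, c⟩ hx
    have hx' : (r, c) ∈ μ := hx
    have := YoungDiagram.mem_iff_lt_rowLen.1 (μ.up_left_mem (Nat.zero_le r) le_rfl hx')
    exact Finset.mem_range.2 (this.trans_le hN)
  rw [YoungDiagram.card, Finset.card_eq_sum_card_fiberwise h]
  refine Finset.sum_congr rfl fun c _ => ?_
  rw [YoungDiagram.colLen_eq_card, YoungDiagram.col]

theorem card_unionPart {m : ℕ} (a : Fin m → ℕ) (lam : YoungDiagram) :
    (unionPart a lam).card = lam.card + ∑ i, a i := by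
  set N := (unionPart a lam).rowLen 0 + lam.rowLen 0 + ∑ i, a i with hN
  rw [card_eq_sum_colLen (unionPart a lam) (N := N) (by omega),
    card_eq_sum_colLen lam (N := N) (by omega)]
  simp only [colLen_unionPart, Finset.sum_add_distrib]
  congr 1
  simp only [Finset.card_filter]
  rw [Finset.sum_comm]
  refine Finset.sum_congr rfl fun i _ => ?_
  have hi : a i ≤ N := (Finset.single_le_sum (fun _ _ => Nat.zero_le _)
    (Finset.mem_univ i)).trans (Nat.le_add_left _ _)
  rw [← Finset.card_filter, show ((Finset.range N).filter fun c => c < a i) =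
    Finset.range (a i) by ext c; simp; omega, Finset.card_range]

namespace SkewTableau

variable {ν μ : YoungDiagram}

/-- A tableau of given shape is determined by the letters in each column. -/
theorem ext_hasLetter {T T' : SkewTableau ν μ} (h : ∀ k c, 1 ≤ k →
    (HasLetter T.entry k c ↔ HasLetter T'.entry k c)) : T = T' := by
  refine ext_entry (funext fun r => funext fun c => ?_)
  induction r using Nat.strong_induction_on with
  | _ r ih =>
    by_cases hr : (r, c) ∈ ν ∧ (r, c) ∉ μ
    swap
    · rw [T.entry_zero r c hr, T'.entry_zero r c hr]
    have key : ∀ S S' : SkewTableau ν μ, (∀ r' < r, S.entry r' c = S'.entry r' c) →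
        (∀ k, 1 ≤ k → HasLetter S.entry k c → HasLetter S'.entry k c) →
        S'.entry r c ≤ S.entry r c := by
      intro S S' hS hL
      have h1 := S.entry_pos r c hr.1 hr.2
      obtain ⟨r', hr'⟩ := hL _ h1 ⟨r, rfl⟩
      have h2 : r ≤ r' := by
        by_contra hlt
        have h3 := S.row_eq_of_entry_eq (r := r) (r' := r') (c := c) (by omega)
          (by rw [hS r' (not_le.1 hlt), hr'])
        omega
      have h4 := S'.entry_pos r c hr.1 hr.2
      have h5 := S'.entry_lt_iff (r := r') (r' := r) (c := c) (by omega) (by omega)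
      omega
    exact le_antisymm (key T' T (fun r' h' => (ih r' h').symm) fun k hk => (h k c hk).2)
      (key T T' ih fun k hk => (h k c hk).1)

end SkewTableau

/-! ### The complementary tableau -/

open Classical in
/-- The letters of column `c` of the complementary tableau, the `i`-th letter (counted from `0`) being
written `m - i`. -/
noncomputable def barSet {m : ℕ} (a : Fin m → ℕ) (T : ℕ → ℕ → ℕ) (c : ℕ) : Finset ℕ :=
  (Finset.univ.filter fun i : Fin m => c < a i ∧ ∀ r', T r' c ≠ i + 1).image
    fun i : Fin m => m - (i : ℕ)

theorem barEntry_eq {m : ℕ} (a : Fin m → ℕ) (lam : YoungDiagram) (T : ℕ → ℕ → ℕ) (r c : ℕ) :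
    barEntry a lam T r c = ((barSet a T c).sort (· ≤ ·)).getD (r - lam.colLen c) 0 := by
  classical
  rw [barEntry]
  congr 2
  ext v
  simp [barSet]

theorem mem_barSet {m : ℕ} {a : Fin m → ℕ} {T : ℕ → ℕ → ℕ} {c v : ℕ} :
    v ∈ barSet a T c ↔ ∃ i : Fin m, c < a i ∧ ¬HasLetter T (i + 1) c ∧ m - (i : ℕ) = v := by
  simp [barSet, HasLetter, and_assoc]

theorem sub_mem_barSet {m : ℕ} {a : Fin m → ℕ} {T : ℕ → ℕ → ℕ} {c : ℕ} (i : Fin m) :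
    m - (i : ℕ) ∈ barSet a T c ↔ c < a i ∧ ¬HasLetter T (i + 1) c := by
  rw [mem_barSet]
  constructor
  · rintro ⟨j, h1, h2, h3⟩
    obtain rfl : j = i := Fin.ext (by omega)
    exact ⟨h1, h2⟩
  · exact fun h => ⟨i, h.1, h.2, rfl⟩

open Classical in
theorem card_filter_barSet {m : ℕ} (a : Fin m → ℕ) (T : ℕ → ℕ → ℕ) (c k : ℕ) (hk : k ≤ m) :
    ((barSet a T c).filter (· ≤ m - k)).card = (Finset.univ.filter fun i : Fin m =>
      k ≤ i ∧ c < a i ∧ ¬HasLetter T (i + 1) c).card := by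
  have hinj : ∀ s : Finset (Fin m), Set.InjOn (fun i : Fin m => m - (i : ℕ)) s := by
    intro s i _ j _ h
    have : m - (i : ℕ) = m - (j : ℕ) := h
    exact Fin.ext (by omega)
  rw [barSet, Finset.filter_image, Finset.card_image_of_injOn (hinj _)]
  refine congrArg Finset.card (Finset.ext fun i => ?_)
  simp only [Finset.mem_filter, Finset.mem_univ, true_and, HasLetter, not_exists]
  have : m - (i : ℕ) ≤ m - k ↔ k ≤ i := by omega
  rw [this]
  tauto

theorem getElem_sort_le_iff (s : Finset ℕ) (K n : ℕ) (hn : n < (s.sort (· ≤ ·)).length) :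
    (s.sort (· ≤ ·))[n] ≤ K ↔ n < (s.filter (· ≤ K)).card := by
  have h := getElem_iff_lt_countP (fun v => decide (v ≤ K)) (Finset.pairwise_sort s (· ≤ ·))
    (fun x _ y _ hxy hy => by simp only [decide_eq_true_eq] at hy ⊢; omega) n hn
  rw [decide_eq_true_eq] at h
  rw [h, ← Multiset.coe_countP, Finset.sort_eq, Multiset.countP_eq_card_filter]
  rfl

section Complement

variable {m : ℕ} {Λ Ω : MPartition m} {T : SkewTableau (unionPart Λ.comp Λ.part) Ω.part}

open Classical in
/-- The number of cells in column `c` of `T` with entry at most `k`, the cells of `μ` (where the entry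
is `0`) included: of the `λ'_c + #{i : c < a_i}` cells of the column, one is lost for each letter
above `k` that does occur. -/
theorem colLen_add_card_missing (hT : T ∈ tableaux Λ Ω) (c k : ℕ) :
    Λ.part.colLen c + (Finset.univ.filter fun i : Fin m =>
        k ≤ i ∧ c < Λ.comp i ∧ ¬HasLetter T.entry (i + 1) c).card +
      (Finset.univ.filter fun i : Fin m => (i : ℕ) < k ∧ c < Λ.comp i).card =
    ((Finset.range ((unionPart Λ.comp Λ.part).colLen c)).filter
      fun r => T.entry r c ≤ k).card := by
  have h1 := Finset.card_filter_add_card_filter_not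
    (s := Finset.range ((unionPart Λ.comp Λ.part).colLen c)) (fun r => T.entry r c ≤ k)
  have h2 : ((Finset.range ((unionPart Λ.comp Λ.part).colLen c)).filter
      fun r => ¬T.entry r c ≤ k).card = (Finset.univ.filter fun i : Fin m =>
        k ≤ i ∧ c < Λ.comp i ∧ HasLetter T.entry (i + 1) c).card := by
    refine Finset.card_bij' (i := fun r hr => ⟨T.entry r c - 1, ?_⟩)
      (j := fun i hi => (Finset.mem_filter.1 hi).2.2.2.choose) ?_ ?_ ?_ ?_
    · have := hT.1 r c
      have := (Finset.mem_filter.1 hr).2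
      omega
    · intro r hr
      have h3 := (Finset.mem_filter.1 hr).2
      have h4 : T.entry r c - 1 + 1 = T.entry r c := by omega
      have h5 := hT.1 r c
      simp only [Finset.mem_filter, Finset.mem_univ, true_and]
      exact ⟨by omega, (hT.2 ⟨T.entry r c - 1, by omega⟩).2 r c h4.symm, r, h4.symm⟩
    · intro i hi
      have h3 := (Finset.mem_filter.1 hi).2.2.2.choose_spec
      have h4 := (Finset.mem_filter.1 hi).2.1
      rw [Finset.mem_filter, Finset.mem_range, ← YoungDiagram.mem_iff_lt_colLen]
      refine ⟨(T.mem_of_entry_eq (Nat.succ_pos _) h3).1, ?_⟩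
      omega
    · intro r hr
      have h3 := (Finset.mem_filter.1 hr).2
      have h5 : HasLetter T.entry (T.entry r c - 1 + 1) c := ⟨r, by omega⟩
      have h6 := h5.choose_spec
      exact T.row_eq_of_entry_eq (r := h5.choose) (c := c) (by omega) (by omega)
    · intro i hi
      have h3 := (Finset.mem_filter.1 hi).2.2.2.choose_spec
      refine Fin.ext ?_
      simp only
      omega
  have h3 : (Finset.univ.filter fun i : Fin m => c < Λ.comp i).card =
      (Finset.univ.filter fun i : Fin m => (i : ℕ) < k ∧ c < Λ.comp i).card +
      ((Finset.univ.filter fun i : Fin m =>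
        k ≤ i ∧ c < Λ.comp i ∧ HasLetter T.entry (i + 1) c).card +
      (Finset.univ.filter fun i : Fin m =>
        k ≤ i ∧ c < Λ.comp i ∧ ¬HasLetter T.entry (i + 1) c).card) := by
    rw [← Finset.card_union_of_disjoint, ← Finset.card_union_of_disjoint]
    · congr 1
      ext i
      simp only [Finset.mem_filter, Finset.mem_univ, true_and, Finset.mem_union]
      have := lt_or_ge (i : ℕ) k
      tauto
    · rw [Finset.disjoint_left]
      intro i
      simp only [Finset.mem_filter, Finset.mem_univ, true_and, Finset.mem_union]
      omega
    · rw [Finset.disjoint_left]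
      intro i
      simp only [Finset.mem_filter, Finset.mem_univ, true_and]
      tauto
  rw [Finset.card_range, colLen_unionPart] at h1
  rw [colLen_unionPart] at h2 ⊢
  omega

theorem card_entry_le_zero (c : ℕ) :
    ((Finset.range ((unionPart Λ.comp Λ.part).colLen c)).filter fun r => T.entry r c ≤ 0).card =
      Ω.part.colLen c := by
  have h : ((Finset.range ((unionPart Λ.comp Λ.part).colLen c)).filter
      fun r => T.entry r c ≤ 0) = Finset.range (Ω.part.colLen c) := by
    ext r
    rw [Finset.mem_filter, Finset.mem_range, Finset.mem_range, ← YoungDiagram.mem_iff_lt_colLen,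
      ← YoungDiagram.mem_iff_lt_colLen]
    constructor
    · rintro ⟨h1, h2⟩
      by_contra h3
      have := T.entry_pos r c h1 h3
      omega
    · intro h1
      exact ⟨T.le h1, (T.entry_zero r c fun h => h.2 h1).le⟩
  rw [h, Finset.card_range]

theorem colLen_add_card_barSet (hT : T ∈ tableaux Λ Ω) (c : ℕ) :
    Λ.part.colLen c + (barSet Λ.comp T.entry c).card = Ω.part.colLen c := by
  classical
  have h := colLen_add_card_missing hT c 0
  rw [card_entry_le_zero, ← card_filter_barSet _ _ _ _ (Nat.zero_le m)] at h
  simp only [not_lt_zero, false_and, Finset.filter_false, Finset.card_empty, add_zero] at h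
  rw [← h]
  congr 2
  refine (Finset.filter_true_of_mem fun v hv => ?_).symm
  obtain ⟨i, -, -, rfl⟩ := mem_barSet.1 hv
  omega

theorem part_le_part (hT : T ∈ tableaux Λ Ω) : Λ.part ≤ Ω.part :=
  le_of_colLen_le fun c => by
    have := colLen_add_card_barSet hT c
    omega

/-- The number of letters at most `m - k` in a column of the complementary tableau, together with the
part of the column in `λ`, decreases from column to column. -/
theorem card_filter_barSet_anti (hT : T ∈ tableaux Λ Ω) (ha : Antitone Λ.comp) (c k : ℕ)
    (hk : k ≤ m) :
    Λ.part.colLen (c + 1) + ((barSet Λ.comp T.entry (c + 1)).filter (· ≤ m - k)).card ≤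
      Λ.part.colLen c + ((barSet Λ.comp T.entry c).filter (· ≤ m - k)).card := by
  classical
  have hl : Λ.part.colLen (c + 1) ≤ Λ.part.colLen c := Λ.part.colLen_anti _ _ (Nat.le_succ c)
  by_cases h0 : ∃ i : Fin m, (i : ℕ) < k ∧ Λ.comp i = c + 1
  · -- by dominance no letter above `k` is allowed in column `c + 1`
    obtain ⟨i, hi, hic⟩ := h0
    have : ((barSet Λ.comp T.entry (c + 1)).filter (· ≤ m - k)) = ∅ := by
      rw [Finset.filter_eq_empty_iff]
      intro v hv
      obtain ⟨j, hj, -, rfl⟩ := mem_barSet.1 hv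
      intro hle
      have : Λ.comp j ≤ Λ.comp i := ha (Fin.mk_le_mk.2 (show (i : ℕ) ≤ j by omega))
      omega
    rw [this, Finset.card_empty]
    omega
  · have h1 := colLen_add_card_missing hT c k
    have h2 := colLen_add_card_missing hT (c + 1) k
    rw [← card_filter_barSet _ _ _ _ hk] at h1 h2
    have h3 : (Finset.univ.filter fun i : Fin m => (i : ℕ) < k ∧ c + 1 < Λ.comp i) =
        Finset.univ.filter fun i : Fin m => (i : ℕ) < k ∧ c < Λ.comp i := by
      ext i
      simp only [Finset.mem_filter, Finset.mem_univ, true_and]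
      have : ¬((i : ℕ) < k ∧ Λ.comp i = c + 1) := fun h => h0 ⟨i, h⟩
      omega
    have h4 : ((Finset.range ((unionPart Λ.comp Λ.part).colLen (c + 1))).filter
        fun r => T.entry r (c + 1) ≤ k).card ≤
        ((Finset.range ((unionPart Λ.comp Λ.part).colLen c)).filter
        fun r => T.entry r c ≤ k).card := by
      refine Finset.card_le_card fun r hr => ?_
      rw [Finset.mem_filter, Finset.mem_range, ← YoungDiagram.mem_iff_lt_colLen] at hr ⊢
      refine ⟨(unionPart Λ.comp Λ.part).up_left_mem le_rfl (Nat.le_succ c) hr.1, ?_⟩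
      by_cases hm : (r, c) ∈ Ω.part
      · rw [T.entry_zero r c fun h => h.2 hm]
        exact Nat.zero_le k
      · exact (T.row_weak r c (c + 1) (Nat.lt_succ_self c) hm hr.1).trans hr.2
    rw [h3] at h2
    omega

theorem sub_lt_length_sort (hT : T ∈ tableaux Λ Ω) {r c : ℕ} (h : (r, c) ∈ Ω.part)
    (h' : (r, c) ∉ Λ.part) :
    r - Λ.part.colLen c < ((barSet Λ.comp T.entry c).sort (· ≤ ·)).length := by
  rw [Finset.length_sort]
  have := colLen_add_card_barSet hT c
  rw [YoungDiagram.mem_iff_lt_colLen] at h h'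
  omega

theorem barEntry_eq_getElem (hT : T ∈ tableaux Λ Ω) {r c : ℕ} (h : (r, c) ∈ Ω.part)
    (h' : (r, c) ∉ Λ.part) : barEntry Λ.comp Λ.part T.entry r c =
      ((barSet Λ.comp T.entry c).sort (· ≤ ·))[r - Λ.part.colLen c]'(sub_lt_length_sort hT h h') := by
  rw [barEntry_eq, List.getD_eq_getElem _ _ (sub_lt_length_sort hT h h')]

theorem barEntry_mem (hT : T ∈ tableaux Λ Ω) {r c : ℕ} (h : (r, c) ∈ Ω.part)
    (h' : (r, c) ∉ Λ.part) : barEntry Λ.comp Λ.part T.entry r c ∈ barSet Λ.comp T.entry c := by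
  rw [barEntry_eq_getElem hT h h', ← Finset.mem_sort (· ≤ ·)]
  exact List.getElem_mem _

theorem barEntry_le_iff (hT : T ∈ tableaux Λ Ω) {r c : ℕ} (h : (r, c) ∈ Ω.part)
    (h' : (r, c) ∉ Λ.part) (K : ℕ) : barEntry Λ.comp Λ.part T.entry r c ≤ K ↔
      r < Λ.part.colLen c + ((barSet Λ.comp T.entry c).filter (· ≤ K)).card := by
  rw [barEntry_eq_getElem hT h h', getElem_sort_le_iff]
  rw [YoungDiagram.mem_iff_lt_colLen] at h'
  omega

open Classical in
/-- The complementary tableau `T̄`, of shape `μ/λ`. Its rows increase weakly by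
`card_filter_barSet_anti`. -/
noncomputable def barTableau (hT : T ∈ tableaux Λ Ω) (ha : Antitone Λ.comp) :
    SkewTableau Ω.part Λ.part where
  entry r c := if (r, c) ∈ Ω.part ∧ (r, c) ∉ Λ.part then barEntry Λ.comp Λ.part T.entry r c else 0
  le := part_le_part hT
  entry_pos r c h h' := by
    rw [if_pos ⟨h, h'⟩]
    obtain ⟨i, -, -, hi⟩ := mem_barSet.1 (barEntry_mem hT h h')
    omega
  entry_zero r c h := if_neg h
  row_weak r c c' hc h h' := by
    have h1 : (r, c) ∈ Ω.part := Ω.part.up_left_mem le_rfl hc.le h'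
    have h2 : (r, c') ∉ Λ.part := fun hm => h (Λ.part.up_left_mem le_rfl hc.le hm)
    rw [if_pos ⟨h1, h⟩, if_pos ⟨h', h2⟩, barEntry_le_iff hT h1 h]
    obtain ⟨i, -, -, hi⟩ := mem_barSet.1 (barEntry_mem hT h' h2)
    have h3 := (barEntry_le_iff hT h' h2 (m - (i : ℕ))).1 hi.ge
    rw [← hi]
    refine h3.trans_le ?_
    clear h3 hi h2 h'
    induction c', hc using Nat.le_induction with
    | base => exact card_filter_barSet_anti hT ha c i i.2.le
    | succ c' hc ih => exact (card_filter_barSet_anti hT ha c' i i.2.le).trans ih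
  col_strict r r' c hr h h' := by
    have h1 : (r, c) ∈ Ω.part := Ω.part.up_left_mem hr.le le_rfl h'
    have h2 : (r', c) ∉ Λ.part := fun hm => h (Λ.part.up_left_mem hr.le le_rfl hm)
    rw [if_pos ⟨h1, h⟩, if_pos ⟨h', h2⟩, barEntry_eq_getElem hT h1 h, barEntry_eq_getElem hT h' h2]
    refine (Finset.sortedLT_sort _).strictMono_get (Fin.mk_lt_mk.2 ?_)
    rw [YoungDiagram.mem_iff_lt_colLen] at h h2
    omega

theorem barTableau_entry (hT : T ∈ tableaux Λ Ω) (ha : Antitone Λ.comp) {r c : ℕ}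
    (h : (r, c) ∈ Ω.part) (h' : (r, c) ∉ Λ.part) :
    (barTableau hT ha).entry r c = barEntry Λ.comp Λ.part T.entry r c := if_pos ⟨h, h'⟩

theorem hasLetter_barTableau (hT : T ∈ tableaux Λ Ω) (ha : Antitone Λ.comp) {k c : ℕ}
    (hk : 1 ≤ k) :
    HasLetter (barTableau hT ha).entry k c ↔ k ∈ barSet Λ.comp T.entry c := by
  constructor
  · rintro ⟨r, hr⟩
    obtain ⟨h, h'⟩ := (barTableau hT ha).mem_of_entry_eq hk hr
    rw [← hr, barTableau_entry hT ha h h']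
    exact barEntry_mem hT h h'
  · intro hm
    rw [← Finset.mem_sort (· ≤ ·), List.mem_iff_getElem] at hm
    obtain ⟨n, hn, he⟩ := hm
    have h1 := colLen_add_card_barSet hT c
    have hn' := hn
    rw [Finset.length_sort] at hn'
    have h2 : (Λ.part.colLen c + n, c) ∈ Ω.part := by
      rw [YoungDiagram.mem_iff_lt_colLen]
      omega
    have h3 : (Λ.part.colLen c + n, c) ∉ Λ.part := by
      rw [YoungDiagram.mem_iff_lt_colLen]
      omega
    refine ⟨Λ.part.colLen c + n, ?_⟩
    rw [barTableau_entry hT ha h2 h3, barEntry_eq, Nat.add_sub_cancel_left,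
      List.getD_eq_getElem _ _ hn, he]

theorem barWord_eq (hT : T ∈ tableaux Λ Ω) (ha : Antitone Λ.comp) : barWord Λ Ω T.entry =
    (readCells Ω.part Λ.part (Ω.part.colLen 0)).map (barTableau hT ha).cellEntry := by
  rw [barWord, readCells, List.map_flatMap]
  refine List.flatMap_congr fun r _ => ?_
  rw [rowCells, List.map_map]
  refine List.map_congr_left fun c hc => ?_
  simp only [List.mem_filter, List.mem_range, decide_eq_true_eq] at hc
  refine (barTableau_entry hT ha (YoungDiagram.mem_iff_lt_rowLen.2 hc.1) ?_).symm
  rw [YoungDiagram.mem_iff_lt_rowLen]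
  omega

end Complement

/-! ### The charge is unchanged by the exchange -/

/-- The charge depends on the orbit of a word only. -/
theorem charge_eq_of_wordSwap {m j : ℕ} (hj : 1 ≤ j) (hjm : j < m) {w w' : List ℕ}
    (h : wordSwap j w = w') (h' : wordSwap j w' = w) : charge m w = charge m w' := by
  have key : ∀ {u v : List ℕ}, wordSwap j u = v → ∀ z, SameOrbit m v z → SameOrbit m u z :=
    fun h z hz => Relation.ReflTransGen.head ⟨j, hj, hjm, h.symm⟩ hz
  have horb : SameOrbit m w = SameOrbit m w' :=
    funext fun z => propext ⟨key h' z, key h z⟩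
  rw [charge, charge, horb]

theorem flipLetter_congr_scan {α : Type*} {i : ℕ} {e : α → ℕ} {L L' : List α}
    (h : labelScan i e L [] [] = labelScan i e L' [] []) (x : α) :
    flipLetter i e L x = flipLetter i e L' x := by
  rw [flipLetter, flipLetter, unpaired, unpaired, numOpen, numOpen, h]

theorem flipLetter_map {α β : Type*} {i : ℕ} {e : α → ℕ} {g : β → α} {L : List β}
    (hg : ∀ x ∈ L, ∀ y ∈ L, g x = g y → x = y) {x : β} (hx : x ∈ L) :
    flipLetter i e (L.map g) (g x) = flipLetter i (e ∘ g) L x := by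
  classical
  have hscan := labelScan_map i e g L [] []
  rw [List.map_nil] at hscan
  have hunp : unpaired i e (L.map g) = (unpaired i (e ∘ g) L).map g := by
    rw [unpaired, hscan, unpaired, List.map_append, List.map_reverse, List.map_reverse]
  have hnum : numOpen i e (L.map g) = numOpen i (e ∘ g) L := by
    rw [numOpen, hscan, numOpen, List.length_map]
  have hmem : ∀ M : List β, (∀ y ∈ M, y ∈ L) → (g x ∈ M.map g ↔ x ∈ M) := by
    intro M hM
    rw [List.mem_map]
    exact ⟨fun ⟨y, hy, he⟩ => hg y (hM y hy) x hx he ▸ hy, fun h => ⟨x, h, rfl⟩⟩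
  rw [flipLetter, flipLetter, hunp, hnum, ← List.map_take, ← List.map_drop]
  exact if_congr (hmem _ fun y hy => mem_of_mem_unpaired (List.mem_of_mem_take hy)) rfl
    (if_congr (hmem _ fun y hy => mem_of_mem_unpaired (List.mem_of_mem_drop hy)) rfl rfl)

theorem Decomposes.balanced {α : Type*} {i : ℕ} {e : α → ℕ} {L U : List α}
    (h : Decomposes i e L U) (hU : U = []) : Balanced i e L := by
  cases h with
  | base h => exact h
  | snoc => simp at hU

theorem Balanced.map {α β : Type*} {i : ℕ} {e : α → ℕ} {g : β → α} {B : List β}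
    (h : Balanced i (e ∘ g) B) : Balanced i e (B.map g) := by
  have hscan := labelScan_map i e g B [] []
  rw [h, List.map_nil] at hscan
  have hdec := decomposes_unpaired i e (B.map g)
  rw [unpaired, hscan] at hdec
  exact hdec.balanced rfl

/-- Labels for the letters of the word `u_a`: the pairs `(k, n)`, where `n` numbers the copies of the
letter that stands for `k`. -/
def uLabels {m : ℕ} (a : Fin m → ℕ) : List (Fin m × ℕ) :=
  (List.finRange m).flatMap fun k => (List.range (a ⟨0, k.pos⟩ - a k)).map fun n => (k, n)

theorem map_uLabels {m : ℕ} (a : Fin m → ℕ) :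
    (uLabels a).map (fun x => m - (x.1 : ℕ)) = uWord a := by
  rw [uLabels, uWord, List.map_flatMap]
  refine List.flatMap_congr fun k _ => ?_
  rw [List.map_map, List.eq_replicate_iff, List.length_map, List.length_range]
  refine ⟨rfl, fun v hv => ?_⟩
  obtain ⟨_, _, rfl⟩ := List.mem_map.1 hv
  rfl

theorem nodup_uLabels {m : ℕ} (a : Fin m → ℕ) : (uLabels a).Nodup := by
  rw [uLabels, List.nodup_flatMap]
  refine ⟨fun k _ => List.nodup_range.map fun n n' h => by simpa using h, ?_⟩
  refine (List.nodup_finRange m).imp fun {k k'} h => ?_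
  rw [Function.onFun, List.disjoint_left]
  rintro ⟨l, n⟩ h1 h2
  simp only [List.mem_map, Prod.mk.injEq] at h1 h2
  obtain ⟨_, _, rfl, _⟩ := h1
  obtain ⟨_, _, rfl, _⟩ := h2
  exact h rfl

theorem balanced_of_forall_ne {α : Type*} {i : ℕ} {e : α → ℕ} {L : List α}
    (h : ∀ x ∈ L, e x ≠ i ∧ e x ≠ i + 1) : Balanced i e L := by
  intro o f
  rw [← labelScan_filter, List.filter_eq_nil_iff.2]
  · rfl
  · intro x hx
    have := h x hx
    simp only [decide_eq_true_eq]
    tauto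

/-- If `a_i = a_{i+1}`, the letters `j + 1` and `j` that stand for `i` and `i + 1` occur in `u_a` as
a factor `(j + 1)^k j^k`. -/
theorem balanced_uLabels {m : ℕ} (a : Fin m → ℕ) (i : ℕ) (hi : i + 1 < m)
    (hai : a ⟨i, by omega⟩ = a ⟨i + 1, hi⟩) :
    Balanced (m - (i + 1)) (fun x : Fin m × ℕ => m - (x.1 : ℕ)) (uLabels a) := by
  have hsplit : List.finRange m = (List.finRange m).take i ++
      ([⟨i, by omega⟩, ⟨i + 1, hi⟩] ++ (List.finRange m).drop (i + 2)) := by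
    conv_lhs => rw [← List.take_append_drop i (List.finRange m)]
    rw [List.drop_eq_getElem_cons (by simpa using by omega),
      List.drop_eq_getElem_cons (by simpa using by omega)]
    simp
  have hnd := List.nodup_finRange m
  rw [hsplit, List.nodup_append, List.nodup_append] at hnd
  rw [uLabels, hsplit, List.flatMap_append, List.flatMap_append]
  have hne : ∀ l : List (Fin m), (∀ k ∈ l, k ≠ ⟨i, by omega⟩ ∧ k ≠ ⟨i + 1, hi⟩) →
      Balanced (m - (i + 1)) (fun x : Fin m × ℕ => m - (x.1 : ℕ))
        (l.flatMap fun k => (List.range (a ⟨0, k.pos⟩ - a k)).map fun n => (k, n)) := by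
    intro l hl
    refine balanced_of_forall_ne ?_
    rintro ⟨k, n⟩ hx
    simp only [List.mem_flatMap, List.mem_map, Prod.mk.injEq] at hx
    obtain ⟨_, hk, _, _, rfl, _⟩ := hx
    obtain ⟨h1, h2⟩ := hl _ hk
    rw [ne_eq, Fin.ext_iff] at h1 h2
    simp only at h1 h2 ⊢
    omega
  refine (hne _ fun k hk => ?_).append (Balanced.append ?_ (hne _ fun k hk => ?_))
  · exact ⟨fun h => hnd.2.2 k hk _ (by simp) h, fun h => hnd.2.2 k hk _ (by simp) h⟩
  · intro o f
    simp only [List.flatMap_cons, List.flatMap_nil, List.append_nil]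
    rw [labelScan_append]
    set A := (List.range (a ⟨0, by omega⟩ - a ⟨i, by omega⟩)).map
      fun n => ((⟨i, by omega⟩ : Fin m), n)
    have hA : ∀ x ∈ A, m - (x.1 : ℕ) = m - (i + 1) + 1 := by
      intro x hx
      obtain ⟨_, _, rfl⟩ := List.mem_map.1 hx
      simp only
      omega
    rw [labelScan_all_succ A hA, labelScan_all_eq]
    · intro x hx
      obtain ⟨_, _, rfl⟩ := List.mem_map.1 hx
      rfl
    · simp [A, hai]
  · exact ⟨fun h => hnd.2.1.2.2 _ (by simp) k hk h.symm,
      fun h => hnd.2.1.2.2 _ (by simp) k hk h.symm⟩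

namespace SkewTableau

variable {μ lam : YoungDiagram} (S : SkewTableau μ lam)

/-- The operator `σ_j` on the row reading of a tableau, followed by a word in which the letters
`j + 1` and `j` are paired, is the exchange of letters that are alone in their columns. -/
theorem wordSwap_append {γ : Type*} {j : ℕ} (hj : 1 ≤ j) (e : γ → ℕ) (U : List γ) (hU : U.Nodup)
    (hbal : Balanced j e U) {R : ℕ} (hR : μ.colLen 0 ≤ R) :
    wordSwap j ((readCells μ lam R).map S.cellEntry ++ U.map e) =
      (readCells μ lam R).map (S.swapLetters j hj).cellEntry ++ U.map e := by
  set L : List ((ℕ × ℕ) ⊕ γ) := (readCells μ lam R).map Sum.inl ++ U.map Sum.inr with hL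
  set e' : (ℕ × ℕ) ⊕ γ → ℕ := Sum.elim S.cellEntry e with he'
  have hnd : L.Nodup := by
    rw [hL, List.nodup_append]
    refine ⟨(nodup_readCells μ lam R).map Sum.inl_injective, hU.map Sum.inr_injective, ?_⟩
    intro x hx y hy hxy
    subst hxy
    rw [List.mem_map] at hx hy
    obtain ⟨_, _, rfl⟩ := hx
    obtain ⟨_, _, h⟩ := hy
    cases h
  have hw : (readCells μ lam R).map S.cellEntry ++ U.map e = L.map e' := by
    rw [hL, List.map_append, List.map_map, List.map_map]
    rfl
  have hscanU : Balanced j e' (U.map Sum.inr) := Balanced.map hbal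
  have hscan : labelScan j e' L [] [] =
      labelScan j e' ((S.singleCells j R).map Sum.inl) [] [] := by
    have hcomp : e' ∘ Sum.inl = S.cellEntry := rfl
    have h1 := labelScan_map j e' Sum.inl (readCells μ lam R) [] []
    have h2 := labelScan_map j e' Sum.inl (S.singleCells j R) [] []
    rw [hcomp, List.map_nil] at h1 h2
    have h3 : labelScan j S.cellEntry (readCells μ lam R) [] [] =
        labelScan j S.cellEntry (S.singleCells j R) [] [] := by
      classical
      rw [← S.labelScan_readCells hj R [] []]
      congr 1
      rw [eq_comm, List.append_nil, List.reverse_eq_nil_iff, List.filter_eq_nil_iff]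
      rintro ⟨r, c⟩ hx
      obtain ⟨h4, h5, -⟩ := mem_rowCells.1 hx
      simp only at h4
      subst h4
      have := YoungDiagram.mem_iff_lt_colLen.1 (μ.up_left_mem le_rfl (Nat.zero_le c) h5)
      omega
    rw [hL, labelScan_append, hscanU, h1, h2, h3]
  rw [hw, wordSwap_map j e' L hnd, hL, List.map_append, List.map_map, List.map_map, ← hL]
  congr 1
  · refine List.map_congr_left fun x hx => ?_
    rw [Function.comp_apply, flipLetter_congr_scan hscan]
    by_cases hxs : x ∈ S.singleCells j R
    · have hmem := hxs
      simp only [singleCells, List.mem_filter, decide_eq_true_eq] at hmem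
      rw [flipLetter_map (fun _ _ _ _ h => Sum.inl_injective h) hxs]
      refine Eq.trans ?_ (toggle_of_single hmem.2.2 hmem.2.1).symm
      rw [newLetter, ← S.map_singleCells hj hR le_rfl, flipLetter_map ?_ hxs]
      · refine flipLetter_congr (fun y hy => ?_) hxs
        simp only [singleCells, List.mem_filter, decide_eq_true_eq] at hy
        exact eq_colLetter hy.2.2 hy.2.1
      · intro y hy z hz hyz
        by_contra hne
        have := List.Pairwise.forall_of_forall_of_flip (l := S.singleCells j R)
          (R := fun x y : ℕ × ℕ => x ≠ y → x.2 ≠ y.2) (by simp)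
          ((S.pairwise_singleCells hj R).imp fun h _ => h.ne)
          ((S.pairwise_singleCells hj R).imp fun h _ => h.ne') hy hz hne
        exact this hyz
    · rw [flipLetter_of_notMem]
      · refine (if_neg fun h => hxs ?_).symm
        simp only [singleCells, List.mem_filter, decide_eq_true_eq]
        exact ⟨hx, h.2, h.1⟩
      · intro h
        have := mem_of_mem_unpaired h
        rw [List.mem_map] at this
        obtain ⟨y, hy, hyx⟩ := this
        exact hxs (Sum.inl_injective hyx ▸ hy)
  · refine List.map_congr_left fun y _ => ?_
    rw [Function.comp_apply, flipLetter_congr_scan hscan, flipLetter_of_notMem]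
    · rfl
    · intro h
      have := mem_of_mem_unpaired h
      rw [List.mem_map] at this
      obtain ⟨_, _, h'⟩ := this
      cases h'

/-- Let the letters `j + 1`, `j` of `S` occur in those of the first `A` columns where the letters
`p`, `p + 1` of `T` do not, respectively. Then the exchange of `p` and `p + 1` in `T` amounts to that
of `j` and `j + 1` in `S`. -/
theorem eq_swapLetters_of_hasLetter {ν κ : YoungDiagram} {S S' : SkewTableau μ lam}
    {T : SkewTableau ν κ} {j p A : ℕ} (hj : 1 ≤ j) (hp : 1 ≤ p)
    (hle : ∀ c, (HasLetter T.entry p c → c < A) ∧ (HasLetter T.entry (p + 1) c → c < A))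
    (hS : ∀ c, (HasLetter S.entry (j + 1) c ↔ c < A ∧ ¬HasLetter T.entry p c) ∧
      (HasLetter S.entry j c ↔ c < A ∧ ¬HasLetter T.entry (p + 1) c))
    (hS' : ∀ c, (HasLetter S'.entry (j + 1) c ↔ c < A ∧
        ¬HasLetter (T.swapLetters p hp).entry p c) ∧
      (HasLetter S'.entry j c ↔ c < A ∧ ¬HasLetter (T.swapLetters p hp).entry (p + 1) c))
    (hk : ∀ c k, 1 ≤ k → k ≠ j → k ≠ j + 1 → (HasLetter S'.entry k c ↔ HasLetter S.entry k c)) :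
    S' = S.swapLetters j hj := by
  have hsingle : ∀ c, SingleCol S.entry j c ↔ SingleCol T.entry p c := by
    intro c
    have h1 := hle c
    have h2 := hS c
    rw [SingleCol, SingleCol]
    tauto
  have hcolL : ∀ c, SingleCol T.entry p c →
      ((colLetter S.entry j c = j ↔ colLetter T.entry p c = p) ∧
        (colLetter S.entry j c = j + 1 ↔ colLetter T.entry p c = p + 1)) := by
    intro c hc
    have h3 : HasLetter S.entry (j + 1) c ↔ HasLetter T.entry (p + 1) c := by
      have h1 := hle c
      have h2 := hS c
      rw [SingleCol] at hc
      tauto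
    rw [colLetter, colLetter]
    split_ifs with g1 g2 g2
    · simp
    · exact absurd (h3.1 g1) g2
    · exact absurd (h3.2 g2) g1
    · simp
  have hcols : ∀ n, singleCols S.entry j n = singleCols T.entry p n := by
    classical
    intro n
    refine List.filter_congr fun c _ => ?_
    rw [decide_eq_decide]
    exact hsingle c
  have hwide : ∀ {ν μ : YoungDiagram} (U : SkewTableau ν μ) {k n : ℕ}, 1 ≤ k → ν.rowLen 0 ≤ n →
      singleCols U.entry k (ν.rowLen 0) = singleCols U.entry k n := by
    intro ν μ U k n hk hn
    rw [← U.map_singleCells hk le_rfl le_rfl, ← U.map_singleCells hk le_rfl hn]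
  have hnew : ∀ c, SingleCol T.entry p c → (newLetter S.entry j (μ.rowLen 0) c = j ↔
      newLetter T.entry p (ν.rowLen 0) c = p) := by
    intro c hc
    rw [newLetter, newLetter, hwide S hj (Nat.le_add_left _ (ν.rowLen 0)),
      hwide T hp (Nat.le_add_right _ (μ.rowLen 0)), hcols]
    have hscan := labelScan_congr (i := j) (i' := p) (e := colLetter S.entry j)
      (e' := colLetter T.entry p) (singleCols T.entry p (ν.rowLen 0 + μ.rowLen 0))
      (fun x hx => hcolL x (mem_singleCols.1 hx).2) [] []
    rw [flipLetter, flipLetter, unpaired, unpaired, numOpen, numOpen, hscan]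
    split_ifs
    · simp
    · simp
    · exact (hcolL c hc).1
  refine ext_hasLetter fun k c h1k => ?_
  by_cases hkj : k = j ∨ k = j + 1
  · by_cases hc : SingleCol T.entry p c
    · have hc' : c < A := by
        rcases hc with h | h
        · exact (hle c).1 h.1
        · exact (hle c).2 h.1
      have h1 : HasLetter (S.swapLetters j hj).entry k c ↔
          k = newLetter S.entry j (μ.rowLen 0) c :=
        hasLetter_toggle_of_single ((hsingle c).2 hc) hkj
      have h2 : HasLetter (T.swapLetters p hp).entry p c ↔
          p = newLetter T.entry p (ν.rowLen 0) c := hasLetter_toggle_of_single hc (Or.inl rfl)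
      have h3 : HasLetter (T.swapLetters p hp).entry (p + 1) c ↔
          p + 1 = newLetter T.entry p (ν.rowLen 0) c := hasLetter_toggle_of_single hc (Or.inr rfl)
      have h4 := newLetter_eq (E := S.entry) (p := j) (N := μ.rowLen 0) c
      have h5 := newLetter_eq (E := T.entry) (p := p) (N := ν.rowLen 0) c
      have h6 := hnew c hc
      rw [h1]
      rcases hkj with rfl | rfl
      · rw [(hS' c).2, h3]
        omega
      · rw [(hS' c).1, h2]
        omega
    · have h1 : HasLetter (S.swapLetters j hj).entry k c ↔ HasLetter S.entry k c :=
        hasLetter_toggle_of_not_single fun h => hc ((hsingle c).1 h)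
      have h2 : HasLetter (T.swapLetters p hp).entry p c ↔ HasLetter T.entry p c :=
        hasLetter_toggle_of_not_single hc
      have h3 : HasLetter (T.swapLetters p hp).entry (p + 1) c ↔ HasLetter T.entry (p + 1) c :=
        hasLetter_toggle_of_not_single hc
      rw [h1]
      rcases hkj with rfl | rfl
      · rw [(hS' c).2, h3, (hS c).2]
      · rw [(hS' c).1, h2, (hS c).1]
  · rw [not_or] at hkj
    exact (hk c k h1k hkj.1 hkj.2).trans
      (exists_congr fun r => toggle_eq_iff hkj.1 hkj.2).symm

end SkewTableau

section Exchange

variable {m : ℕ} {Λ Ω : MPartition m} {T : SkewTableau (unionPart Λ.comp Λ.part) Ω.part}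

theorem swapLetters_mem_tableaux (i : ℕ) (hi : i + 1 < m)
    (hai : Λ.comp ⟨i, by omega⟩ = Λ.comp ⟨i + 1, hi⟩) (hT : T ∈ tableaux Λ Ω) :
    T.swapLetters (i + 1) (Nat.succ_pos i) ∈ tableaux Λ (Ω.swap i hi) := by
  have hi' : i < m := Nat.lt_of_succ_lt hi
  have hlet : ∀ r c k, k ≠ i + 1 → k ≠ i + 1 + 1 →
      ((T.swapLetters (i + 1) (Nat.succ_pos i)).entry r c = k ↔ T.entry r c = k) :=
    fun r c k h h' => toggle_eq_iff h h'
  refine ⟨fun r c => ?_, fun k => ?_⟩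
  · by_contra hgt
    have h1 := (hlet r c _ (show (T.swapLetters (i + 1) (Nat.succ_pos i)).entry r c ≠ i + 1 by
      omega) (by omega)).1 rfl
    have := hT.1 r c
    omega
  have hcol : ∀ r c, (T.swapLetters (i + 1) (Nat.succ_pos i)).entry r c = i + 1 ∨
      (T.swapLetters (i + 1) (Nat.succ_pos i)).entry r c = i + 1 + 1 →
      c < Λ.comp ⟨i, by omega⟩ := by
    intro r c h
    rcases toggle_letter_iff.1 h with h1 | h1
    · exact (hT.2 ⟨i, by omega⟩).2 r c h1
    · rw [hai]
      exact (hT.2 ⟨i + 1, hi⟩).2 r c h1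
  by_cases h0 : (k : ℕ) = i
  · obtain rfl : k = ⟨i, hi'⟩ := Fin.ext h0
    refine ⟨?_, fun r c h => hcol r c (Or.inl h)⟩
    refine (T.ncard_swapLetters_eq (i + 1) (Nat.succ_pos i)).trans ?_
    exact ((hT.2 ⟨i + 1, hi⟩).1).trans (Ω.comp_swap_left i hi).symm
  by_cases h1 : (k : ℕ) = i + 1
  · obtain rfl : k = ⟨i + 1, hi⟩ := Fin.ext h1
    refine ⟨?_, fun r c h => hai ▸ hcol r c (Or.inr h)⟩
    refine (T.ncard_swapLetters_eq_succ (i + 1) (Nat.succ_pos i)).trans ?_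
    exact ((hT.2 ⟨i, by omega⟩).1).trans (Ω.comp_swap_right i hi).symm
  have hk : (Ω.swap i hi).comp k = Ω.comp k := by
    change Ω.comp (Equiv.swap _ _ k) = Ω.comp k
    rw [Equiv.swap_apply_of_ne_of_ne]
    · exact fun h => h0 (congrArg Fin.val h)
    · exact fun h => h1 (congrArg Fin.val h)
  simp only [hlet _ _ ((k : ℕ) + 1) (by omega) (by omega), hk]
  exact hT.2 k

/-- As `a_i = a_{i+1}`, the letters for `i` and `i + 1` are allowed in the same columns of `T`, so
that an exchange of letters in `T` is an exchange of letters in the complementary tableau. -/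
theorem barTableau_swapLetters (i : ℕ) (hi : i + 1 < m)
    (hai : Λ.comp ⟨i, by omega⟩ = Λ.comp ⟨i + 1, hi⟩) (ha : Antitone Λ.comp)
    (hT : T ∈ tableaux Λ Ω) :
    barTableau (swapLetters_mem_tableaux i hi hai hT) ha =
      (barTableau hT ha).swapLetters (m - (i + 1)) (by omega) := by
  -- the letter `j + 1` stands for `i + 1`, and `j` for `i + 2`
  have hbar : ∀ (U : ℕ → ℕ → ℕ) c, (m - (i + 1) + 1 ∈ barSet Λ.comp U c ↔
      c < Λ.comp ⟨i, by omega⟩ ∧ ¬HasLetter U (i + 1) c) ∧ (m - (i + 1) ∈ barSet Λ.comp U c ↔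
      c < Λ.comp ⟨i, by omega⟩ ∧ ¬HasLetter U (i + 1 + 1) c) := by
    intro U c
    have h1 := sub_mem_barSet (a := Λ.comp) (T := U) (c := c) ⟨i, by omega⟩
    have h0 := sub_mem_barSet (a := Λ.comp) (T := U) (c := c) ⟨i + 1, hi⟩
    have e1 : m - i = m - (i + 1) + 1 := by omega
    simp only [e1, ← hai] at h1 h0
    exact ⟨h1, h0⟩
  have hj : 1 ≤ m - (i + 1) := by omega
  have hT' := swapLetters_mem_tableaux i hi hai hT
  refine SkewTableau.eq_swapLetters_of_hasLetter hj (Nat.succ_pos i) (A := Λ.comp ⟨i, by omega⟩)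
    (T := T) (fun c => ⟨?_, ?_⟩) (fun c => ⟨?_, ?_⟩) (fun c => ⟨?_, ?_⟩) fun c k hk hk0 hk1 => ?_
  · rintro ⟨r, hr⟩
    exact (hT.2 ⟨i, by omega⟩).2 r c hr
  · rintro ⟨r, hr⟩
    rw [hai]
    exact (hT.2 ⟨i + 1, hi⟩).2 r c hr
  · exact (hasLetter_barTableau hT ha (by omega)).trans (hbar T.entry c).1
  · exact (hasLetter_barTableau hT ha hj).trans (hbar T.entry c).2
  · exact (hasLetter_barTableau hT' ha (by omega)).trans (hbar _ c).1
  · exact (hasLetter_barTableau hT' ha hj).trans (hbar _ c).2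
  · rw [hasLetter_barTableau hT' ha hk, hasLetter_barTableau hT ha hk, mem_barSet, mem_barSet]
    refine exists_congr fun l => and_congr_right fun _ => and_congr_left fun hl => not_congr ?_
    exact exists_congr fun r => toggle_eq_iff (by omega) (by omega)

/-- The word of the complementary tableau followed by `u_a` undergoes one of the operators `σ_j`. -/
theorem charge_barWord_swapLetters (i : ℕ) (hi : i + 1 < m)
    (hai : Λ.comp ⟨i, by omega⟩ = Λ.comp ⟨i + 1, hi⟩) (ha : Antitone Λ.comp)
    (hT : T ∈ tableaux Λ Ω) :
    charge m (barWord Λ (Ω.swap i hi) (T.swapLetters (i + 1) (Nat.succ_pos i)).entry ++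
      uWord Λ.comp) = charge m (barWord Λ Ω T.entry ++ uWord Λ.comp) := by
  have h1 := barWord_eq hT ha
  have h2 := barWord_eq (swapLetters_mem_tableaux i hi hai hT) ha
  rw [barTableau_swapLetters i hi hai ha hT] at h2
  have hbal := balanced_uLabels Λ.comp i hi hai
  have hsw := fun S : SkewTableau Ω.part Λ.part => S.wordSwap_append
    (show 1 ≤ m - (i + 1) by omega) _ _ (nodup_uLabels Λ.comp) hbal (R := Ω.part.colLen 0) le_rfl
  rw [map_uLabels] at hsw
  refine charge_eq_of_wordSwap (j := m - (i + 1)) (by omega) (by omega) ?_ ?_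
  · rw [h1, h2]
    refine (hsw _).trans ?_
    rw [SkewTableau.swapLetters_swapLetters]
  · rw [h1, h2]
    exact hsw _

theorem inv_swapComp (i : ℕ) (hi : i + 1 < m) (b : Fin m → ℕ)
    (hb : b ⟨i + 1, hi⟩ < b ⟨i, by omega⟩) : inv (swapComp i hi b) = inv b + 1 := by
  set u : Fin m := ⟨i, by omega⟩ with hu
  set v : Fin m := ⟨i + 1, hi⟩ with hv
  have huv : u ≠ v := by simp [hu, hv, Fin.ext_iff]
  have hlt : u < v := Fin.mk_lt_mk.2 (Nat.lt_succ_self i)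
  have hval : ∀ k : Fin m, ((Equiv.swap u v k : Fin m) : ℕ) =
      if (k : ℕ) = i then i + 1 else if (k : ℕ) = i + 1 then i else k := by
    intro k
    rw [Equiv.swap_apply_def]
    simp only [Fin.ext_iff, hu, hv]
    split_ifs <;> rfl
  have hsw : ∀ k, swapComp i hi b k = b (Equiv.swap u v k) := fun _ => rfl
  rw [inv, inv]
  have h1 : (Finset.univ.filter fun p : Fin m × Fin m =>
      p.1 < p.2 ∧ swapComp i hi b p.1 < swapComp i hi b p.2) =
      insert (u, v) ((Finset.univ.filter fun p : Fin m × Fin m => p.1 < p.2 ∧ b p.1 < b p.2).map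
        (Equiv.prodCongr (Equiv.swap u v) (Equiv.swap u v)).toEmbedding) := by
    ext ⟨k, l⟩
    rw [Finset.mem_insert, Finset.mem_map_equiv]
    simp only [Finset.mem_filter, Finset.mem_univ, true_and, Prod.mk.injEq,
      Equiv.prodCongr_symm, Equiv.symm_swap, Equiv.prodCongr_apply, Prod.map_apply, hsw]
    rw [Fin.lt_def, Fin.lt_def, hval, hval]
    constructor
    · rintro ⟨h2, h3⟩
      by_cases h4 : k = u ∧ l = v
      · exact Or.inl h4
      · refine Or.inr ⟨?_, h3⟩
        simp only [Fin.ext_iff, hu, hv] at h4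
        split_ifs <;> omega
    · rintro (⟨rfl, rfl⟩ | ⟨h2, h3⟩)
      · refine ⟨hlt, ?_⟩
        rwa [Equiv.swap_apply_left, Equiv.swap_apply_right]
      · refine ⟨?_, h3⟩
        by_contra h4
        have h5 : l = u ∧ k = v := by
          simp only [Fin.ext_iff, hu, hv]
          split_ifs at h2 <;> omega
        obtain ⟨rfl, rfl⟩ := h5
        rw [Equiv.swap_apply_left, Equiv.swap_apply_right] at h3
        omega
  rw [h1, Finset.card_insert_of_notMem, Finset.card_map]
  rw [Finset.mem_map_equiv]
  simp only [Finset.mem_filter, Finset.mem_univ, true_and, Equiv.prodCongr_symm, Equiv.symm_swap,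
    Equiv.prodCongr_apply, Prod.map_apply, Equiv.swap_apply_left, Equiv.swap_apply_right]
  exact fun h => lt_asymm hlt h.1

/-- If `a_i = a_{i+1}` and `b_i > b_{i+1}`, exchanging `b_i` and `b_{i+1}` multiplies the coefficient
by `t`. -/
theorem dCoeff_swap (i : ℕ) (hi : i + 1 < m) (hai : Λ.comp ⟨i, by omega⟩ = Λ.comp ⟨i + 1, hi⟩)
    (ha : Antitone Λ.comp) (hb : Ω.comp ⟨i + 1, hi⟩ < Ω.comp ⟨i, by omega⟩) :
    dCoeff Λ (Ω.swap i hi) = t * dCoeff Λ Ω := by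
  rw [dCoeff, dCoeff, ← smul_eq_mul, smul_finsum]
  symm
  simp only [smul_finsum]
  refine finsum_mem_eq_of_bijOn (fun T => T.swapLetters (i + 1) (Nat.succ_pos i)) ?_ ?_
  · refine Set.InvOn.bijOn (f' := fun T => T.swapLetters (i + 1) (Nat.succ_pos i))
      ⟨fun T _ => T.swapLetters_swapLetters _ _, fun T _ => T.swapLetters_swapLetters _ _⟩
      (fun T hT => swapLetters_mem_tableaux i hi hai hT) fun T hT => ?_
    have h := swapLetters_mem_tableaux i hi hai hT
    change _ ∈ tableaux Λ ⟨swapComp i hi (swapComp i hi Ω.comp), Ω.part⟩ at h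
    rwa [swapComp_swapComp] at h
  · intro T hT
    rw [smul_eq_mul, ← pow_succ', tableauCharge, tableauCharge,
      charge_barWord_swapLetters i hi hai ha hT]
    congr 1
    have := inv_swapComp i hi Ω.comp hb
    change _ = inv (swapComp i hi Ω.comp) + _
    omega

end Exchange

/-! ### Triangularity of the coefficients -/

section Triangular

variable {m : ℕ} {Λ Ω : MPartition m} {T : SkewTableau (unionPart Λ.comp Λ.part) Ω.part}

theorem card_eq_of_mem_tableaux (hT : T ∈ tableaux Λ Ω) :
    Λ.part.card + ∑ i, Λ.comp i = Ω.part.card + ∑ i, Ω.comp i := by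
  classical
  rw [← card_unionPart]
  have hsub : Ω.part.cells ⊆ (unionPart Λ.comp Λ.part).cells := T.le
  have h1 : ∀ x ∈ (unionPart Λ.comp Λ.part).cells \ Ω.part.cells,
      T.entry x.1 x.2 - 1 ∈ Finset.range m := by
    rintro ⟨r, c⟩ hx
    rw [Finset.mem_sdiff] at hx
    have := T.entry_pos r c hx.1 hx.2
    have := hT.1 r c
    rw [Finset.mem_range]
    simp only
    omega
  rw [YoungDiagram.card, YoungDiagram.card, ← Finset.card_sdiff_add_card_eq_card hsub, add_comm,
    Finset.card_eq_sum_card_fiberwise h1, Finset.sum_range]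
  congr 1
  refine Finset.sum_congr rfl fun i _ => ?_
  rw [← (hT.2 i).1, ← Set.ncard_coe_finset]
  congr 1
  ext ⟨r, c⟩
  simp only [Finset.coe_filter, Finset.mem_sdiff, Set.mem_ofPred_eq, YoungDiagram.mem_cells]
  constructor
  · rintro ⟨⟨h2, h3⟩, h4⟩
    have := T.entry_pos r c h2 h3
    omega
  · intro h
    exact ⟨T.mem_of_entry_eq (Nat.succ_pos _) h, by omega⟩

/-- In a tableau without complementary cells each letter occurs wherever it may. -/
theorem hasLetter_of_part_eq (hT : T ∈ tableaux Λ Ω) (hp : Λ.part = Ω.part) (i : Fin m) (c : ℕ) :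
    HasLetter T.entry (i + 1) c ↔ c < Λ.comp i := by
  refine ⟨fun ⟨r, hr⟩ => (hT.2 i).2 r c hr, fun hc => ?_⟩
  by_contra hn
  have h1 := colLen_add_card_barSet hT c
  have h2 : Λ.part.colLen c = Ω.part.colLen c := by rw [hp]
  rw [h2, Nat.add_eq_left, Finset.card_eq_zero] at h1
  have := (sub_mem_barSet (a := Λ.comp) (T := T.entry) i).2 ⟨hc, hn⟩
  rw [h1] at this
  simp at this

theorem comp_eq_of_part_eq (hT : T ∈ tableaux Λ Ω) (hp : Λ.part = Ω.part) (i : Fin m) :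
    Ω.comp i = Λ.comp i := by
  classical
  rw [← (hT.2 i).1, T.ncard_entry_eq (Nat.succ_pos _)
    (N := (unionPart Λ.comp Λ.part).rowLen 0 + Λ.comp i) (Nat.le_add_right _ _),
    List.countP_congr (q := fun c => decide (c < Λ.comp i)), List.countP_eq_length_filter]
  · change ((Finset.range _).filter fun c => c < Λ.comp i).card = _
    rw [show ((Finset.range ((unionPart Λ.comp Λ.part).rowLen 0 + Λ.comp i)).filter
      fun c => c < Λ.comp i) = Finset.range (Λ.comp i) by ext c; simp; omega, Finset.card_range]
  · intro c _
    simp only [decide_eq_true_eq]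
    exact hasLetter_of_part_eq hT hp i c

/-- Comparing sizes, `λ ⊆ μ` gives `∑ b ≤ ∑ a`; in the case of equality there are no complementary
cells. -/
theorem triangular_of_mem_tableaux (hT : T ∈ tableaux Λ Ω) :
    Ω.size = Λ.size ∧ (Ω = Λ ∨ ∑ i, Ω.comp i < ∑ i, Λ.comp i) := by
  have h1 := card_eq_of_mem_tableaux hT
  have h2 : Λ.part.cells ⊆ Ω.part.cells := part_le_part hT
  have h3 : Λ.part.card ≤ Ω.part.card := Finset.card_le_card h2
  refine ⟨by rw [MPartition.size, MPartition.size]; omega, ?_⟩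
  rcases h3.lt_or_eq with h | h
  · exact Or.inr (by omega)
  · have hp : Λ.part = Ω.part := YoungDiagram.ext (Finset.eq_of_subset_of_card_le h2 h.ge)
    exact Or.inl (MPartition.ext (funext (comp_eq_of_part_eq hT hp)) hp.symm)

theorem triangular_of_dCoeff_ne_zero (h : dCoeff Λ Ω ≠ 0) :
    Ω.size = Λ.size ∧ (Ω = Λ ∨ ∑ i, Ω.comp i < ∑ i, Λ.comp i) := by
  by_contra hn
  refine h ?_
  rw [dCoeff]
  exact finsum_mem_eq_zero_of_forall_eq_zero fun T hT => (hn (triangular_of_mem_tableaux hT)).elim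

/-- The tableau whose columns are filled with `1, 2, 3, …`. -/
noncomputable def columnTableau (Λ : MPartition m) :
    SkewTableau (unionPart Λ.comp Λ.part) Λ.part where
  entry r c := if Λ.part.colLen c ≤ r ∧ r < (unionPart Λ.comp Λ.part).colLen c then
    r - Λ.part.colLen c + 1 else 0
  le := le_of_colLen_le fun c => by
    rw [colLen_unionPart]
    omega
  entry_pos r c h h' := by
    rw [YoungDiagram.mem_iff_lt_colLen] at h h'
    rw [if_pos ⟨by omega, h⟩]
    omega
  entry_zero r c h := by
    rw [YoungDiagram.mem_iff_lt_colLen, YoungDiagram.mem_iff_lt_colLen] at h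
    exact if_neg (by omega)
  row_weak r c c' hc h h' := by
    have h1 := Λ.part.colLen_anti c c' hc.le
    have h2 := (unionPart Λ.comp Λ.part).colLen_anti c c' hc.le
    rw [YoungDiagram.mem_iff_lt_colLen] at h h'
    rw [if_pos (by omega), if_pos (by omega)]
    omega
  col_strict r r' c hr h h' := by
    rw [YoungDiagram.mem_iff_lt_colLen] at h h'
    rw [if_pos (by omega), if_pos (by omega)]
    omega

theorem lt_card_iff_of_antitone {a : Fin m → ℕ} (ha : Antitone a) (c : ℕ) (i : Fin m) :
    (i : ℕ) < (Finset.univ.filter fun k : Fin m => c < a k).card ↔ c < a i := by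
  constructor
  · intro h
    by_contra hn
    have hsub : (Finset.univ.filter fun k : Fin m => c < a k) ⊆ Finset.Iio i := by
      intro k hk
      rw [Finset.mem_Iio]
      by_contra hle
      have := ha (not_lt.1 hle)
      have := (Finset.mem_filter.1 hk).2
      omega
    have := Finset.card_le_card hsub
    rw [Fin.card_Iio] at this
    omega
  · intro h
    have hsub : Finset.Iic i ⊆ (Finset.univ.filter fun k : Fin m => c < a k) := by
      intro k hk
      have := ha (Finset.mem_Iic.1 hk)
      simp only [Finset.mem_filter, Finset.mem_univ, true_and]
      omega
    have := Finset.card_le_card hsub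
    rw [Fin.card_Iic] at this
    omega

theorem columnTableau_entry_eq_iff (r c k : ℕ) : (columnTableau Λ).entry r c = k + 1 ↔
    r = Λ.part.colLen c + k ∧ k < (Finset.univ.filter fun i : Fin m => c < Λ.comp i).card := by
  change (if Λ.part.colLen c ≤ r ∧ r < (unionPart Λ.comp Λ.part).colLen c then
    r - Λ.part.colLen c + 1 else 0) = k + 1 ↔ _
  rw [colLen_unionPart]
  generalize (Finset.univ.filter fun i : Fin m => c < Λ.comp i).card = n
  split_ifs with h
  · omega
  · exact iff_of_false not_false (by omega)

theorem columnTableau_mem (ha : Antitone Λ.comp) : columnTableau Λ ∈ tableaux Λ Λ := by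
  have hlet : ∀ (i : Fin m) c, HasLetter (columnTableau Λ).entry (i + 1) c ↔ c < Λ.comp i := by
    intro i c
    simp only [HasLetter, columnTableau_entry_eq_iff, lt_card_iff_of_antitone ha,
      exists_and_right, exists_eq, true_and]
  refine ⟨fun r c => ?_, fun i => ⟨?_, fun r c h => (hlet i c).1 ⟨r, h⟩⟩⟩
  · have h := Finset.card_le_univ (Finset.univ.filter fun i : Fin m => c < Λ.comp i)
    rw [Fintype.card_fin] at h
    rcases Nat.eq_zero_or_pos ((columnTableau Λ).entry r c) with h0 | h0
    · omega
    · have := (columnTableau_entry_eq_iff (Λ := Λ) r c ((columnTableau Λ).entry r c - 1)).1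
        (by omega)
      omega
  · classical
    rw [SkewTableau.ncard_entry_eq _ (Nat.succ_pos _)
      (N := (unionPart Λ.comp Λ.part).rowLen 0 + Λ.comp i) (Nat.le_add_right _ _),
      List.countP_congr (q := fun c => decide (c < Λ.comp i)), List.countP_eq_length_filter]
    · change ((Finset.range _).filter fun c => c < Λ.comp i).card = _
      rw [show ((Finset.range ((unionPart Λ.comp Λ.part).rowLen 0 + Λ.comp i)).filter
        fun c => c < Λ.comp i) = Finset.range (Λ.comp i) by ext c; simp; omega, Finset.card_range]
    · intro c _
      simp only [decide_eq_true_eq]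
      exact hlet i c

theorem tableaux_self (ha : Antitone Λ.comp) : tableaux Λ Λ = {columnTableau Λ} := by
  refine Set.eq_singleton_iff_unique_mem.2 ⟨columnTableau_mem ha, fun T hT => ?_⟩
  refine SkewTableau.ext_hasLetter fun k c hk => ?_
  by_cases hkm : k ≤ m
  · obtain ⟨i, rfl⟩ : ∃ i : Fin m, k = i + 1 := ⟨⟨k - 1, by omega⟩, by simp only; omega⟩
    rw [hasLetter_of_part_eq hT rfl, hasLetter_of_part_eq (columnTableau_mem ha) rfl]
  · refine iff_of_false ?_ ?_
    · rintro ⟨r, hr⟩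
      have := hT.1 r c
      omega
    · rintro ⟨r, hr⟩
      have := (columnTableau_mem ha).1 r c
      omega

theorem dCoeff_self_ne_zero (ha : Antitone Λ.comp) : dCoeff Λ Λ ≠ 0 := by
  rw [dCoeff, tableaux_self ha, finsum_mem_singleton]
  exact pow_ne_zero _ t_ne_zero

end Triangular

/-! ### The dual `m`-symmetric Schur functions -/

section Dual

variable {m : ℕ}

theorem swapComp_sum (i : ℕ) (hi : i + 1 < m) (a : Fin m → ℕ) :
    ∑ j, swapComp i hi a j = ∑ j, a j :=
  Equiv.sum_comp (Equiv.swap (⟨i, by omega⟩ : Fin m) ⟨i + 1, hi⟩) a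

theorem MPartition.size_swap (i : ℕ) (hi : i + 1 < m) (Λ : MPartition m) :
    (Λ.swap i hi).size = Λ.size := by
  rw [MPartition.size, MPartition.size]
  exact congrArg (· + _) (swapComp_sum i hi Λ.comp)

theorem finite_support_dCoeff (Λ : MPartition m) : (Function.support (dCoeff Λ)).Finite :=
  (finite_size_le m Λ.size).subset fun _ hΩ => (triangular_of_dCoeff_ne_zero hΩ).1.le

theorem dualSchur_of_dominant {Λ : MPartition m} (h : Dominant Λ.comp) :
    dualSchur Λ = ∑ᶠ Ω, dCoeff Λ Ω • kFun Ω := by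
  rw [dualSchur, dif_neg h]

theorem exists_dualSchur_eq {Λ : MPartition m} (h : ¬Dominant Λ.comp) :
    ∃ i, ∃ hi : i + 1 < m, Λ.comp ⟨i, by omega⟩ < Λ.comp ⟨i + 1, hi⟩ ∧
      dualSchur Λ = t⁻¹ • heckeTStar i hi (dualSchur (Λ.swap i hi)) := by
  have h' := not_not.1 h
  refine ⟨h'.choose, h'.choose_spec.choose, h'.choose_spec.choose_spec, ?_⟩
  conv_lhs => rw [dualSchur, dif_pos h']

theorem coord_dualSchur {Λ : MPartition m} (h : Dominant Λ.comp) (Ω : MPartition m) :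
    (kBasis m).coord Ω (dualSchur Λ) = dCoeff Λ Ω := by
  classical
  have hs : (Function.support fun Ω => dCoeff Λ Ω • kFun Ω).Finite :=
    (finite_support_dCoeff Λ).subset fun Ω hΩ h0 => hΩ (by
      change dCoeff Λ Ω • kFun Ω = 0
      rw [show dCoeff Λ Ω = 0 from h0, zero_smul])
  rw [dualSchur_of_dominant h, ← LinearMap.toAddMonoidHom_coe, AddMonoidHom.map_finsum _ hs]
  simp only [LinearMap.toAddMonoidHom_coe, map_smul, kBasis_coord, smul_eq_mul, mul_ite, mul_one,
    mul_zero]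
  rw [finsum_eq_single _ Ω fun Ω' hne => if_neg hne.symm, if_pos rfl]

theorem coord_heckeTStar (i : ℕ) (hi : i + 1 < m) (Ω : MPartition m) (f : SymRing m) :
    (kBasis m).coord Ω (heckeTStar i hi f) = scalarProduct m (heckeT i hi (kFun Ω)) f := by
  rw [← scalarProduct_kFun_left, isHeckeAdjoint_heckeTStar]

/-- The coordinates of `s^*_Λ` at `k_Ω` and `k_{s_i Ω}` differ by the factor `t`. -/
theorem heckeTStar_dualSchur_of_dominant {Λ : MPartition m} (h : Dominant Λ.comp) (i : ℕ)
    (hi : i + 1 < m) (hai : Λ.comp ⟨i, by omega⟩ = Λ.comp ⟨i + 1, hi⟩) :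
    heckeTStar i hi (dualSchur Λ) = t • dualSchur Λ := by
  refine (kBasis m).ext_elem fun Ω => ?_
  rw [← Module.Basis.coord_apply, ← Module.Basis.coord_apply, coord_heckeTStar, map_smul,
    coord_dualSchur h, smul_eq_mul]
  have hk : ∀ Ω, scalarProduct m (kFun Ω) (dualSchur Λ) = dCoeff Λ Ω := fun Ω => by
    rw [scalarProduct_kFun_left, coord_dualSchur h]
  rcases lt_trichotomy (Ω.comp ⟨i, by omega⟩) (Ω.comp ⟨i + 1, hi⟩) with hb | hb | hb
  · have h1 := dCoeff_swap (Ω := Ω.swap i hi) i hi hai h.antitone (by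
      rwa [MPartition.comp_swap_left, MPartition.comp_swap_right])
    rw [MPartition.swap_swap] at h1
    rw [heckeT_kFun_of_lt i hi Ω hb, map_add, map_smul, map_smul, LinearMap.add_apply,
      LinearMap.smul_apply, LinearMap.smul_apply, hk, hk, smul_eq_mul, smul_eq_mul, ← h1]
    ring
  · rw [heckeT_kFun_of_eq i hi Ω hb, map_smul, LinearMap.smul_apply, hk, smul_eq_mul]
  · rw [heckeT_kFun_of_gt i hi Ω hb, hk, dCoeff_swap i hi hai h.antitone hb]

theorem dualSchur_recursion (lam : YoungDiagram) (a : Fin m → ℕ) :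
    (∀ i (hi : i + 1 < m), a ⟨i, by omega⟩ < a ⟨i + 1, hi⟩ →
      dualSchur ⟨a, lam⟩ = t⁻¹ • heckeTStar i hi (dualSchur ⟨swapComp i hi a, lam⟩)) ∧
    (∀ i (hi : i + 1 < m), a ⟨i, by omega⟩ = a ⟨i + 1, hi⟩ →
      t⁻¹ • heckeTStar i hi (dualSchur ⟨a, lam⟩) = (1 : QT) • dualSchur ⟨a, lam⟩) := by
  refine ascent_recursion
    (fun i hi => (t⁻¹ : QT) • (heckeTStar i hi : SymRing m →ₗ[QT] SymRing m)) ?_ ?_ 1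
    (fun a => dualSchur ⟨a, lam⟩) ?_ (fun a h => exists_dualSchur_eq (Λ := ⟨a, lam⟩) h) a
  · intro i j hi hj hij v
    simp only [LinearMap.smul_apply, map_smul]
    rw [heckeTStar_comm i j hi hj hij]
  · intro i hi v
    simp only [LinearMap.smul_apply, map_smul]
    rw [heckeTStar_braid i hi]
  · intro a h i hi hai
    rw [LinearMap.smul_apply, heckeTStar_dualSchur_of_dominant (Λ := ⟨a, lam⟩) h i hi hai,
      smul_smul, inv_mul_cancel₀ t_ne_zero]

theorem heckeTStar_dualSchur_of_gt (i : ℕ) (hi : i + 1 < m) (Λ : MPartition m)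
    (h : Λ.comp ⟨i + 1, hi⟩ < Λ.comp ⟨i, by omega⟩) :
    heckeTStar i hi (dualSchur Λ) = t • dualSchur (Λ.swap i hi) := by
  have h1 := (dualSchur_recursion Λ.part (swapComp i hi Λ.comp)).1 i hi (by
    rwa [swapComp_left, swapComp_right])
  rw [swapComp_swapComp] at h1
  rw [MPartition.swap, h1, smul_smul, mul_inv_cancel₀ t_ne_zero, one_smul]

theorem heckeTStar_dualSchur_of_eq (i : ℕ) (hi : i + 1 < m) (Λ : MPartition m)
    (h : Λ.comp ⟨i, by omega⟩ = Λ.comp ⟨i + 1, hi⟩) :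
    heckeTStar i hi (dualSchur Λ) = t • dualSchur Λ := by
  have h1 := (dualSchur_recursion Λ.part Λ.comp).2 i hi h
  rw [one_smul] at h1
  calc heckeTStar i hi (dualSchur Λ)
      = t • t⁻¹ • heckeTStar i hi (dualSchur Λ) := by
        rw [smul_smul, mul_inv_cancel₀ t_ne_zero, one_smul]
    _ = t • dualSchur Λ := congrArg (t • ·) h1

theorem heckeTStar_dualSchur_of_lt (i : ℕ) (hi : i + 1 < m) (Λ : MPartition m)
    (h : Λ.comp ⟨i, by omega⟩ < Λ.comp ⟨i + 1, hi⟩) :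
    heckeTStar i hi (dualSchur Λ) = (t - 1) • dualSchur Λ + dualSchur (Λ.swap i hi) := by
  have h1 := heckeTStar_dualSchur_of_gt i hi (Λ.swap i hi) (by
    rwa [MPartition.comp_swap_left, MPartition.comp_swap_right])
  rw [MPartition.swap_swap] at h1
  have h2 := heckeTStar_quadratic i hi (dualSchur (Λ.swap i hi))
  rw [h1, map_smul, smul_comm, ← smul_add] at h2
  exact smul_right_injective _ t_ne_zero h2

/-- Triangularity of the expansion of `f` in the basis of the `k_Ω`: the coordinate at `k_Λ` does not
vanish, and the other coordinates that do not vanish belong to `m`-partitions of the same size with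
a smaller sum of `b`. -/
def IsTriangularAt (Λ : MPartition m) (f : SymRing m) : Prop :=
  (kBasis m).coord Λ f ≠ 0 ∧ ∀ Ω, (kBasis m).coord Ω f ≠ 0 →
    Ω.size = Λ.size ∧ (Ω = Λ ∨ ∑ i, Ω.comp i < ∑ i, Λ.comp i)

theorem coord_heckeTStar_eq (i : ℕ) (hi : i + 1 < m) (Ω : MPartition m) (f : SymRing m) :
    ∃ u v : QT, (kBasis m).coord Ω (heckeTStar i hi f) =
      u * (kBasis m).coord Ω f + v * (kBasis m).coord (Ω.swap i hi) f := by
  rw [coord_heckeTStar, ← scalarProduct_kFun_left, ← scalarProduct_kFun_left]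
  rcases lt_trichotomy (Ω.comp ⟨i, by omega⟩) (Ω.comp ⟨i + 1, hi⟩) with hb | hb | hb
  · refine ⟨t - 1, t, ?_⟩
    rw [heckeT_kFun_of_lt i hi Ω hb, map_add, map_smul, map_smul]
    rfl
  · refine ⟨t, 0, ?_⟩
    rw [heckeT_kFun_of_eq i hi Ω hb, map_smul, zero_mul, add_zero]
    rfl
  · refine ⟨0, 1, ?_⟩
    rw [heckeT_kFun_of_gt i hi Ω hb, zero_mul, one_mul, zero_add]

/-- The coordinates of `T_i^* f` at `k_Ω` and `k_{s_i Ω}` are combinations of those of `f`, and neither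
the size nor the sum of `b` changes under `s_i`. -/
theorem isTriangularAt_heckeTStar (i : ℕ) (hi : i + 1 < m) {Λ : MPartition m}
    (hlt : Λ.comp ⟨i, by omega⟩ < Λ.comp ⟨i + 1, hi⟩) {f : SymRing m}
    (h : IsTriangularAt (Λ.swap i hi) f) : IsTriangularAt Λ (t⁻¹ • heckeTStar i hi f) := by
  have hne : Λ ≠ Λ.swap i hi := by
    intro he
    have := congrArg (fun M : MPartition m => M.comp ⟨i, by omega⟩) he
    simp only [MPartition.comp_swap_left] at this
    omega
  have hsum : ∀ Ω : MPartition m, ∑ j, (Ω.swap i hi).comp j = ∑ j, Ω.comp j :=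
    fun Ω => swapComp_sum i hi Ω.comp
  obtain ⟨h1, h2⟩ := h
  rw [MPartition.size_swap, hsum] at h2
  have h0 : (kBasis m).coord Λ f = 0 := by
    by_contra h'
    rcases (h2 Λ h').2 with h3 | h3
    · exact hne h3
    · exact lt_irrefl _ h3
  refine ⟨?_, fun Ω hΩ => ?_⟩
  · rw [map_smul, coord_heckeTStar, heckeT_kFun_of_lt i hi Λ hlt, map_add, map_smul, map_smul,
      LinearMap.add_apply, LinearMap.smul_apply, LinearMap.smul_apply, scalarProduct_kFun_left,
      scalarProduct_kFun_left, h0, smul_zero, zero_add, smul_smul, inv_mul_cancel₀ t_ne_zero,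
      one_smul]
    exact h1
  · rw [map_smul] at hΩ
    have hΩ' := right_ne_zero_of_smul hΩ
    by_cases hs : Ω = Λ.swap i hi
    · refine (hΩ' ?_).elim
      rw [hs, coord_heckeTStar, heckeT_kFun_of_gt i hi _ (by
        rwa [MPartition.comp_swap_left, MPartition.comp_swap_right]), MPartition.swap_swap,
        scalarProduct_kFun_left, h0]
    · obtain ⟨u, v, huv⟩ := coord_heckeTStar_eq i hi Ω f
      rw [huv] at hΩ'
      by_cases hf : (kBasis m).coord Ω f = 0
      · rw [hf, mul_zero, zero_add] at hΩ'
        obtain ⟨h3, h4⟩ := h2 _ (right_ne_zero_of_mul hΩ')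
        rw [MPartition.size_swap, hsum] at *
        refine ⟨h3, h4.imp (fun h5 => ?_) id⟩
        rw [← Ω.swap_swap i hi, h5, MPartition.swap_swap]
      · obtain ⟨h3, h4⟩ := h2 _ hf
        exact ⟨h3, Or.inr (h4.resolve_left hs)⟩

theorem isTriangularAt_dualSchur (Λ : MPartition m) : IsTriangularAt Λ (dualSchur Λ) := by
  induction hn : ∑ j : Fin m, (j : ℕ) * Λ.comp j using Nat.strong_induction_on generalizing Λ with
  | _ n ih =>
    by_cases h : Dominant Λ.comp
    · refine ⟨?_, fun Ω hΩ => ?_⟩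
      · rw [coord_dualSchur h]
        exact dCoeff_self_ne_zero h.antitone
      · rw [coord_dualSchur h] at hΩ
        exact triangular_of_dCoeff_ne_zero hΩ
    · obtain ⟨i, hi, hlt, he⟩ := exists_dualSchur_eq h
      rw [he]
      exact isTriangularAt_heckeTStar i hi hlt
        (ih _ (hn ▸ weight_swapComp_lt i hi Λ.comp hlt) (Λ.swap i hi) rfl)

theorem linearIndependent_dualSchur (m : ℕ) :
    LinearIndependent QT (dualSchur : MPartition m → SymRing m) := by
  refine linearIndependent_of_triangular _ (fun Λ => (kBasis m).coord Λ)
    (fun Λ => ∑ i, Λ.comp i) (fun Λ => (isTriangularAt_dualSchur Λ).1) fun Λ Ω hne hle => ?_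
  by_contra h
  rcases ((isTriangularAt_dualSchur Λ).2 Ω h).2 with h1 | h1
  · exact hne h1.symm
  · omega

/-- The inverse of the transition matrix respects the size as well. -/
theorem kFun_mem_span_dualSchur (Λ : MPartition m) :
    kFun Λ ∈ Submodule.span QT (dualSchur '' {Ω : MPartition m | Ω.size = Λ.size}) := by
  induction hn : ∑ j, Λ.comp j using Nat.strong_induction_on generalizing Λ with
  | _ n ih =>
    classical
    obtain ⟨h1, h2⟩ := isTriangularAt_dualSchur Λ
    have hrepr := (kBasis m).linearCombination_repr (dualSchur Λ)
    rw [Finsupp.linearCombination_apply, Finsupp.sum] at hrepr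
    have hmem : Λ ∈ ((kBasis m).repr (dualSchur Λ)).support := Finsupp.mem_support_iff.2 h1
    rw [← Finset.add_sum_erase _ _ hmem, ← eq_sub_iff_add_eq] at hrepr
    have hk : (kBasis m).repr (dualSchur Λ) Λ • kFun Λ ∈
        Submodule.span QT (dualSchur '' {Ω : MPartition m | Ω.size = Λ.size}) := by
      rw [← kBasis_apply, hrepr]
      refine Submodule.sub_mem _ (Submodule.subset_span ⟨Λ, rfl, rfl⟩)
        (Submodule.sum_mem _ fun Ω hΩ => Submodule.smul_mem _ _ ?_)
      rw [Finset.mem_erase, Finsupp.mem_support_iff] at hΩ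
      obtain ⟨h3, h4⟩ := h2 Ω hΩ.2
      rw [kBasis_apply, ← h3]
      exact ih _ (hn ▸ h4.resolve_left hΩ.1) Ω rfl
    exact (Submodule.smul_mem_iff _ h1).1 hk

/-- The basis of the `s^*_Λ`. -/
noncomputable def dualBasis (m : ℕ) : Module.Basis (MPartition m) QT (SymRing m) :=
  Module.Basis.mk (linearIndependent_dualSchur m) (by
    rw [← (kBasis m).span_eq, Submodule.span_le]
    rintro _ ⟨Λ, rfl⟩
    rw [kBasis_apply]
    exact Submodule.span_mono (Set.image_subset_range _ _) (kFun_mem_span_dualSchur Λ))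

theorem dualBasis_apply (Λ : MPartition m) : dualBasis m Λ = dualSchur Λ :=
  Module.Basis.mk_apply _ _ _

theorem coord_dualBasis_kFun {Λ Ω : MPartition m} (h : Λ.size ≠ Ω.size) :
    (dualBasis m).coord Λ (kFun Ω) = 0 := by
  classical
  have hle : Submodule.span QT (dualSchur '' {M : MPartition m | M.size = Ω.size}) ≤
      LinearMap.ker ((dualBasis m).coord Λ) := by
    rw [Submodule.span_le]
    rintro _ ⟨M, hM, rfl⟩
    rw [SetLike.mem_coe, LinearMap.mem_ker, ← dualBasis_apply, Module.Basis.coord_apply,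
      Module.Basis.repr_self, Finsupp.single_apply, if_neg]
    rintro rfl
    exact h hM
  exact hle (kFun_mem_span_dualSchur Ω)

end Dual

/-! ### The `m`-symmetric Schur functions -/

section Schur

variable {m : ℕ}

/-- The linear form dual to `s^*_Λ` has finitely many nonzero values on the `k_Ω`, as it respects
the degree; hence it is the scalar product with an element of `R_m`. -/
theorem exists_isMSchurFamily (m : ℕ) : ∃ s, IsMSchurFamily m s := by
  classical
  have hfin : ∀ Λ : MPartition m, {Ω : MPartition m | Ω.size ≤ Λ.size}.Finite :=
    fun Λ => finite_size_le m Λ.size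
  refine ⟨fun Λ => ∑ Ω ∈ (hfin Λ).toFinset, (dualBasis m).coord Λ (kFun Ω) • kFun Ω,
    fun Λ Ω => ?_⟩
  have h : scalarProduct m
      (∑ M ∈ (hfin Λ).toFinset, (dualBasis m).coord Λ (kFun M) • kFun M) =
        (dualBasis m).coord Λ := by
    refine (kBasis m).ext fun M => ?_
    rw [map_sum, LinearMap.sum_apply, kBasis_apply]
    simp only [map_smul, LinearMap.smul_apply, isScalarProduct_scalarProduct m _ M, smul_eq_mul,
      mul_ite, mul_one, mul_zero, Finset.sum_ite_eq']
    split_ifs with hM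
    · rfl
    · refine (coord_dualBasis_kFun fun he => hM ?_).symm
      rw [Set.Finite.mem_toFinset]
      exact he.ge
  rw [h, ← dualBasis_apply, Module.Basis.coord_apply, Module.Basis.repr_self,
    Finsupp.single_apply]
  exact if_congr eq_comm rfl rfl

theorem eq_of_scalarProduct_dualSchur {f g : SymRing m}
    (h : ∀ Ω, scalarProduct m f (dualSchur Ω) = scalarProduct m g (dualSchur Ω)) : f = g := by
  have hfg : scalarProduct m f = scalarProduct m g :=
    (dualBasis m).ext fun Ω => by rw [dualBasis_apply, h]
  refine eq_of_scalarProduct_right fun v => ?_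
  rw [scalarProduct_comm v, scalarProduct_comm v, hfg]

theorem existsUnique_isMSchurFamily (m : ℕ) : ∃! s, IsMSchurFamily m s := by
  obtain ⟨s, hs⟩ := exists_isMSchurFamily m
  exact ⟨s, hs, fun s' hs' => funext fun Λ =>
    eq_of_scalarProduct_dualSchur fun Ω => (hs' Λ Ω).trans (hs Λ Ω).symm⟩

theorem isMSchurFamily_mSchur (m : ℕ) : IsMSchurFamily m mSchur :=
  Classical.epsilon_spec (existsUnique_isMSchurFamily m).exists

theorem scalarProduct_heckeT_mSchur (i : ℕ) (hi : i + 1 < m) (Λ Ω : MPartition m) :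
    scalarProduct m (heckeT i hi (mSchur Λ)) (dualSchur Ω) =
      scalarProduct m (mSchur Λ) (heckeTStar i hi (dualSchur Ω)) :=
  isHeckeAdjoint_heckeTStar i hi _ _

/-- Both sides have the same scalar products with all `s^*_Ω`. -/
theorem heckeT_mSchur_of_gt (i : ℕ) (hi : i + 1 < m) (Λ : MPartition m)
    (h : Λ.comp ⟨i + 1, hi⟩ < Λ.comp ⟨i, by omega⟩) :
    heckeT i hi (mSchur Λ) = mSchur (Λ.swap i hi) := by
  classical
  refine eq_of_scalarProduct_dualSchur fun Ω => ?_
  have hs : ∀ Λ Ω : MPartition m, scalarProduct m (mSchur Λ) (dualSchur Ω) =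
      if Λ = Ω then 1 else 0 := fun Λ Ω =>
    (isMSchurFamily_mSchur m Λ Ω).trans (if_congr Iff.rfl rfl rfl)
  have hsw : Λ.swap i hi = Ω ↔ Λ = Ω.swap i hi :=
    ⟨fun e => by rw [← e, MPartition.swap_swap], fun e => by rw [e, MPartition.swap_swap]⟩
  have hval : Λ = Ω.swap i hi → Ω.comp ⟨i, by omega⟩ < Ω.comp ⟨i + 1, hi⟩ := by
    rintro rfl
    rwa [MPartition.comp_swap_left, MPartition.comp_swap_right] at h
  rw [scalarProduct_heckeT_mSchur, hs, hsw]
  rcases lt_trichotomy (Ω.comp ⟨i, by omega⟩) (Ω.comp ⟨i + 1, hi⟩) with hb | hb | hb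
  · rw [heckeTStar_dualSchur_of_lt i hi Ω hb, map_add, map_smul, hs, hs,
      if_neg (show Λ ≠ Ω by rintro rfl; exact lt_asymm h hb), smul_zero, zero_add]
  · rw [heckeTStar_dualSchur_of_eq i hi Ω hb, map_smul, hs,
      if_neg (show Λ ≠ Ω by rintro rfl; exact h.ne' hb), smul_zero,
      if_neg fun e => (hval e).ne hb]
  · rw [heckeTStar_dualSchur_of_gt i hi Ω hb, map_smul, hs, if_neg fun e => lt_asymm (hval e) hb,
      smul_zero]

theorem heckeT_mSchur_of_lt (i : ℕ) (hi : i + 1 < m) (Λ : MPartition m)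
    (h : Λ.comp ⟨i, by omega⟩ < Λ.comp ⟨i + 1, hi⟩) :
    heckeT i hi (mSchur Λ) = (t - 1) • mSchur Λ + t • mSchur (Λ.swap i hi) := by
  have h1 := heckeT_mSchur_of_gt i hi (Λ.swap i hi) (by
    rwa [MPartition.comp_swap_left, MPartition.comp_swap_right])
  rw [MPartition.swap_swap] at h1
  have h2 := heckeT_quadratic i hi (mSchur (Λ.swap i hi))
  rwa [h1] at h2

theorem heckeT_mSchur_of_eq (i : ℕ) (hi : i + 1 < m) (Λ : MPartition m)
    (h : Λ.comp ⟨i, by omega⟩ = Λ.comp ⟨i + 1, hi⟩) :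
    heckeT i hi (mSchur Λ) = t • mSchur Λ := by
  classical
  refine eq_of_scalarProduct_dualSchur fun Ω => ?_
  have hs : ∀ Λ Ω : MPartition m, scalarProduct m (mSchur Λ) (dualSchur Ω) =
      if Λ = Ω then 1 else 0 := fun Λ Ω =>
    (isMSchurFamily_mSchur m Λ Ω).trans (if_congr Iff.rfl rfl rfl)
  have hne : Ω.comp ⟨i, by omega⟩ ≠ Ω.comp ⟨i + 1, hi⟩ → Λ ≠ Ω ∧ Λ ≠ Ω.swap i hi := by
    refine fun hb => ⟨fun e => hb (e ▸ h), fun e => hb ?_⟩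
    rw [e, MPartition.comp_swap_left, MPartition.comp_swap_right] at h
    exact h.symm
  rw [scalarProduct_heckeT_mSchur, map_smul, LinearMap.smul_apply]
  rcases lt_trichotomy (Ω.comp ⟨i, by omega⟩) (Ω.comp ⟨i + 1, hi⟩) with hb | hb | hb
  · rw [heckeTStar_dualSchur_of_lt i hi Ω hb, map_add, map_smul, hs, hs, if_neg (hne hb.ne).1,
      if_neg (hne hb.ne).2, smul_zero, smul_zero, add_zero]
  · rw [heckeTStar_dualSchur_of_eq i hi Ω hb, map_smul]
  · rw [heckeTStar_dualSchur_of_gt i hi Ω hb, map_smul, hs, hs, if_neg (hne hb.ne').1,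
      if_neg (hne hb.ne').2]

end Schur

end MSymmetric

theorem mainTheorem6 (m : ℕ) :
    -- the scalar product, the adjoints and the `m`-symmetric Schur functions are well defined
    (∃! B, MSymmetric.IsScalarProduct m B) ∧
    (∀ (i : ℕ) (hi : i + 1 < m), ∃! S, MSymmetric.IsHeckeAdjoint i hi S) ∧
    (∃! s, MSymmetric.IsMSchurFamily m s) ∧
    ∀ (i : ℕ) (hi : i + 1 < m) (Λ : MSymmetric.MPartition m),
      -- the action of `T_i` on `k_Λ`
      (Λ.comp ⟨i + 1, hi⟩ < Λ.comp ⟨i, by omega⟩ →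
        MSymmetric.heckeT i hi (MSymmetric.kFun Λ) = MSymmetric.kFun (Λ.swap i hi)) ∧
      (Λ.comp ⟨i, by omega⟩ < Λ.comp ⟨i + 1, hi⟩ →
        MSymmetric.heckeT i hi (MSymmetric.kFun Λ) =
          (MSymmetric.t - 1) • MSymmetric.kFun Λ +
            MSymmetric.t • MSymmetric.kFun (Λ.swap i hi)) ∧
      (Λ.comp ⟨i, by omega⟩ = Λ.comp ⟨i + 1, hi⟩ →
        MSymmetric.heckeT i hi (MSymmetric.kFun Λ) = MSymmetric.t • MSymmetric.kFun Λ) ∧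
      -- the action of `T_i^*` on `s^*_Λ`
      (Λ.comp ⟨i + 1, hi⟩ < Λ.comp ⟨i, by omega⟩ →
        MSymmetric.heckeTStar i hi (MSymmetric.dualSchur Λ) =
          MSymmetric.t • MSymmetric.dualSchur (Λ.swap i hi)) ∧
      (Λ.comp ⟨i, by omega⟩ < Λ.comp ⟨i + 1, hi⟩ →
        MSymmetric.heckeTStar i hi (MSymmetric.dualSchur Λ) =
          (MSymmetric.t - 1) • MSymmetric.dualSchur Λ + MSymmetric.dualSchur (Λ.swap i hi)) ∧
      (Λ.comp ⟨i, by omega⟩ = Λ.comp ⟨i + 1, hi⟩ →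
        MSymmetric.heckeTStar i hi (MSymmetric.dualSchur Λ) =
          MSymmetric.t • MSymmetric.dualSchur Λ) ∧
      -- the action of `T_i` on `s_Λ`
      (Λ.comp ⟨i + 1, hi⟩ < Λ.comp ⟨i, by omega⟩ →
        MSymmetric.heckeT i hi (MSymmetric.mSchur Λ) = MSymmetric.mSchur (Λ.swap i hi)) ∧
      (Λ.comp ⟨i, by omega⟩ < Λ.comp ⟨i + 1, hi⟩ →
        MSymmetric.heckeT i hi (MSymmetric.mSchur Λ) =
          (MSymmetric.t - 1) • MSymmetric.mSchur Λ +
            MSymmetric.t • MSymmetric.mSchur (Λ.swap i hi)) ∧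
      (Λ.comp ⟨i, by omega⟩ = Λ.comp ⟨i + 1, hi⟩ →
        MSymmetric.heckeT i hi (MSymmetric.mSchur Λ) = MSymmetric.t • MSymmetric.mSchur Λ) ∧
      -- in particular, `s_Λ` is symmetric in `x_i, x_{i+1}` if `a_i = a_{i+1}`
      (Λ.comp ⟨i, by omega⟩ = Λ.comp ⟨i + 1, hi⟩ →
        MSymmetric.swapVar i hi (MSymmetric.mSchur Λ) = MSymmetric.mSchur Λ) := by
  refine ⟨MSymmetric.existsUnique_isScalarProduct m, MSymmetric.existsUnique_isHeckeAdjoint,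
    MSymmetric.existsUnique_isMSchurFamily m, fun i hi Λ =>
      ⟨MSymmetric.heckeT_kFun_of_gt i hi Λ, MSymmetric.heckeT_kFun_of_lt i hi Λ,
        MSymmetric.heckeT_kFun_of_eq i hi Λ, MSymmetric.heckeTStar_dualSchur_of_gt i hi Λ,
        MSymmetric.heckeTStar_dualSchur_of_lt i hi Λ, MSymmetric.heckeTStar_dualSchur_of_eq i hi Λ,
        MSymmetric.heckeT_mSchur_of_gt i hi Λ, MSymmetric.heckeT_mSchur_of_lt i hi Λ,
        MSymmetric.heckeT_mSchur_of_eq i hi Λ, fun h =>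
          MSymmetric.swapVar_eq_of_heckeT_eq i hi _ (MSymmetric.heckeT_mSchur_of_eq i hi Λ h)⟩⟩
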